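/- Let $(M,g)$ be a closed (compact, without boundary) smooth Riemannian manifold of dimension $n$, let $s\ge 0$ and $1\le p<\infty$ be real. **Groups.** For an open subset $U$ of a manifold, $\mathrm{Diff}_c(U)$ denotes the connected component of the identity in the group of smooth compactly supported diffeomorphisms of $U$, i.e. the set of diffeomorphisms that are joined to the identity by a smooth path of diffeomorphisms supported in a common compact subset of $U$ (they are extended by the identity outside $U$). $\mathrm{Diff}(M)=\mathrm{Diff}_c(M)$. **Sobolev norms.** Write $s=k+\sigma$ with $k\in\mathbb N=\{0,1,2,\dots\}$, $\sigma\in[0,1)$. For a smooth compactly supported $f:\mathbb R^n\to\mathbb R^n$ put $$\|f\|_{W^{s,p}(\mathbb R^n)}=\sum_{j=0}^{k}\|D^jf\|_{L^p}+\Big(\iint_{\mathbb R^n\times\mathbb R^n}\frac{|D^kf(x)-D^kf(y)|^p}{|x-y|^{n+\sigma p}}\,dx\,dy\Big)^{1/p},$$ where the last term is omitted if $\sigma=0$. A *normal ball* in $M$ is a geodesic ball $B_\varepsilon(x)$ on which normal coordinates are defined, i.e. $\exp_x$ (with $T_xM$ identified isometrically with $\mathbb R^n$) is a diffeomorphism of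 the Euclidean ball of radius $\varepsilon$ about $0$ onto $B_\varepsilon(x)$. Given a finite cover of $M$ by normal balls $B_{\varepsilon_\alpha}(x_\alpha)$ and a smooth partition of unity $(\rho_\alpha)$ subordinate to it, the $W^{s,p}$-norm of a smooth vector field $u$ on $M$ is $$\|u\|_{W^{s,p}(M)}=\Big(\sum_\alpha\|\exp_{x_\alpha}^*(\rho_\alpha u)\|_{W^{s,p}(\mathbb R^n)}^2\Big)^{1/2},$$ where $\exp_{x_\alpha}^*(\rho_\alpha u)$ is the vector field $\rho_\alpha u$ written in the normal coordinates of $B_{\varepsilon_\alpha}(x_\alpha)$ and extended by zero. Vector fields compactly supported in the unit ball $B$ of $\mathbb R^n$ carry the norm of $W^{s,p}(\mathbb R^n)$. **Distance and diameter.** The geodesic distance of the corresponding right-invariant Finsler metric is $$\mathrm{dist}_{s,p}(\varphi_0,\varphi_1)=\inf_{\varphi}\int_0^1\|\partial_t\varphi_t\circ\varphi_t^{-1}\|_{W^{s,p}}\,dt,$$ the infimum being over all smooth paths $(\varphi_t)_{t\in[0,1]}$ from $\varphi_0$ to $\varphi_1$ in the group, and $\mathrm{diam}_{s,p}$ is the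 supremum of $\mathrm{dist}_{s,p}(\varphi_0,\varphi_1)$ over all $\varphi_0,\varphi_1$ in the group. **Uniform fragmentation.** $\mathrm{Diff}(M)$ has the uniform fragmentation property with respect to a finite cover of $M$ by normal balls $A_1,\dots,A_m$ if there is an integer $K>0$ such that every $\varphi\in\mathrm{Diff}(M)$ is a composition of $K$ diffeomorphisms, each of which belongs to $\mathrm{Diff}_c(A_\alpha)$ for some $\alpha$. **Statement.** Suppose that $\mathrm{Diff}(M)$ has the uniform fragmentation property with respect to some finite cover of $M$ by normal balls, and that $\mathrm{diam}_{s,p}\mathrm{Diff}_c(B)<\infty$, where $B$ is the unit ball of $\mathbb R^n$. Then $\mathrm{diam}_{s,p}\mathrm{Diff}(M)<\infty$, whichever finite cover by normal balls and subordinate partition of unity are used to define the $W^{s,p}$-norm on $M$. -/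

import Mathlib

open Set MeasureTheory Metric Bundle
open scoped Manifold ContDiff ENNReal InnerProductSpace

noncomputable section

/-- Euclidean `n`-space, which is also the model space of all the manifolds below. -/
abbrev Euc (n : ℕ) : Type := EuclideanSpace ℝ (Fin n)

/-! ### Sobolev (Slobodeckij) norms on Euclidean space -/

/-- The Gagliardo seminorm of order `k + σ` (with `σ ∈ (0,1)`):
`(∬ |D^k f(x) - D^k f(y)|^p / |x - y|^(n + σ p) dx dy)^(1/p)`. -/
def gagliardoSeminorm {n : ℕ} {F : Type*} [NormedAddCommGroup F] [NormedSpace ℝ F]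
    (k : ℕ) (σ p : ℝ) (f : Euc n → F) : ℝ≥0∞ :=
  (∫⁻ x, ∫⁻ y, ‖iteratedFDeriv ℝ k f x - iteratedFDeriv ℝ k f y‖ₑ ^ p /
    ‖x - y‖ₑ ^ ((n : ℝ) + σ * p)) ^ (1 / p)

/-- The `W^{s,p}(ℝⁿ)`-norm of a smooth function, for real `s ≥ 0` and `1 ≤ p < ∞`. With
`k = ⌊s⌋` and `σ = s - k` it is the `W^{k,p}`-norm `∑_{j ≤ k} ‖D^j f‖_{L^p}`, plus the Gagliardo
seminorm of order `k + σ` if `s` is not an integer. It is only evaluated on smooth compactly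
supported functions, for which the classical derivatives are the weak ones. -/
def sobolevNorm {n : ℕ} {F : Type*} [NormedAddCommGroup F] [NormedSpace ℝ F]
    (s p : ℝ) (f : Euc n → F) : ℝ≥0∞ :=
  (∑ j ∈ Finset.range (⌊s⌋₊ + 1), eLpNorm (iteratedFDeriv ℝ j f) (ENNReal.ofReal p) volume) +
    open Classical in
    if s = (⌊s⌋₊ : ℝ) then 0 else gagliardoSeminorm ⌊s⌋₊ (s - (⌊s⌋₊ : ℝ)) p f

/-! ### Diffeomorphism groups and right-invariant geodesic distances -/

section Diffeo

variable {n : ℕ} {N : Type*} [TopologicalSpace N] [ChartedSpace (Euc n) N]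

/-- A smooth path `[0,1] → Diff_c(U)`, `t ↦ Φ t`, for an open subset `U` of the manifold `N`.
Diffeomorphisms of `U` with compact support are identified with their extensions to `N` by the
identity. Smoothness of the path is joint smoothness of `(t, x) ↦ Φ t x`, and the diffeomorphisms
`Φ t`, `t ∈ [0,1]`, are supported in a common compact subset of `U`. The values at `t ∉ [0,1]`
only serve to express smoothness up to the end points. -/
def IsDiffPath (U : Set N) (Φ : ℝ → (N ≃ₘ^∞⟮𝓡 n, 𝓡 n⟯ N)) : Prop :=
  ContMDiff (𝓘(ℝ, ℝ).prod (𝓡 n)) (𝓡 n) ∞ (fun q : ℝ × N => Φ q.1 q.2) ∧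
    ∃ K : Set N, IsCompact K ∧ K ⊆ U ∧ ∀ t ∈ Icc (0 : ℝ) 1, ∀ x ∉ K, Φ t x = x

/-- `Diff_c(U)`: the connected component of the identity of the group of smooth, compactly
supported diffeomorphisms of `U`, that is, the diffeomorphisms which are joined to the identity by
a smooth path of diffeomorphisms supported in a common compact subset of `U`. -/
def DiffC (U : Set N) : Set (N ≃ₘ^∞⟮𝓡 n, 𝓡 n⟯ N) :=
  {φ | ∃ Φ : ℝ → (N ≃ₘ^∞⟮𝓡 n, 𝓡 n⟯ N),
    IsDiffPath U Φ ∧ Φ 0 = Diffeomorph.refl (𝓡 n) N ∞ ∧ Φ 1 = φ}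

/-- The vector field `∂ₜΦ ∘ Φₜ⁻¹` of a path of diffeomorphisms at time `t`. -/
def pathVelocity (Φ : ℝ → (N ≃ₘ^∞⟮𝓡 n, 𝓡 n⟯ N)) (t : ℝ) (y : N) : TangentSpace (𝓡 n) y :=
  mfderiv 𝓘(ℝ, ℝ) (𝓡 n) (fun τ : ℝ => Φ τ ((Φ t).symm y)) t (1 : ℝ)

/-- The length `∫₀¹ ‖∂ₜΦ ∘ Φₜ⁻¹‖ dt` of a path of diffeomorphisms, for the right-invariant
Finsler metric given by a norm on vector fields. -/
def pathLength (norm : (∀ y : N, TangentSpace (𝓡 n) y) → ℝ≥0∞)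
    (Φ : ℝ → (N ≃ₘ^∞⟮𝓡 n, 𝓡 n⟯ N)) : ℝ≥0∞ :=
  ∫⁻ t in Icc (0 : ℝ) 1, norm (pathVelocity Φ t)

/-- The geodesic distance on `Diff_c(U)`: the infimum of the lengths of paths in `Diff_c(U)`. -/
def diffDist (U : Set N) (norm : (∀ y : N, TangentSpace (𝓡 n) y) → ℝ≥0∞)
    (φ₀ φ₁ : N ≃ₘ^∞⟮𝓡 n, 𝓡 n⟯ N) : ℝ≥0∞ :=
  ⨅ (Φ : ℝ → (N ≃ₘ^∞⟮𝓡 n, 𝓡 n⟯ N)) (_ : IsDiffPath U Φ ∧ Φ 0 = φ₀ ∧ Φ 1 = φ₁),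
    pathLength norm Φ

/-- The diameter of `Diff_c(U)` for the geodesic distance. -/
def diffDiam (U : Set N) (norm : (∀ y : N, TangentSpace (𝓡 n) y) → ℝ≥0∞) : ℝ≥0∞ :=
  ⨆ φ₀ ∈ DiffC (n := n) U, ⨆ φ₁ ∈ DiffC (n := n) U, diffDist U norm φ₀ φ₁

end Diffeo

/-! ### Geodesics and normal coordinates -/

section Riemannian

variable {n : ℕ} {M : Type*} [TopologicalSpace M] [ChartedSpace (Euc n) M]
  [IsManifold (𝓡 n) ∞ M]

/-- The coefficients `g_y(v, w)` of the metric `g` in the coordinate chart at `x₀`, at the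
coordinate point `y`. -/
def chartMetric (g : ContMDiffRiemannianMetric (𝓡 n) ∞ (Euc n) (fun x : M => TangentSpace (𝓡 n) x))
    (x₀ : M) (y v w : Euc n) : ℝ :=
  g.inner ((extChartAt (𝓡 n) x₀).symm y)
    (mfderiv 𝓘(ℝ, Euc n) (𝓡 n) (extChartAt (𝓡 n) x₀).symm y v)
    (mfderiv 𝓘(ℝ, Euc n) (𝓡 n) (extChartAt (𝓡 n) x₀).symm y w)

/-- `γ` is an (affinely parametrized) geodesic of `g` on the open set `J` of times: it is smooth
and at each `t ∈ J` it satisfies, in the chart at `γ t`, the geodesic equation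
`d/dt (g_{ij} ċ^j) = ½ ∂_i g_{jk} ċ^j ċ^k`, which is `c̈^i + Γ^i_{jk} ċ^j ċ^k = 0` with the index `i`
lowered (and contracted with an arbitrary vector `w`). -/
def IsGeodesicOn
    (g : ContMDiffRiemannianMetric (𝓡 n) ∞ (Euc n) (fun x : M => TangentSpace (𝓡 n) x))
    (γ : ℝ → M) (J : Set ℝ) : Prop :=
  ContMDiffOn 𝓘(ℝ, ℝ) (𝓡 n) ∞ γ J ∧
    ∀ t ∈ J, ∀ w : Euc n,
      let c : ℝ → Euc n := fun τ => extChartAt (𝓡 n) (γ t) (γ τ)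
      deriv (fun τ => chartMetric g (γ t) (c τ) (deriv c τ) w) t =
        (1 / 2 : ℝ) *
          deriv (fun r : ℝ => chartMetric g (γ t) (c t + r • w) (deriv c t) (deriv c t)) 0

/-- A geodesic ball `B_r(x)` of `(M, g)` on which normal coordinates are defined. The map `coord`
is a diffeomorphism of the Euclidean ball of radius `r` about `0` onto the (open) geodesic ball,
it is the exponential map at its center `x = coord 0`: its derivative at `0` is an isometry onto
`T_x M` and it maps rays from `0` to geodesics. -/
structure NormalBall
    (g : ContMDiffRiemannianMetric (𝓡 n) ∞ (Euc n) (fun x : M => TangentSpace (𝓡 n) x)) where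
  radius : ℝ
  radius_pos : 0 < radius
  coord : OpenPartialHomeomorph (Euc n) M
  source_eq : coord.source = ball 0 radius
  contMDiffOn_coord : ContMDiffOn 𝓘(ℝ, Euc n) (𝓡 n) ∞ coord coord.source
  contMDiffOn_symm : ContMDiffOn (𝓡 n) 𝓘(ℝ, Euc n) ∞ coord.symm coord.target
  isometry_zero : ∀ v w : Euc n,
    g.inner (coord 0) (mfderiv 𝓘(ℝ, Euc n) (𝓡 n) coord 0 v)
      (mfderiv 𝓘(ℝ, Euc n) (𝓡 n) coord 0 w) = ⟪v, w⟫_ℝ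
  isGeodesicOn_ray : ∀ v ∈ ball (0 : Euc n) radius,
    IsGeodesicOn g (fun t : ℝ => coord (t • v)) {t : ℝ | t • v ∈ ball (0 : Euc n) radius}

/-- The open subset of `M` covered by a geodesic ball. -/
def NormalBall.carrier
    {g : ContMDiffRiemannianMetric (𝓡 n) ∞ (Euc n) (fun x : M => TangentSpace (𝓡 n) x)}
    (B : NormalBall g) : Set M :=
  B.coord.target

/-! ### Sobolev norms of vector fields on a manifold -/

/-- The vector field `ρ u` in the normal coordinates of `B`, extended by zero to `ℝⁿ`. -/
def NormalBall.localize
    {g : ContMDiffRiemannianMetric (𝓡 n) ∞ (Euc n) (fun x : M => TangentSpace (𝓡 n) x)}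
    (B : NormalBall g) (ρ : M → ℝ) (u : ∀ y : M, TangentSpace (𝓡 n) y) : Euc n → Euc n :=
  (ball (0 : Euc n) B.radius).indicator fun v =>
    ρ (B.coord v) • (VectorField.mpullback 𝓘(ℝ, Euc n) (𝓡 n) B.coord u v : Euc n)

/-- The `W^{s,p}`-norm of vector fields on `M` given by finitely many geodesic balls and a
partition of unity: `(∑_α ‖(ρ_α u) ∘ exp_{x_α}‖²_{W^{s,p}(ℝⁿ)})^(1/2)`, where vector fields are
read in normal coordinates. -/
def manifoldSobolevNorm
    {g : ContMDiffRiemannianMetric (𝓡 n) ∞ (Euc n) (fun x : M => TangentSpace (𝓡 n) x)}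
    {ι : Type*} [Fintype ι] (B : ι → NormalBall g) (ρ : SmoothPartitionOfUnity ι (𝓡 n) M univ)
    (s p : ℝ) (u : ∀ y : M, TangentSpace (𝓡 n) y) : ℝ≥0∞ :=
  (∑ α, sobolevNorm s p ((B α).localize (ρ α) u) ^ (2 : ℝ)) ^ (1 / 2 : ℝ)

/-! ### Uniform fragmentation -/

/-- The uniform fragmentation property of `Diff(M)` with respect to the balls `B α`: there is
`K > 0` such that every `φ ∈ Diff(M)` is a composition of `K` diffeomorphisms, each of which
belongs to `Diff_c(B α)` for some `α`. -/
def UniformFragmentation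
    {g : ContMDiffRiemannianMetric (𝓡 n) ∞ (Euc n) (fun x : M => TangentSpace (𝓡 n) x)}
    {ι : Type*} (B : ι → NormalBall g) : Prop :=
  ∃ K : ℕ, 0 < K ∧ ∀ φ ∈ DiffC (n := n) (univ : Set M),
    ∃ ψ : Fin K → (M ≃ₘ^∞⟮𝓡 n, 𝓡 n⟯ M),
      (∀ i, ∃ α, ψ i ∈ DiffC (B α).carrier) ∧
        (φ : M → M) = (List.ofFn fun i => (ψ i : M → M)).foldr (fun f h => f ∘ h) id

end Riemannian

end

set_option linter.unusedSectionVars false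
set_option linter.style.haveILetI false

/-! Fragmentation writes each `φ` as a product of `K` diffeomorphisms supported in the balls `A α`,
and lengths of paths are right invariant. So it suffices to join every `ψ` in `DiffC (A α).carrier`
to the identity by a path whose length is bounded independently of `ψ`.

Over a concentric ball of radius `R` smaller than that of `A α` this follows from the hypothesis on
the unit ball. Rescaled normal coordinates conjugate one group into the other, and the velocity
fields are pushed forward. Read in a chart of the norm, a pushed field is a smooth compactly
supported matrix times the original field composed with a coordinate change, and such operators are
bounded on `W^{s,p}` (`IsMultiplier.exists_sobolevNorm_le`, `exists_isReachable_of_diffDiam_lt_top`,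
`NormalBall.exists_isReachable`). Compactness inside the coordinate domain is essential. Normal
coordinates need not be controlled up to the boundary of `A α`, while supports of elements of its
group come arbitrarily close to it.

To gain this room, write `ψ = h⁻¹ (h ψ h⁻¹) h`, where `h` moves the support of `ψ` into a fixed
smaller ball. The point is that `h` costs a bounded amount however large the support is. It is a
product of radial pulls `v ↦ (1 - τ χ j) v` in the coordinates of `A α`, where `χ` is a partition of
unity subordinate to the cover. Each pull is supported in `tsupport (χ j)`, a compact part of `A j`,
so the first case applies to it in the ball `A j`. Pulls are diffeomorphisms for one `τ` that works
up to the boundary, because the radial derivative of `χ j` is bounded there: geodesics have constant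
speed (`IsGeodesicOn.hasDerivAt_energy`, `NormalBall.exists_abs_fderiv_radial_le`). At every point
some `χ j` is at least `1 / m`, so one round of pulls contracts radii by a fixed factor
(`exists_isReachable_pull_list`), and a fixed number of rounds halves them. -/

noncomputable section

/-! ### Sobolev energies -/

/-- The `p`-th power of the `L^p`-norm. -/
def lpEnergy {n : ℕ} {F : Type*} [NormedAddCommGroup F] (p : ℝ) (f : Euc n → F) : ℝ≥0∞ :=
  ∫⁻ x, ‖f x‖ₑ ^ p

/-- The `p`-th power of the Gagliardo seminorm of order `σ`. -/
def gagliardoEnergy {n : ℕ} {F : Type*} [NormedAddCommGroup F] (σ p : ℝ) (f : Euc n → F) : ℝ≥0∞ :=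
  ∫⁻ x, ∫⁻ y, ‖f x - f y‖ₑ ^ p / ‖x - y‖ₑ ^ ((n : ℝ) + σ * p)

open Classical in
/-- The `p`-th power of the fractional part of the Sobolev norm, absent for `σ = 0`. -/
def fracEnergy {n : ℕ} {F : Type*} [NormedAddCommGroup F] (σ p : ℝ) (f : Euc n → F) : ℝ≥0∞ :=
  if σ = 0 then 0 else gagliardoEnergy σ p f

/-- The sum of the `p`-th powers of the constituents of the `W^{k+σ,p}`-norm. -/
def sobolevEnergy {n : ℕ} {F : Type*} [NormedAddCommGroup F] [NormedSpace ℝ F]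
    (k : ℕ) (σ p : ℝ) (f : Euc n → F) : ℝ≥0∞ :=
  (∑ j ∈ Finset.range (k + 1), lpEnergy p (iteratedFDeriv ℝ j f)) +
    fracEnergy σ p (iteratedFDeriv ℝ k f)

section Energies

variable {n : ℕ} {F G : Type*} [NormedAddCommGroup F] [NormedSpace ℝ F]
  [NormedAddCommGroup G] [NormedSpace ℝ G]

theorem gagliardoEnergy_congr_dist {σ p : ℝ} {f : Euc n → F} {g : Euc n → G}
    (h : ∀ x y, ‖f x - f y‖ = ‖g x - g y‖) : gagliardoEnergy σ p f = gagliardoEnergy σ p g := by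
  have h' : ∀ x y, ‖f x - f y‖ₑ = ‖g x - g y‖ₑ := fun x y => by
    rw [← ofReal_norm, ← ofReal_norm, h]
  simp only [gagliardoEnergy, h']

theorem lpEnergy_congr_norm {p : ℝ} {f : Euc n → F} {g : Euc n → G}
    (h : ∀ x, ‖f x‖ = ‖g x‖) : lpEnergy p f = lpEnergy p g := by
  have h' : ∀ x, ‖f x‖ₑ = ‖g x‖ₑ := fun x => by rw [← ofReal_norm, ← ofReal_norm, h]
  simp only [lpEnergy, h']

theorem fracEnergy_congr_dist {σ p : ℝ} {f : Euc n → F} {g : Euc n → G}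
    (h : ∀ x y, ‖f x - f y‖ = ‖g x - g y‖) : fracEnergy σ p f = fracEnergy σ p g := by
  simp only [fracEnergy, gagliardoEnergy_congr_dist h]

theorem sobolevEnergy_zero (σ p : ℝ) (f : Euc n → F) :
    sobolevEnergy 0 σ p f = lpEnergy p f + fracEnergy σ p f := by
  have h0 : ∀ x, iteratedFDeriv ℝ 0 f x = (continuousMultilinearCurryFin0 ℝ (Euc n) F).symm (f x) :=
    fun x => by rw [iteratedFDeriv_zero_eq_comp]; rfl
  simp only [sobolevEnergy, zero_add, Finset.range_one, Finset.sum_singleton]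
  congr 1
  · exact lpEnergy_congr_norm fun x => by rw [h0, LinearIsometryEquiv.norm_map]
  · refine fracEnergy_congr_dist fun x y => ?_
    rw [h0, h0, ← map_sub, LinearIsometryEquiv.norm_map]

/-- Currying a multilinear map is an isometry, so higher derivatives of `f` may be read as
derivatives of `fderiv ℝ f`. This recursion drives all inductions on the order. -/
theorem sobolevEnergy_succ (k : ℕ) (σ p : ℝ) (f : Euc n → F) :
    sobolevEnergy (k + 1) σ p f = lpEnergy p f + sobolevEnergy k σ p (fderiv ℝ f) := by
  have h0 : ∀ x, ‖iteratedFDeriv ℝ 0 f x‖ = ‖f x‖ := fun x => norm_iteratedFDeriv_zero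
  have h1 : lpEnergy p (iteratedFDeriv ℝ 0 f) = lpEnergy p f := lpEnergy_congr_norm h0
  have h2 : ∀ j, lpEnergy p (iteratedFDeriv ℝ (j + 1) f) =
      lpEnergy p (iteratedFDeriv ℝ j (fderiv ℝ f)) :=
    fun j => lpEnergy_congr_norm fun x => norm_iteratedFDeriv_fderiv.symm
  have h3 : fracEnergy σ p (iteratedFDeriv ℝ (k + 1) f) =
      fracEnergy σ p (iteratedFDeriv ℝ k (fderiv ℝ f)) := by
    refine fracEnergy_congr_dist fun x y => ?_
    simp only [iteratedFDeriv_succ_eq_comp_right, Function.comp_apply, ← dist_eq_norm]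
    exact LinearIsometryEquiv.dist_map _ _ _
  rw [sobolevEnergy, Finset.sum_range_succ', h1, h3, sobolevEnergy]
  simp only [h2]
  ring

theorem measurable_enorm_rpow {X : Type*} [TopologicalSpace X] [MeasurableSpace X]
    [OpensMeasurableSpace X] {f : X → F} (hf : Continuous f) (p : ℝ) :
    Measurable fun x => ‖f x‖ₑ ^ p :=
  (hf.enorm.measurable).pow_const p

theorem measurable_gagliardo_integrand {f : Euc n → F} (hf : Continuous f) (p q : ℝ) :
    Measurable fun z : Euc n × Euc n => ‖f z.1 - f z.2‖ₑ ^ p / ‖z.1 - z.2‖ₑ ^ q :=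
  (measurable_enorm_rpow (by fun_prop) p).div (measurable_enorm_rpow (by fun_prop) q)

theorem enorm_add_rpow_le {p : ℝ} (hp : 1 ≤ p) (a b : F) :
    ‖a + b‖ₑ ^ p ≤ 2 ^ (p - 1) * (‖a‖ₑ ^ p + ‖b‖ₑ ^ p) := by
  have hp0 : 0 ≤ p := by linarith
  refine (ENNReal.rpow_le_rpow (enorm_add_le a b) hp0).trans ?_
  exact ENNReal.rpow_add_le_mul_rpow_add_rpow _ _ hp

theorem lpEnergy_add_le {p : ℝ} (hp : 1 ≤ p) {f g : Euc n → F} (hf : Continuous f) :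
    lpEnergy p (f + g) ≤ 2 ^ (p - 1) * (lpEnergy p f + lpEnergy p g) := by
  have h2 : (2 : ℝ≥0∞) ^ (p - 1) ≠ ⊤ := ENNReal.rpow_ne_top_of_nonneg (by linarith) (by simp)
  unfold lpEnergy
  rw [← lintegral_add_left (measurable_enorm_rpow hf p), ← lintegral_const_mul' _ _ h2]
  exact lintegral_mono fun x => enorm_add_rpow_le hp _ _

theorem gagliardoEnergy_add_le {σ p : ℝ} (hp : 1 ≤ p) {f g : Euc n → F} (hf : Continuous f) :
    gagliardoEnergy σ p (f + g) ≤
      2 ^ (p - 1) * (gagliardoEnergy σ p f + gagliardoEnergy σ p g) := by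
  have h2 : (2 : ℝ≥0∞) ^ (p - 1) ≠ ⊤ := ENNReal.rpow_ne_top_of_nonneg (by linarith) (by simp)
  have hm := measurable_gagliardo_integrand hf p ((n : ℝ) + σ * p)
  unfold gagliardoEnergy
  rw [← lintegral_add_left hm.lintegral_prod_right', ← lintegral_const_mul' _ _ h2]
  refine lintegral_mono fun x => ?_
  have hmx : Measurable fun y => ‖f x - f y‖ₑ ^ p / ‖x - y‖ₑ ^ ((n : ℝ) + σ * p) :=
    hm.comp measurable_prodMk_left
  rw [← lintegral_add_left hmx, ← lintegral_const_mul' _ _ h2]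
  refine lintegral_mono fun y => ?_
  simp only [Pi.add_apply]
  rw [← ENNReal.add_div, ← mul_div_assoc]
  gcongr
  rw [add_sub_add_comm]
  exact enorm_add_rpow_le hp _ _

theorem fracEnergy_add_le {σ p : ℝ} (hp : 1 ≤ p) {f g : Euc n → F} (hf : Continuous f) :
    fracEnergy σ p (f + g) ≤ 2 ^ (p - 1) * (fracEnergy σ p f + fracEnergy σ p g) := by
  unfold fracEnergy
  split_ifs
  · simp
  · exact gagliardoEnergy_add_le hp hf

/-- The mass of the kernel that controls the Gagliardo energy of Lipschitz functions. -/
theorem lintegral_kernel_lt_top (n : ℕ) {σ p : ℝ} (hσ : 0 < σ) (hσ1 : σ < 1) (hp : 1 ≤ p) :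
    ∫⁻ z : Euc n, min ‖z‖ₑ 1 ^ p / ‖z‖ₑ ^ ((n : ℝ) + σ * p) < ⊤ := by
  have hp0 : 0 < p := by linarith
  -- Polar coordinates need a nontrivial space; in dimension zero the integrand vanishes.
  rcases Nat.eq_zero_or_pos n with rfl | hn
  · have : ∀ z : Euc 0, z = 0 := fun z => Subsingleton.elim _ _
    have h0 : ∀ z : Euc 0, min ‖z‖ₑ 1 ^ p / ‖z‖ₑ ^ (((0 : ℕ) : ℝ) + σ * p) = 0 := fun z => by
      rw [this z]; simp [hp0]
    simp only [h0, lintegral_zero, ENNReal.zero_lt_top]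
  haveI : Nonempty (Fin n) := ⟨⟨0, hn⟩⟩
  haveI : Nontrivial (Euc n) := inferInstance
  set f : ℝ → ℝ := fun r => min r 1 ^ p / r ^ ((n : ℝ) + σ * p) with hf
  have key : Integrable (fun z : Euc n => f ‖z‖) := by
    rw [integrable_fun_norm_addHaar]
    rw [← Ioc_union_Ioi_eq_Ioi (zero_le_one (α := ℝ))]
    have hfr : Module.finrank ℝ (Euc n) = n := by simp
    rw [hfr]
    refine IntegrableOn.union ?_ ?_
    -- Near the origin the factor `r^(n-1)` of polar coordinates leaves the exponent `p - σ p - 1`,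
    -- which exceeds `-1` because `σ < 1`.
    · have : IntegrableOn (fun r : ℝ => r ^ (p - σ * p - 1)) (Ioc 0 1) := by
        rw [← intervalIntegrable_iff_integrableOn_Ioc_of_le zero_le_one]
        refine intervalIntegral.intervalIntegrable_rpow' ?_
        nlinarith
      refine this.congr_fun (fun r hr => ?_) measurableSet_Ioc
      have hr0 : 0 < r := hr.1
      simp only [hf, min_eq_left hr.2, smul_eq_mul]
      rw [← Real.rpow_natCast r (n - 1), Nat.cast_sub hn, ← mul_div_assoc, ← Real.rpow_add hr0,
        ← Real.rpow_sub hr0]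
      congr 1
      push_cast
      ring
    -- At infinity the exponent is below `-1` because `σ > 0`.
    · have : IntegrableOn (fun r : ℝ => r ^ (-(σ * p) - 1)) (Ioi 1) :=
        integrableOn_Ioi_rpow_of_lt (by nlinarith) zero_lt_one
      refine this.congr_fun (fun r hr => ?_) measurableSet_Ioi
      have hr1 : 1 < r := hr
      have hr0 : 0 < r := by linarith
      simp only [hf, min_eq_right hr1.le, smul_eq_mul, Real.one_rpow]
      rw [← Real.rpow_natCast r (n - 1), Nat.cast_sub hn, mul_one_div, ← Real.rpow_sub hr0]
      congr 1
      push_cast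
      ring
  refine lt_of_eq_of_lt (lintegral_congr fun z => ?_) key.hasFiniteIntegral
  rcases eq_or_ne z 0 with rfl | hz
  · have : (0 : ℝ) ^ ((n : ℝ) + σ * p) = 0 := Real.zero_rpow (by positivity)
    simp [hf, hp0, this]
  have hz0 : 0 < ‖z‖ := norm_pos_iff.2 hz
  have hf0 : 0 ≤ f ‖z‖ := by positivity
  rw [Real.enorm_eq_ofReal hf0, hf]
  simp only
  rw [ENNReal.ofReal_div_of_pos (by positivity),
    ← ENNReal.ofReal_rpow_of_nonneg (by positivity) hp0.le,
    ← ENNReal.ofReal_rpow_of_nonneg (by positivity) (by positivity), ENNReal.ofReal_min,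
    ofReal_norm, ENNReal.ofReal_one]

end Energies

/-! ### Gagliardo energies and the kernel of Lipschitz functions -/

section Energies2

variable {n : ℕ} {F G : Type*} [NormedAddCommGroup F] [NormedSpace ℝ F]
  [NormedAddCommGroup G] [NormedSpace ℝ G]

/-- The kernel that controls the Gagliardo energy of Lipschitz functions. -/
def lipKernel (n : ℕ) (σ p : ℝ) (z : Euc n) : ℝ≥0∞ :=
  min ‖z‖ₑ 1 ^ p / ‖z‖ₑ ^ ((n : ℝ) + σ * p)

theorem measurable_lipKernel (n : ℕ) (σ p : ℝ) : Measurable (lipKernel n σ p) := by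
  unfold lipKernel
  have : Measurable fun z : Euc n => ‖z‖ₑ := continuous_enorm.measurable
  exact ((this.min measurable_const).pow_const p).div (this.pow_const _)

theorem lintegral_lipKernel_mul_left (σ p : ℝ) {h : Euc n → ℝ≥0∞} (hh : Measurable h) :
    ∫⁻ x, ∫⁻ y, lipKernel n σ p (x - y) * h x = (∫⁻ z, lipKernel n σ p z) * ∫⁻ x, h x := by
  rw [← lintegral_const_mul _ hh]
  refine lintegral_congr fun x => ?_
  have hm : Measurable fun y => lipKernel n σ p (x - y) :=
    (measurable_lipKernel n σ p).comp (measurable_const.sub measurable_id)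
  rw [lintegral_mul_const _ hm, lintegral_sub_left_eq_self]

theorem lintegral_lipKernel_mul_right (σ p : ℝ) {h : Euc n → ℝ≥0∞} (hh : Measurable h) :
    ∫⁻ x, ∫⁻ y, lipKernel n σ p (x - y) * h y = (∫⁻ z, lipKernel n σ p z) * ∫⁻ x, h x := by
  have hm : Measurable fun z : Euc n × Euc n => lipKernel n σ p (z.1 - z.2) * h z.2 :=
    ((measurable_lipKernel n σ p).comp (measurable_fst.sub measurable_snd)).mul
      (hh.comp measurable_snd)
  rw [lintegral_lintegral_swap hm.aemeasurable, ← lintegral_const_mul _ hh]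
  refine lintegral_congr fun y => ?_
  have hm : Measurable fun x => lipKernel n σ p (x - y) :=
    (measurable_lipKernel n σ p).comp (measurable_id.sub measurable_const)
  rw [lintegral_mul_const _ hm, lintegral_sub_right_eq_self]

/-- Away from the diagonal the Gagliardo integrand is controlled by the values. -/
theorem gagliardo_far_le {p : ℝ} (hp : 1 ≤ p) (σ : ℝ) {δ : ℝ≥0∞} (hδ0 : δ ≠ 0) (hδ : δ ≤ 1)
    (x y : Euc n) (hxy : δ ≤ ‖x - y‖ₑ) (a b : F) :
    ‖a - b‖ₑ ^ p / ‖x - y‖ₑ ^ ((n : ℝ) + σ * p) ≤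
      2 ^ (p - 1) * (δ ^ p)⁻¹ *
        (lipKernel n σ p (x - y) * ‖a‖ₑ ^ p + lipKernel n σ p (x - y) * ‖b‖ₑ ^ p) := by
  have hp0 : 0 ≤ p := by linarith
  have hδt : δ ≠ ⊤ := (hδ.trans_lt ENNReal.one_lt_top).ne
  have h1 : ‖a - b‖ₑ ^ p ≤ 2 ^ (p - 1) * (‖a‖ₑ ^ p + ‖b‖ₑ ^ p) := by
    have := enorm_add_rpow_le hp a (-b)
    rwa [← sub_eq_add_neg, enorm_neg] at this
  have h2 : 1 ≤ (δ ^ p)⁻¹ * min ‖x - y‖ₑ 1 ^ p := by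
    have : δ ^ p ≤ min ‖x - y‖ₑ 1 ^ p := ENNReal.rpow_le_rpow (le_min hxy hδ) hp0
    calc (1 : ℝ≥0∞) = (δ ^ p)⁻¹ * δ ^ p := (ENNReal.inv_mul_cancel (by simp [hδ0, hδt])
          (ENNReal.rpow_ne_top_of_nonneg hp0 hδt)).symm
      _ ≤ _ := by gcongr
  calc _ ≤ (2 ^ (p - 1) * (‖a‖ₑ ^ p + ‖b‖ₑ ^ p)) * 1 / ‖x - y‖ₑ ^ ((n : ℝ) + σ * p) := by
        rw [mul_one]; gcongr
    _ ≤ (2 ^ (p - 1) * (‖a‖ₑ ^ p + ‖b‖ₑ ^ p)) * ((δ ^ p)⁻¹ * min ‖x - y‖ₑ 1 ^ p) /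
          ‖x - y‖ₑ ^ ((n : ℝ) + σ * p) := by gcongr
    _ = _ := by
        simp only [lipKernel, ENNReal.div_eq_inv_mul]
        ring

/-- Jensen's inequality: `[0,1]` has total mass one. -/
theorem rpow_lintegral_Icc_le {p : ℝ} (hp : 1 ≤ p) {h : ℝ → F} (hh : Continuous h) :
    (∫⁻ t in Icc (0 : ℝ) 1, ‖h t‖ₑ) ^ p ≤ ∫⁻ t in Icc (0 : ℝ) 1, ‖h t‖ₑ ^ p := by
  have hp0 : 0 < p := by linarith
  haveI : IsProbabilityMeasure (volume.restrict (Icc (0 : ℝ) 1)) := ⟨by simp⟩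
  have := eLpNorm'_le_eLpNorm'_of_exponent_le zero_lt_one hp
    (volume.restrict (Icc (0 : ℝ) 1)) hh.aestronglyMeasurable
  simp only [eLpNorm', ENNReal.rpow_one, div_one] at this
  calc _ ≤ ((∫⁻ t in Icc (0 : ℝ) 1, ‖h t‖ₑ ^ p) ^ (1 / p)) ^ p :=
        ENNReal.rpow_le_rpow this hp0.le
    _ = _ := by rw [← ENNReal.rpow_mul, one_div_mul_cancel hp0.ne', ENNReal.rpow_one]

/-- The fundamental theorem of calculus along the segment from `y` to `x`, followed by Jensen's
inequality. -/
theorem enorm_sub_rpow_le_lintegral {p : ℝ} (hp : 1 ≤ p) {u : Euc n → F} (hu : ContDiff ℝ 1 u)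
    (x y : Euc n) :
    ‖u x - u y‖ₑ ^ p ≤
      ‖x - y‖ₑ ^ p * ∫⁻ t in Icc (0 : ℝ) 1, ‖fderiv ℝ u (y + t • (x - y))‖ₑ ^ p := by
  have hp0 : 0 ≤ p := by linarith
  have hl : ContDiff ℝ 1 fun t : ℝ => y + t • (x - y) := by fun_prop
  have hd : Continuous fun t : ℝ => fderiv ℝ u (y + t • (x - y)) :=
    (hu.continuous_fderiv one_ne_zero).comp hl.continuous
  have h1 := enorm_sub_le_lintegral_deriv_of_contDiffOn_Icc
    (hu.comp hl).contDiffOn (zero_le_one (α := ℝ))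
  simp only [Function.comp_apply, one_smul, add_sub_cancel, zero_smul, add_zero] at h1
  have h2 : ∀ t : ℝ, deriv (u ∘ fun t : ℝ => y + t • (x - y)) t =
      fderiv ℝ u (y + t • (x - y)) (x - y) := fun t => by
    have h3 : HasDerivAt (fun t : ℝ => y + t • (x - y)) (x - y) t := by
      simpa using ((hasDerivAt_id t).smul_const (x - y)).const_add y
    exact ((hu.differentiable one_ne_zero _).hasFDerivAt.comp_hasDerivAt t h3).deriv
  calc ‖u x - u y‖ₑ ^ p
      ≤ (∫⁻ t in Icc (0 : ℝ) 1, ‖x - y‖ₑ * ‖fderiv ℝ u (y + t • (x - y))‖ₑ) ^ p := by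
        refine ENNReal.rpow_le_rpow (h1.trans (lintegral_mono fun t => ?_)) hp0
        rw [h2, mul_comm]
        exact ContinuousLinearMap.le_opENorm _ _
    _ = ‖x - y‖ₑ ^ p * (∫⁻ t in Icc (0 : ℝ) 1, ‖fderiv ℝ u (y + t • (x - y))‖ₑ) ^ p := by
        rw [lintegral_const_mul _ hd.enorm.measurable, ENNReal.mul_rpow_of_nonneg _ _ hp0]
    _ ≤ _ := by gcongr; exact rpow_lintegral_Icc_le hp hd

/-- After the substitution `z = x - y`, translation invariance in `y` makes the inner integral
independent of both `t` and `z`, so the kernel separates off. -/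
theorem lintegral_lipKernel_mul_segment (σ p : ℝ) {h : Euc n → ℝ≥0∞} (hh : Measurable h) :
    ∫⁻ x, ∫⁻ y, lipKernel n σ p (x - y) * ∫⁻ t in Icc (0 : ℝ) 1, h (y + t • (x - y)) =
      (∫⁻ z, lipKernel n σ p z) * ∫⁻ x, h x := by
  have hkm := measurable_lipKernel n σ p
  have hm4 : Measurable fun w : (Euc n × Euc n) × ℝ => h (w.1.1 + w.2 • w.1.2) :=
    hh.comp (by fun_prop)
  set J : Euc n × Euc n → ℝ≥0∞ := fun w => ∫⁻ t in Icc (0 : ℝ) 1, h (w.1 + t • w.2) with hJ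
  have hJm : Measurable J := hm4.lintegral_prod_right'
  have hsw : Measurable fun w : Euc n × Euc n => lipKernel n σ p (w.1 - w.2) * J (w.2, w.1 - w.2) :=
    (hkm.comp (measurable_fst.sub measurable_snd)).mul
      (hJm.comp (measurable_snd.prodMk (measurable_fst.sub measurable_snd)))
  have hsw2 : Measurable fun w : Euc n × Euc n => lipKernel n σ p w.2 * J w :=
    (hkm.comp measurable_snd).mul hJm
  have e3 : ∀ z, ∫⁻ y, J (y, z) = ∫⁻ x, h x := by
    intro z
    have hm6 : Measurable fun w : Euc n × ℝ => h (w.1 + w.2 • z) := hh.comp (by fun_prop)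
    have e2 : ∀ t : ℝ, ∫⁻ y, h (y + t • z) = ∫⁻ x, h x :=
      fun t => lintegral_add_right_eq_self h (t • z)
    calc ∫⁻ y, J (y, z) = ∫⁻ t in Icc (0 : ℝ) 1, ∫⁻ y, h (y + t • z) :=
          lintegral_lintegral_swap (f := fun y t => h (y + t • z)) hm6.aemeasurable
      _ = _ := by simp [e2]
  calc ∫⁻ x, ∫⁻ y, lipKernel n σ p (x - y) * J (y, x - y)
      = ∫⁻ y, ∫⁻ x, lipKernel n σ p (x - y) * J (y, x - y) :=
        lintegral_lintegral_swap (f := fun x y => lipKernel n σ p (x - y) * J (y, x - y))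
          hsw.aemeasurable
    _ = ∫⁻ y, ∫⁻ z, lipKernel n σ p z * J (y, z) := lintegral_congr fun y =>
        lintegral_sub_right_eq_self (fun z => lipKernel n σ p z * J (y, z)) y
    _ = ∫⁻ z, ∫⁻ y, lipKernel n σ p z * J (y, z) :=
        lintegral_lintegral_swap (f := fun y z => lipKernel n σ p z * J (y, z)) hsw2.aemeasurable
    _ = ∫⁻ z, lipKernel n σ p z * ∫⁻ x, h x := lintegral_congr fun z => by
        have hJz : Measurable fun y => J (y, z) := hJm.comp measurable_prodMk_right
        rw [lintegral_const_mul _ hJz, e3]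
    _ = _ := lintegral_mul_const _ hkm

/-- Splitting an integral of a sum requires measurability of one summand only, so `R` may be
arbitrary. This spares a measurability proof for integrands composed with a coordinate change. -/
theorem lintegral_lintegral_le {X : Type*} [MeasurableSpace X] {μ : Measure X} [SFinite μ]
    {H A B R : X → X → ℝ≥0∞}
    (hA : Measurable fun z : X × X => A z.1 z.2) (hB : Measurable fun z : X × X => B z.1 z.2)
    {c : ℝ≥0∞} (hc : c ≠ ⊤) (h : ∀ x y, H x y ≤ c * (A x y + B x y) + R x y) :
    ∫⁻ x, ∫⁻ y, H x y ∂μ ∂μ ≤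
      c * ((∫⁻ x, ∫⁻ y, A x y ∂μ ∂μ) + ∫⁻ x, ∫⁻ y, B x y ∂μ ∂μ) + ∫⁻ x, ∫⁻ y, R x y ∂μ ∂μ := by
  have hA' : Measurable fun x => ∫⁻ y, A x y ∂μ := hA.lintegral_prod_right'
  have hB' : Measurable fun x => ∫⁻ y, B x y ∂μ := hB.lintegral_prod_right'
  have hAB : Measurable fun x => c * ((∫⁻ y, A x y ∂μ) + ∫⁻ y, B x y ∂μ) :=
    (hA'.add hB').const_mul c
  rw [← lintegral_add_left hA', ← lintegral_const_mul' _ _ hc, ← lintegral_add_left hAB]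
  refine lintegral_mono fun x => ?_
  have hAx : Measurable fun y => A x y := hA.comp measurable_prodMk_left
  have hBx : Measurable fun y => B x y := hB.comp measurable_prodMk_left
  have hABx : Measurable fun y => c * (A x y + B x y) := (hAx.add hBx).const_mul c
  rw [← lintegral_add_left hAx, ← lintegral_const_mul' _ _ hc, ← lintegral_add_left hABx]
  exact lintegral_mono fun y => h x y

/-- The embedding of `W^{1,p}` into `W^{σ,p}`. -/
theorem exists_gagliardoEnergy_le (n : ℕ) {σ p : ℝ} (hσ : 0 < σ) (hσ1 : σ < 1) (hp : 1 ≤ p) :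
    ∃ C : ℝ≥0∞, C ≠ ⊤ ∧ ∀ {F : Type} [NormedAddCommGroup F] [NormedSpace ℝ F] (u : Euc n → F),
      ContDiff ℝ 1 u →
      gagliardoEnergy σ p u ≤ C * (lpEnergy p u + lpEnergy p (fderiv ℝ u)) := by
  have hp0 : 0 ≤ p := by linarith
  have hκ : (∫⁻ z, lipKernel n σ p z) ≠ ⊤ := (lintegral_kernel_lt_top n hσ hσ1 hp).ne
  set κ := ∫⁻ z, lipKernel n σ p z with hκdef
  have h2 : (2 : ℝ≥0∞) ^ (p - 1) ≠ ⊤ := ENNReal.rpow_ne_top_of_nonneg (by linarith) (by simp)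
  refine ⟨2 ^ (p - 1) * (2 * κ) + κ, by finiteness, fun {F} _ _ u hu => ?_⟩
  have hum := measurable_enorm_rpow hu.continuous p
  have hdc : Continuous (fderiv ℝ u) := hu.continuous_fderiv one_ne_zero
  have hdm := measurable_enorm_rpow hdc p
  have hkm := measurable_lipKernel n σ p
  set D : Euc n → Euc n → ℝ≥0∞ := fun x y =>
    ∫⁻ t in Icc (0 : ℝ) 1, ‖fderiv ℝ u (y + t • (x - y))‖ₑ ^ p with hD
  have hpt : ∀ x y, ‖u x - u y‖ₑ ^ p / ‖x - y‖ₑ ^ ((n : ℝ) + σ * p) ≤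
      2 ^ (p - 1) * (lipKernel n σ p (x - y) * ‖u x‖ₑ ^ p + lipKernel n σ p (x - y) * ‖u y‖ₑ ^ p)
        + lipKernel n σ p (x - y) * D x y := by
    intro x y
    -- Far from the diagonal the values of `u` suffice; near it the kernel is `‖x - y‖^p / ‖x -
    -- y‖^(n + σ p)` and the derivative along the segment takes over.
    rcases le_total 1 ‖x - y‖ₑ with h | h
    · refine le_trans ?_ le_self_add
      have := gagliardo_far_le hp σ one_ne_zero le_rfl x y h (u x) (u y)
      simpa using this
    · refine le_trans ?_ le_add_self
      rw [lipKernel, min_eq_left h, ENNReal.mul_comm_div, ← mul_div_assoc]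
      gcongr
      exact enorm_sub_rpow_le_lintegral hp hu x y
  have hA : Measurable fun z : Euc n × Euc n => lipKernel n σ p (z.1 - z.2) * ‖u z.1‖ₑ ^ p :=
    (hkm.comp (measurable_fst.sub measurable_snd)).mul (hum.comp measurable_fst)
  have hB : Measurable fun z : Euc n × Euc n => lipKernel n σ p (z.1 - z.2) * ‖u z.2‖ₑ ^ p :=
    (hkm.comp (measurable_fst.sub measurable_snd)).mul (hum.comp measurable_snd)
  have hthird : ∫⁻ x, ∫⁻ y, lipKernel n σ p (x - y) * D x y = κ * lpEnergy p (fderiv ℝ u) :=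
    lintegral_lipKernel_mul_segment σ p hdm
  have hfirst : ∫⁻ x, ∫⁻ y, lipKernel n σ p (x - y) * ‖u x‖ₑ ^ p = κ * lpEnergy p u :=
    lintegral_lipKernel_mul_left σ p hum
  have hsecond : ∫⁻ x, ∫⁻ y, lipKernel n σ p (x - y) * ‖u y‖ₑ ^ p = κ * lpEnergy p u :=
    lintegral_lipKernel_mul_right σ p hum
  have htot : gagliardoEnergy σ p u ≤
      2 ^ (p - 1) * (κ * lpEnergy p u + κ * lpEnergy p u) + κ * lpEnergy p (fderiv ℝ u) := by
    have := lintegral_lintegral_le (μ := volume) hA hB h2 hpt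
    rwa [hfirst, hsecond, hthird] at this
  refine htot.trans ?_
  have : 2 ^ (p - 1) * (κ * lpEnergy p u + κ * lpEnergy p u) + κ * lpEnergy p (fderiv ℝ u) =
    2 ^ (p - 1) * (2 * κ) * lpEnergy p u + κ * lpEnergy p (fderiv ℝ u) := by ring
  rw [this, mul_add]
  gcongr
  · exact le_self_add
  · exact le_add_self

end Energies2

/-! ### Coordinate changes -/

/-- `T` restricts to a diffeomorphism of the open set `O` onto its image. -/
structure IsCoordChange {n : ℕ} (T : Euc n → Euc n) (O : Set (Euc n)) : Prop where
  isOpen : IsOpen O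
  contDiffOn : ContDiffOn ℝ ∞ T O
  injOn : InjOn T O
  det_ne_zero : ∀ x ∈ O, (fderiv ℝ T x).det ≠ 0

section CoordChange

variable {n : ℕ} {T : Euc n → Euc n} {O : Set (Euc n)}

theorem IsCoordChange.contDiffAt (hT : IsCoordChange T O) {x : Euc n} (hx : x ∈ O) :
    ContDiffAt ℝ ∞ T x :=
  hT.contDiffOn.contDiffAt (hT.isOpen.mem_nhds hx)

theorem IsCoordChange.contDiffOn_fderiv (hT : IsCoordChange T O) :
    ContDiffOn ℝ ∞ (fderiv ℝ T) O :=
  hT.contDiffOn.fderiv_of_isOpen hT.isOpen (by simp)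

theorem IsCoordChange.exists_lipschitzOnWith (hT : IsCoordChange T O) {K : Set (Euc n)}
    (hK : IsCompact K) (hKO : K ⊆ O) : ∃ L, LipschitzOnWith L T K := by
  refine LocallyLipschitzOn.exists_lipschitzOnWith_of_compact hK fun x hx => ?_
  obtain ⟨C, t, ht, h⟩ := ((hT.contDiffAt (hKO hx)).of_le
    (by exact_mod_cast le_top)).exists_lipschitzOnWith
  exact ⟨C, t, mem_nhdsWithin_of_mem_nhds ht, h⟩

/-- On the compact set `K` the Jacobian is bounded below by its minimum `m > 0`, and the change of
variables formula applies. It holds for every `h`, measurable or not, so `h` may itself be an inner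
integral. -/
theorem IsCoordChange.exists_setLIntegral_comp_le (hT : IsCoordChange T O) {K : Set (Euc n)}
    (hK : IsCompact K) (hKO : K ⊆ O) :
    ∃ C : ℝ≥0∞, C ≠ ⊤ ∧ ∀ h : Euc n → ℝ≥0∞, ∫⁻ x in K, h (T x) ≤ C * ∫⁻ x, h x := by
  rcases K.eq_empty_or_nonempty with rfl | hne
  · exact ⟨0, by simp, by simp⟩
  have hc : ContinuousOn (fun x => |(fderiv ℝ T x).det|) K :=
    ((ContinuousLinearMap.continuous_det.comp_continuousOn
      hT.contDiffOn_fderiv.continuousOn).abs).mono hKO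
  obtain ⟨x₀, hx₀, hmin⟩ := hK.exists_isMinOn hne hc
  set m := |(fderiv ℝ T x₀).det| with hm
  have hm0 : 0 < m := abs_pos.2 (hT.det_ne_zero x₀ (hKO hx₀))
  refine ⟨(ENNReal.ofReal m)⁻¹, by simp [hm0], fun h => ?_⟩
  have hcov := lintegral_image_eq_lintegral_abs_det_fderiv_mul volume hK.measurableSet
    (fun x hx => ((hT.contDiffAt (hKO hx)).differentiableAt (by simp)).hasFDerivAt.hasFDerivWithinAt)
    (hT.injOn.mono hKO) h
  have h1 : ENNReal.ofReal m * ∫⁻ x in K, h (T x) ≤ ∫⁻ x, h x := by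
    rw [← lintegral_const_mul' _ _ (by simp)]
    refine le_trans ?_ (hcov.symm.le.trans (setLIntegral_le_lintegral _ _))
    refine setLIntegral_mono' hK.measurableSet fun x hx => ?_
    gcongr
    exact hmin hx
  exact (ENNReal.mul_le_iff_le_inv (by simp [hm0]) (by simp)).1 h1

end CoordChange

/-! ### Multipliers on `L^p` and on Gagliardo energies -/

section Multiplier

variable {n : ℕ} {T : Euc n → Euc n} {O : Set (Euc n)}
  {F G : Type*} [NormedAddCommGroup F] [NormedSpace ℝ F] [NormedAddCommGroup G] [NormedSpace ℝ G]

/-- A smooth operator-valued multiplier with compact support in `O`. -/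
structure IsMultiplier (a : Euc n → F →L[ℝ] G) (O : Set (Euc n)) : Prop where
  contDiff : ContDiff ℝ ∞ a
  hasCompactSupport : HasCompactSupport a
  tsupport_subset : tsupport a ⊆ O

theorem IsMultiplier.exists_lpEnergy_le (hT : IsCoordChange T O) {a : Euc n → F →L[ℝ] G}
    (ha : IsMultiplier a O) {p : ℝ} (hp : 1 ≤ p) :
    ∃ C : ℝ≥0∞, C ≠ ⊤ ∧ ∀ u : Euc n → F,
      lpEnergy p (fun x => a x (u (T x))) ≤ C * lpEnergy p u := by
  have hp0 : 0 < p := by linarith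
  obtain ⟨C, hC, hCT⟩ := hT.exists_setLIntegral_comp_le ha.hasCompactSupport ha.tsupport_subset
  obtain ⟨A, hA⟩ := ha.hasCompactSupport.exists_bound_of_continuous ha.contDiff.continuous
  have hA' : ∀ x, ‖a x‖ₑ ≤ ENNReal.ofReal A := fun x => by
    rw [← ofReal_norm]; exact ENNReal.ofReal_le_ofReal (hA x)
  have hAt : ENNReal.ofReal A ^ p ≠ ⊤ := ENNReal.rpow_ne_top_of_nonneg hp0.le (by simp)
  refine ⟨ENNReal.ofReal A ^ p * C, by finiteness, fun u => ?_⟩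
  calc lpEnergy p (fun x => a x (u (T x)))
      ≤ ∫⁻ x in tsupport a, ENNReal.ofReal A ^ p * ‖u (T x)‖ₑ ^ p := by
        rw [← lintegral_indicator (isClosed_tsupport a).measurableSet]
        refine lintegral_mono fun x => ?_
        by_cases hx : x ∈ tsupport a
        · rw [indicator_of_mem hx, ← ENNReal.mul_rpow_of_nonneg _ _ hp0.le]
          refine ENNReal.rpow_le_rpow ?_ hp0.le
          exact ((a x).le_opENorm _).trans (by gcongr; exact hA' x)
        · simp [image_eq_zero_of_notMem_tsupport hx, hp0]
    _ = ENNReal.ofReal A ^ p * ∫⁻ x in tsupport a, ‖u (T x)‖ₑ ^ p := lintegral_const_mul' _ _ hAt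
    _ ≤ ENNReal.ofReal A ^ p * (C * lpEnergy p u) := by
        gcongr
        exact hCT fun x => ‖u x‖ₑ ^ p
    _ = _ := by ring

theorem div_rpow_le_of_le_mul {a D E : ℝ≥0∞} {L : ℝ≥0∞} (hL0 : L ≠ 0) (hL : L ≠ ⊤) {q : ℝ}
    (hq : 0 ≤ q) (h : E ≤ L * D) : a / D ^ q ≤ L ^ q * (a / E ^ q) := by
  have h1 : L ^ q ≠ 0 := by simp [hL0, hL]
  have h2 : L ^ q ≠ ⊤ := ENNReal.rpow_ne_top_of_nonneg hq hL
  calc a / D ^ q = L ^ q * (a / (L ^ q * D ^ q)) := by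
        rw [← mul_div_assoc, ENNReal.mul_div_mul_left _ _ h1 h2]
    _ ≤ _ := by
        gcongr
        rw [← ENNReal.mul_rpow_of_nonneg _ _ hq]
        exact ENNReal.rpow_le_rpow h hq

/-- Pairs at distance at least `δ` are controlled by the `L^p` bound. For close pairs the difference
splits into a variation of `a`, which is Lipschitz, and a variation of `u ∘ T`, which a change of
variables in `x` and in `y` turns into the energy of `u`. -/
theorem IsMultiplier.exists_gagliardoEnergy_le (hT : IsCoordChange T O) {a : Euc n → F →L[ℝ] G}
    (ha : IsMultiplier a O) {σ p : ℝ} (hσ : 0 < σ) (hσ1 : σ < 1) (hp : 1 ≤ p) :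
    ∃ C : ℝ≥0∞, C ≠ ⊤ ∧ ∀ u : Euc n → F, Continuous u →
      Continuous (fun x => a x (u (T x))) →
      gagliardoEnergy σ p (fun x => a x (u (T x))) ≤
        C * (lpEnergy p u + gagliardoEnergy σ p u) := by
  have hp0 : 0 < p := by linarith
  have hq0 : 0 ≤ (n : ℝ) + σ * p := by positivity
  obtain ⟨C₀, hC₀, hlp⟩ := ha.exists_lpEnergy_le hT hp
  set K := tsupport a with hK
  have hKc : IsCompact K := ha.hasCompactSupport
  -- A compact neighbourhood `K'` of `K` inside `O`: if one of two points at distance less than `δ`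
  -- lies in `K`, both lie in `K'`, where `T` is Lipschitz. The bound `δ ≤ 1` puts such pairs where
  -- the kernel has numerator `‖x - y‖^p`.
  obtain ⟨δ₁, hδ₁, hδO⟩ := hKc.exists_cthickening_subset_open hT.isOpen ha.tsupport_subset
  set δ := min δ₁ 1 with hδdef
  have hδ : 0 < δ := lt_min hδ₁ one_pos
  set K' := cthickening δ K with hK'
  have hK'c : IsCompact K' := hKc.cthickening
  have hK'm : MeasurableSet K' := hK'c.measurableSet
  have hK'O : K' ⊆ O := (cthickening_mono (min_le_left _ _) K).trans hδO
  have hKK' : K ⊆ K' := self_subset_cthickening K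
  have hnear : ∀ x ∈ K, ∀ y, ‖x - y‖ₑ < ENNReal.ofReal δ → y ∈ K' := by
    intro x hx y hxy
    refine mem_cthickening_of_dist_le y x δ K hx ?_
    rw [← ofReal_norm, ENNReal.ofReal_lt_ofReal_iff hδ] at hxy
    rw [dist_comm, dist_eq_norm]
    exact hxy.le
  obtain ⟨C₁, hC₁, hcov⟩ := hT.exists_setLIntegral_comp_le hK'c hK'O
  obtain ⟨L₀, hL₀⟩ := hT.exists_lipschitzOnWith hK'c hK'O
  obtain ⟨La, hLa⟩ := ha.contDiff.lipschitzWith_of_hasCompactSupport ha.hasCompactSupport (by simp)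
  obtain ⟨A, hA⟩ := ha.hasCompactSupport.exists_bound_of_continuous ha.contDiff.continuous
  have hA' : ∀ x, ‖a x‖ₑ ≤ ENNReal.ofReal A := fun x => by
    rw [← ofReal_norm]; exact ENNReal.ofReal_le_ofReal (hA x)
  -- The maximum with `1` keeps `L` nonzero, as division by its powers requires.
  set L : ℝ≥0∞ := max L₀ 1 with hLdef
  have hL0 : L ≠ 0 := (lt_of_lt_of_le one_pos (le_max_right _ _)).ne'
  have hLt : L ≠ ⊤ := by simp [hLdef]
  have hTL : ∀ x ∈ K', ∀ y ∈ K', ‖T x - T y‖ₑ ≤ L * ‖x - y‖ₑ := by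
    intro x hx y hy
    have := hL₀ hx hy
    rw [edist_eq_enorm_sub, edist_eq_enorm_sub] at this
    exact this.trans (by gcongr; exact le_max_left _ _)
  have haL : ∀ x y, ‖a x - a y‖ₑ ≤ La * ‖x - y‖ₑ := by
    intro x y
    have := hLa x y
    rwa [edist_eq_enorm_sub, edist_eq_enorm_sub] at this
  have hκ : (∫⁻ z, lipKernel n σ p z) ≠ ⊤ := (lintegral_kernel_lt_top n hσ hσ1 hp).ne
  set κ := ∫⁻ z, lipKernel n σ p z with hκdef
  set q : ℝ := (n : ℝ) + σ * p with hq
  -- The weights of the three contributions: distant pairs, the variation of `a`, the variation of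
  -- `u ∘ T`.
  set c₁ : ℝ≥0∞ := 2 ^ (p - 1) * ((ENNReal.ofReal δ) ^ p)⁻¹ with hc₁
  set c₂ : ℝ≥0∞ := 2 ^ (p - 1) * (La : ℝ≥0∞) ^ p with hc₂
  set c₃ : ℝ≥0∞ := 2 ^ (p - 1) * ENNReal.ofReal A ^ p * L ^ q with hc₃
  have h2 : (2 : ℝ≥0∞) ^ (p - 1) ≠ ⊤ := ENNReal.rpow_ne_top_of_nonneg (by linarith) (by simp)
  have hc₁t : c₁ ≠ ⊤ := ENNReal.mul_ne_top h2 (by simp [hδ])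
  have hc₂t : c₂ ≠ ⊤ := ENNReal.mul_ne_top h2 (ENNReal.rpow_ne_top_of_nonneg hp0.le (by simp))
  have hc₃t : c₃ ≠ ⊤ := ENNReal.mul_ne_top (ENNReal.mul_ne_top h2
    (ENNReal.rpow_ne_top_of_nonneg hp0.le (by simp))) (ENNReal.rpow_ne_top_of_nonneg hq0 hLt)
  refine ⟨c₁ * (κ * C₀ + κ * C₀) + (c₂ * (κ * C₁) + c₃ * (C₁ * C₁)), by finiteness,
    fun u hu hf => ?_⟩
  set f : Euc n → G := fun x => a x (u (T x)) with hfdef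
  set φ : Euc n → ℝ≥0∞ := K'.indicator fun x => ‖u (T x)‖ₑ ^ p with hφ
  set H : Euc n → Euc n → ℝ≥0∞ := fun x y => ‖u x - u y‖ₑ ^ p / ‖x - y‖ₑ ^ q with hH
  set R : Euc n → Euc n → ℝ≥0∞ := fun x y =>
    K'.indicator (fun x => K'.indicator (fun y => H (T x) (T y)) y) x with hR
  have hφm : Measurable φ := by
    classical
    have : ContinuousOn (fun x => ‖u (T x)‖ₑ ^ p) K' :=
      ENNReal.continuous_rpow_const.comp_continuousOn
        (hu.comp_continuousOn (hT.contDiffOn.continuousOn.mono hK'O)).enorm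
    have h0 : ContinuousOn (fun _ : Euc n => (0 : ℝ≥0∞)) K'ᶜ := continuousOn_const
    have := this.measurable_piecewise h0 hK'm
    rwa [hφ, ← piecewise_eq_indicator]
  have hfm := measurable_enorm_rpow hf p
  have hkm := measurable_lipKernel n σ p
  have hf0 : ∀ x ∉ K, f x = 0 := fun x hx => by
    simp [hfdef, image_eq_zero_of_notMem_tsupport hx]
  have hpt : ∀ x y, ‖f x - f y‖ₑ ^ p / ‖x - y‖ₑ ^ q ≤
      c₁ * (lipKernel n σ p (x - y) * ‖f x‖ₑ ^ p + lipKernel n σ p (x - y) * ‖f y‖ₑ ^ p) +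
        (c₂ * (lipKernel n σ p (x - y) * φ x) + c₃ * R x y) := by
    intro x y
    rcases le_or_gt (ENNReal.ofReal δ) ‖x - y‖ₑ with h | h
    · refine le_trans ?_ le_self_add
      exact gagliardo_far_le hp σ (by simp [hδ]) (by simp [hδdef]) x y h _ _
    refine le_trans ?_ le_add_self
    by_cases hxy : x ∉ K ∧ y ∉ K
    · simp [hf0 x hxy.1, hf0 y hxy.2, hp0]
    have hxK' : x ∈ K' := by
      by_cases hx : x ∈ K
      · exact hKK' hx
      · have hy : y ∈ K := by tauto
        refine hnear y hy x ?_
        rwa [← enorm_neg, neg_sub]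
    have hyK' : y ∈ K' := by
      by_cases hy : y ∈ K
      · exact hKK' hy
      · exact hnear x (by tauto) y h
    have h1 : ‖x - y‖ₑ ≤ 1 := h.le.trans (by simp [hδdef])
    have hsplit : f x - f y = (a x - a y) (u (T x)) + a y (u (T x) - u (T y)) := by
      simp [hfdef]
    have hbd : ‖f x - f y‖ₑ ^ p ≤ c₂ * (‖x - y‖ₑ ^ p * ‖u (T x)‖ₑ ^ p) +
        2 ^ (p - 1) * ENNReal.ofReal A ^ p * ‖u (T x) - u (T y)‖ₑ ^ p := by
      rw [hsplit]
      refine (enorm_add_rpow_le hp _ _).trans ?_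
      have e1 : ‖(a x - a y) (u (T x))‖ₑ ^ p ≤
          (La : ℝ≥0∞) ^ p * (‖x - y‖ₑ ^ p * ‖u (T x)‖ₑ ^ p) := by
        rw [← ENNReal.mul_rpow_of_nonneg _ _ hp0.le, ← ENNReal.mul_rpow_of_nonneg _ _ hp0.le,
          ← mul_assoc]
        refine ENNReal.rpow_le_rpow ?_ hp0.le
        exact ((a x - a y).le_opENorm _).trans (by gcongr; exact haL x y)
      have e2 : ‖a y (u (T x) - u (T y))‖ₑ ^ p ≤
          ENNReal.ofReal A ^ p * ‖u (T x) - u (T y)‖ₑ ^ p := by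
        rw [← ENNReal.mul_rpow_of_nonneg _ _ hp0.le]
        refine ENNReal.rpow_le_rpow ?_ hp0.le
        exact ((a y).le_opENorm _).trans (by gcongr; exact hA' y)
      calc _ ≤ 2 ^ (p - 1) * ((La : ℝ≥0∞) ^ p * (‖x - y‖ₑ ^ p * ‖u (T x)‖ₑ ^ p) +
            ENNReal.ofReal A ^ p * ‖u (T x) - u (T y)‖ₑ ^ p) := by gcongr
        _ = _ := by rw [hc₂]; ring
    calc ‖f x - f y‖ₑ ^ p / ‖x - y‖ₑ ^ q
        ≤ (c₂ * (‖x - y‖ₑ ^ p * ‖u (T x)‖ₑ ^ p) +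
          2 ^ (p - 1) * ENNReal.ofReal A ^ p * ‖u (T x) - u (T y)‖ₑ ^ p) / ‖x - y‖ₑ ^ q := by
          gcongr
      _ = c₂ * (lipKernel n σ p (x - y) * φ x) +
          2 ^ (p - 1) * ENNReal.ofReal A ^ p *
            (‖u (T x) - u (T y)‖ₑ ^ p / ‖x - y‖ₑ ^ q) := by
          rw [hφ, indicator_of_mem hxK', lipKernel, min_eq_left h1]
          simp only [ENNReal.div_eq_inv_mul]
          ring
      _ ≤ c₂ * (lipKernel n σ p (x - y) * φ x) +
          2 ^ (p - 1) * ENNReal.ofReal A ^ p * (L ^ q * R x y) := by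
          gcongr
          simp only [hR, indicator_of_mem hxK', indicator_of_mem hyK']
          exact div_rpow_le_of_le_mul hL0 hLt hq0 (hTL x hxK' y hyK')
      _ = _ := by rw [hc₃]; ring
  have hm1 : Measurable fun z : Euc n × Euc n => lipKernel n σ p (z.1 - z.2) * ‖f z.1‖ₑ ^ p :=
    (hkm.comp (measurable_fst.sub measurable_snd)).mul (hfm.comp measurable_fst)
  have hm2 : Measurable fun z : Euc n × Euc n => lipKernel n σ p (z.1 - z.2) * ‖f z.2‖ₑ ^ p :=
    (hkm.comp (measurable_fst.sub measurable_snd)).mul (hfm.comp measurable_snd)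
  have hm3 : Measurable fun z : Euc n × Euc n => lipKernel n σ p (z.1 - z.2) * φ z.1 :=
    (hkm.comp (measurable_fst.sub measurable_snd)).mul (hφm.comp measurable_fst)
  have hR1 : ∫⁻ x, ∫⁻ y, R x y ≤ C₁ * C₁ * gagliardoEnergy σ p u := by
    have e1 : ∀ x, ∫⁻ y, R x y ≤ K'.indicator (fun x => C₁ * ∫⁻ y, H (T x) y) x := by
      intro x
      by_cases hx : x ∈ K'
      · simp only [hR, indicator_of_mem hx]
        rw [lintegral_indicator hK'm]
        exact hcov fun y => H (T x) y
      · simp [hR, hx]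
    calc ∫⁻ x, ∫⁻ y, R x y ≤ ∫⁻ x in K', C₁ * ∫⁻ y, H (T x) y := by
          rw [← lintegral_indicator hK'm]
          exact lintegral_mono e1
      _ = C₁ * ∫⁻ x in K', ∫⁻ y, H (T x) y := lintegral_const_mul' _ _ hC₁
      _ ≤ C₁ * (C₁ * gagliardoEnergy σ p u) := by
          gcongr
          exact hcov fun x => ∫⁻ y, H x y
      _ = _ := by ring
  have hφ1 : ∫⁻ x, φ x ≤ C₁ * lpEnergy p u := by
    rw [hφ, lintegral_indicator hK'm]
    exact hcov fun x => ‖u x‖ₑ ^ p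
  have hS : ∫⁻ x, ∫⁻ y, (c₂ * (lipKernel n σ p (x - y) * φ x) + c₃ * R x y) ≤
      c₂ * (κ * (C₁ * lpEnergy p u)) + c₃ * (C₁ * C₁ * gagliardoEnergy σ p u) := by
    have e1 := lintegral_lintegral_le (μ := volume) (B := fun _ _ => 0)
      (R := fun x y => c₃ * R x y) hm3 measurable_const hc₂t
      (fun x y => (show c₂ * (lipKernel n σ p (x - y) * φ x) + c₃ * R x y ≤
        c₂ * (lipKernel n σ p (x - y) * φ x + 0) + c₃ * R x y by rw [add_zero]))
    refine e1.trans ?_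
    simp only [lintegral_zero, add_zero, lintegral_const_mul' _ _ hc₃t]
    rw [lintegral_lipKernel_mul_left σ p hφm]
    gcongr
  have htot := lintegral_lintegral_le (μ := volume) hm1 hm2 hc₁t hpt
  rw [lintegral_lipKernel_mul_left σ p hfm, lintegral_lipKernel_mul_right σ p hfm] at htot
  have hf1 : ∫⁻ x, ‖f x‖ₑ ^ p ≤ C₀ * lpEnergy p u := hlp u
  calc gagliardoEnergy σ p f
      ≤ c₁ * (κ * (C₀ * lpEnergy p u) + κ * (C₀ * lpEnergy p u)) +
        (c₂ * (κ * (C₁ * lpEnergy p u)) + c₃ * (C₁ * C₁ * gagliardoEnergy σ p u)) := by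
        exact htot.trans (add_le_add (mul_le_mul' le_rfl (add_le_add (mul_le_mul' le_rfl hf1)
          (mul_le_mul' le_rfl hf1))) hS)
    _ = (c₁ * (κ * C₀ + κ * C₀) + c₂ * (κ * C₁)) * lpEnergy p u +
        c₃ * (C₁ * C₁) * gagliardoEnergy σ p u := by ring
    _ ≤ _ := by
        refine le_trans ?_ (mul_add _ _ _).symm.le
        rw [← add_assoc (c₁ * (κ * C₀ + κ * C₀))]
        exact add_le_add (mul_le_mul' le_self_add le_rfl) (mul_le_mul' le_add_self le_rfl)

end Multiplier

/-! ### Multipliers on `W^{s,p}` -/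

section SobolevMultiplier

variable {n : ℕ}

theorem contDiff_of_contDiffOn_of_tsupport_subset {E F : Type*} [NormedAddCommGroup E]
    [NormedSpace ℝ E] [NormedAddCommGroup F] [NormedSpace ℝ F] {f : E → F} {O : Set E}
    (hO : IsOpen O) (hf : ContDiffOn ℝ ∞ f O) (hs : tsupport f ⊆ O) : ContDiff ℝ ∞ f := by
  refine contDiff_iff_contDiffAt.2 fun x => ?_
  by_cases hx : x ∈ tsupport f
  · exact hf.contDiffAt (hO.mem_nhds (hs hx))
  · exact contDiffAt_const.congr_of_eventuallyEq (notMem_tsupport_iff_eventuallyEq.1 hx)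

/-- The target space is quantified inside the statement because the induction replaces `F` by `Euc n
→L[ℝ] F`. -/
theorem sobolevEnergy_add_le {σ p : ℝ} (hp : 1 ≤ p) (k : ℕ) :
    ∀ {F : Type} [NormedAddCommGroup F] [NormedSpace ℝ F] {f g : Euc n → F},
      ContDiff ℝ ∞ f → ContDiff ℝ ∞ g → sobolevEnergy k σ p (f + g) ≤
        2 ^ (p - 1) * (sobolevEnergy k σ p f + sobolevEnergy k σ p g) := by
  induction k with
  | zero =>
    intro F _ _ f g hf hg
    simp only [sobolevEnergy_zero]
    refine (add_le_add (lpEnergy_add_le hp hf.continuous)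
      (fracEnergy_add_le hp hf.continuous)).trans_eq ?_
    ring
  | succ k ih =>
    intro F _ _ f g hf hg
    have hd : fderiv ℝ (f + g) = fderiv ℝ f + fderiv ℝ g := by
      ext1 x
      exact fderiv_add (hf.differentiable (by simp) x) (hg.differentiable (by simp) x)
    simp only [sobolevEnergy_succ, hd]
    refine (add_le_add (lpEnergy_add_le hp hf.continuous)
      (ih (hf.fderiv_right (m := ∞) (by simp)) (hg.fderiv_right (m := ∞) (by simp)))).trans_eq ?_
    ring

/-- Each induction step strips one derivative, and the base case is the embedding of `W^{1,p}` into
`W^{σ,p}`. It absorbs the term of the product rule in which the multiplier, rather than `u`, is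
differentiated. -/
theorem exists_sobolevEnergy_le_succ (n : ℕ) {σ p : ℝ} (hσ : 0 ≤ σ) (hσ1 : σ < 1) (hp : 1 ≤ p)
    (k : ℕ) : ∃ C : ℝ≥0∞, C ≠ ⊤ ∧ ∀ {F : Type} [NormedAddCommGroup F] [NormedSpace ℝ F]
      (u : Euc n → F), ContDiff ℝ ∞ u → sobolevEnergy k σ p u ≤ C * sobolevEnergy (k + 1) σ p u := by
  induction k with
  | zero =>
    have hfrac : ∃ C : ℝ≥0∞, C ≠ ⊤ ∧ ∀ {F : Type} [NormedAddCommGroup F] [NormedSpace ℝ F]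
        (u : Euc n → F), ContDiff ℝ 1 u →
        fracEnergy σ p u ≤ C * (lpEnergy p u + lpEnergy p (fderiv ℝ u)) := by
      rcases hσ.eq_or_lt with rfl | hσ0
      · exact ⟨0, by simp, fun u _ => by simp [fracEnergy]⟩
      · obtain ⟨C, hC, h⟩ := exists_gagliardoEnergy_le n hσ0 hσ1 hp
        exact ⟨C, hC, fun u hu => by simpa [fracEnergy, hσ0.ne'] using h u hu⟩
    obtain ⟨C, hC, h⟩ := hfrac
    refine ⟨1 + C, by finiteness, fun u hu => ?_⟩
    rw [sobolevEnergy_succ, sobolevEnergy_zero, sobolevEnergy_zero, add_mul, one_mul, ← add_assoc]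
    refine add_le_add (by rw [add_assoc]; exact le_self_add) ?_
    exact (h u (hu.of_le (by exact_mod_cast le_top))).trans
      (mul_le_mul' le_rfl le_self_add)
  | succ k ih =>
    obtain ⟨C, hC, h⟩ := ih
    refine ⟨1 + C, by finiteness, fun u hu => ?_⟩
    rw [sobolevEnergy_succ k, sobolevEnergy_succ (k + 1), add_mul, one_mul]
    refine add_le_add le_self_add ?_
    refine (h _ (hu.fderiv_right (m := ∞) (by simp))).trans ?_
    gcongr
    exact le_add_self

theorem contDiff_clm_flip {E F G : Type*} [NormedAddCommGroup E] [NormedSpace ℝ E]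
    [NormedAddCommGroup F] [NormedSpace ℝ F] [NormedAddCommGroup G] [NormedSpace ℝ G] :
    ContDiff ℝ ∞ fun L : E →L[ℝ] F →L[ℝ] G => L.flip :=
  IsBoundedLinearMap.contDiff (𝕜 := ℝ) ⟨⟨fun _ _ => rfl, fun _ _ => rfl⟩, 1, one_pos, fun L => by
    simp [ContinuousLinearMap.opNorm_flip]⟩

/-- The operator `B ↦ L ∘ B ∘ A`. -/
def clmConj {E F G : Type*} [NormedAddCommGroup E] [NormedSpace ℝ E]
    [NormedAddCommGroup F] [NormedSpace ℝ F] [NormedAddCommGroup G] [NormedSpace ℝ G]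
    (L : F →L[ℝ] G) (A : E →L[ℝ] E) : (E →L[ℝ] F) →L[ℝ] E →L[ℝ] G :=
  (ContinuousLinearMap.compL ℝ E F G L).comp ((ContinuousLinearMap.compL ℝ E E F).flip A)

theorem contDiffOn_clmConj {X E F G : Type*} [NormedAddCommGroup X] [NormedSpace ℝ X]
    [NormedAddCommGroup E] [NormedSpace ℝ E]
    [NormedAddCommGroup F] [NormedSpace ℝ F] [NormedAddCommGroup G] [NormedSpace ℝ G] {O : Set X}
    {L : X → F →L[ℝ] G} {A : X → E →L[ℝ] E} (hL : ContDiffOn ℝ ∞ L O) (hA : ContDiffOn ℝ ∞ A O) :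
    ContDiffOn ℝ ∞ (fun x => clmConj (L x) (A x)) O := by
  unfold clmConj
  fun_prop

theorem clmConj_zero {E F G : Type*} [NormedAddCommGroup E] [NormedSpace ℝ E]
    [NormedAddCommGroup F] [NormedSpace ℝ F] [NormedAddCommGroup G] [NormedSpace ℝ G]
    (A : E →L[ℝ] E) : clmConj (0 : F →L[ℝ] G) A = 0 := by
  refine ContinuousLinearMap.ext fun B => ContinuousLinearMap.ext fun v => ?_
  rfl

variable {T : Euc n → Euc n} {O : Set (Euc n)}

section Derivative

variable {F G : Type*} [NormedAddCommGroup F] [NormedSpace ℝ F] [NormedAddCommGroup G]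
  [NormedSpace ℝ G] {a : Euc n → F →L[ℝ] G}

theorem IsMultiplier.contDiff_comp (hT : IsCoordChange T O) (ha : IsMultiplier a O)
    {u : Euc n → F} (hu : ContDiff ℝ ∞ u) : ContDiff ℝ ∞ fun x => a x (u (T x)) := by
  refine contDiff_of_contDiffOn_of_tsupport_subset hT.isOpen
    (ha.contDiff.contDiffOn.clm_apply (hu.comp_contDiffOn hT.contDiffOn)) ?_
  refine (closure_mono fun x hx => ?_).trans ha.tsupport_subset
  contrapose! hx
  simp [Function.notMem_support.1 hx]

theorem IsMultiplier.of_support_subset {F' G' : Type*} [NormedAddCommGroup F'] [NormedSpace ℝ F']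
    [NormedAddCommGroup G'] [NormedSpace ℝ G'] {b : Euc n → F' →L[ℝ] G'}
    (hO : IsOpen O) (ha : IsMultiplier a O) (hb : ContDiffOn ℝ ∞ b O)
    (hs : Function.support b ⊆ tsupport a) : IsMultiplier b O := by
  have hs' : tsupport b ⊆ tsupport a := closure_minimal hs (isClosed_tsupport a)
  exact ⟨contDiff_of_contDiffOn_of_tsupport_subset hO hb (hs'.trans ha.tsupport_subset),
    ha.hasCompactSupport.of_isClosed_subset (isClosed_tsupport b) hs', hs'.trans ha.tsupport_subset⟩

theorem IsMultiplier.deriv_left (hT : IsCoordChange T O) (ha : IsMultiplier a O) :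
    IsMultiplier (fun x => (fderiv ℝ a x).flip) O := by
  refine ha.of_support_subset hT.isOpen ?_ ?_
  · exact (contDiff_clm_flip.comp
      (ha.contDiff.fderiv_right (m := ∞) (by simp))).contDiffOn
  · refine fun x hx => support_fderiv_subset ℝ (f := a) ?_
    contrapose! hx
    simp [Function.notMem_support.1 hx]

theorem IsMultiplier.deriv_right (hT : IsCoordChange T O) (ha : IsMultiplier a O) :
    IsMultiplier (fun x => (clmConj (a x) (fderiv ℝ T x) : (Euc n →L[ℝ] F) →L[ℝ] Euc n →L[ℝ] G)) O := by
  refine ha.of_support_subset hT.isOpen ?_ ?_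
  · exact contDiffOn_clmConj ha.contDiff.contDiffOn hT.contDiffOn_fderiv
  · refine Subset.trans (fun x hx => ?_) subset_closure
    contrapose! hx
    rw [Function.notMem_support] at hx ⊢
    rw [hx, clmConj_zero]

/-- Product and chain rule on `O`; elsewhere `T` is unrestricted, but `a` vanishes near the point.
Both terms are again multipliers composed with `T`. -/
theorem IsMultiplier.fderiv_comp (hT : IsCoordChange T O) (ha : IsMultiplier a O)
    {u : Euc n → F} (hu : ContDiff ℝ ∞ u) :
    fderiv ℝ (fun x => a x (u (T x))) = (fun x => (fderiv ℝ a x).flip (u (T x))) +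
      fun x => clmConj (a x) (fderiv ℝ T x) (fderiv ℝ u (T x)) := by
  ext1 x
  by_cases hx : x ∈ O
  · have h1 : HasFDerivAt T (fderiv ℝ T x) x :=
      ((hT.contDiffAt hx).differentiableAt (by simp)).hasFDerivAt
    have h2 : HasFDerivAt (fun x => u (T x)) ((fderiv ℝ u (T x)).comp (fderiv ℝ T x)) x :=
      (hu.differentiable (by simp) (T x)).hasFDerivAt.comp x h1
    have h3 := (ha.contDiff.differentiable (by simp) x).hasFDerivAt.clm_apply h2
    rw [h3.fderiv, add_comm]
    rfl
  · have hx' : x ∉ tsupport a := fun h => hx (ha.tsupport_subset h)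
    have h0 : a =ᶠ[nhds x] 0 := notMem_tsupport_iff_eventuallyEq.1 hx'
    have h1 : (fun x => a x (u (T x))) =ᶠ[nhds x] fun _ => (0 : G) :=
      h0.mono fun y hy => by simp [hy]
    have h2 : fderiv ℝ a x = 0 := by
      rw [h0.fderiv_eq]; exact fderiv_const_apply 0
    rw [h1.fderiv_eq]
    simp [h2, h0.eq_of_nhds, clmConj_zero]

end Derivative

/-- Induction on `k` through the product rule: both new multipliers are handled at order `k`, one
acting on `u` and the other on `fderiv ℝ u`. -/
theorem IsMultiplier.exists_sobolevEnergy_le (hT : IsCoordChange T O) {σ p : ℝ} (hσ : 0 ≤ σ)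
    (hσ1 : σ < 1) (hp : 1 ≤ p) (k : ℕ) :
    ∀ {F G : Type} [NormedAddCommGroup F] [NormedSpace ℝ F] [NormedAddCommGroup G]
      [NormedSpace ℝ G] {a : Euc n → F →L[ℝ] G}, IsMultiplier a O →
      ∃ C : ℝ≥0∞, C ≠ ⊤ ∧ ∀ u : Euc n → F, ContDiff ℝ ∞ u →
        sobolevEnergy k σ p (fun x => a x (u (T x))) ≤ C * sobolevEnergy k σ p u := by
  induction k with
  | zero =>
    intro F G _ _ _ _ a ha
    obtain ⟨C₀, hC₀, h₀⟩ := ha.exists_lpEnergy_le hT hp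
    rcases hσ.eq_or_lt with rfl | hσ0
    · refine ⟨C₀, hC₀, fun u _ => ?_⟩
      simpa [sobolevEnergy_zero, fracEnergy] using h₀ u
    · obtain ⟨C₁, hC₁, h₁⟩ := ha.exists_gagliardoEnergy_le hT hσ0 hσ1 hp
      refine ⟨C₀ + C₁, by finiteness, fun u hu => ?_⟩
      simp only [sobolevEnergy_zero, fracEnergy, hσ0.ne', if_false]
      rw [add_mul]
      refine add_le_add ((h₀ u).trans (by gcongr; exact le_self_add)) ?_
      exact h₁ u hu.continuous (ha.contDiff_comp hT hu).continuous
  | succ k ih =>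
    intro F G _ _ _ _ a ha
    obtain ⟨C₀, hC₀, h₀⟩ := ha.exists_lpEnergy_le hT hp
    obtain ⟨C₁, hC₁, h₁⟩ := ih (ha.deriv_left hT)
    obtain ⟨C₂, hC₂, h₂⟩ := ih (ha.deriv_right hT)
    obtain ⟨C₃, hC₃, h₃⟩ := exists_sobolevEnergy_le_succ n hσ hσ1 hp k
    have hc : (2 : ℝ≥0∞) ^ (p - 1) ≠ ⊤ := ENNReal.rpow_ne_top_of_nonneg (by linarith) (by simp)
    refine ⟨C₀ + 2 ^ (p - 1) * (C₁ * C₃ + C₂), by finiteness, fun u hu => ?_⟩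
    have hu' : ContDiff ℝ ∞ (fderiv ℝ u) := hu.fderiv_right (m := ∞) (by simp)
    rw [sobolevEnergy_succ, ha.fderiv_comp hT hu]
    have hlp : lpEnergy p u ≤ sobolevEnergy (k + 1) σ p u := by
      rw [sobolevEnergy_succ]; exact le_self_add
    have hd : sobolevEnergy k σ p (fderiv ℝ u) ≤ sobolevEnergy (k + 1) σ p u := by
      rw [sobolevEnergy_succ]; exact le_add_self
    rw [add_mul]
    refine add_le_add ((h₀ u).trans (by gcongr)) ?_
    refine (sobolevEnergy_add_le hp k ((ha.deriv_left hT).contDiff_comp hT hu)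
      ((ha.deriv_right hT).contDiff_comp hT hu')).trans ?_
    rw [mul_assoc]
    refine mul_le_mul' le_rfl ?_
    rw [add_mul, mul_assoc]
    exact add_le_add ((h₁ u hu).trans (mul_le_mul' le_rfl (h₃ u hu)))
      ((h₂ _ hu').trans (mul_le_mul' le_rfl hd))

section Norm

variable {F : Type*} [NormedAddCommGroup F] [NormedSpace ℝ F]

theorem sobolevNorm_eq (s : ℝ) {p : ℝ} (hp : 1 ≤ p) (f : Euc n → F) :
    sobolevNorm s p f = (∑ j ∈ Finset.range (⌊s⌋₊ + 1),
      lpEnergy p (iteratedFDeriv ℝ j f) ^ (1 / p)) +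
        fracEnergy (s - ⌊s⌋₊) p (iteratedFDeriv ℝ ⌊s⌋₊ f) ^ (1 / p) := by
  have hp0 : 0 < p := by linarith
  unfold sobolevNorm
  congr 1
  · refine Finset.sum_congr rfl fun j _ => ?_
    rw [eLpNorm_eq_lintegral_rpow_enorm_toReal (by simp [hp0]) (by simp),
      ENNReal.toReal_ofReal hp0.le]
    rfl
  · unfold fracEnergy
    simp only [sub_eq_zero]
    split_ifs
    · simp [hp0]
    · rfl

/-- The factor counts the summands: the orders `0, …, ⌊s⌋₊` and the fractional part. -/
theorem sobolevNorm_le_sobolevEnergy (s : ℝ) {p : ℝ} (hp : 1 ≤ p) (f : Euc n → F) :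
    sobolevNorm s p f ≤ (⌊s⌋₊ + 2) * sobolevEnergy ⌊s⌋₊ (s - ⌊s⌋₊) p f ^ (1 / p) := by
  have hp0 : 0 ≤ 1 / p := by positivity
  rw [sobolevNorm_eq s hp]
  have h1 : ∀ j ∈ Finset.range (⌊s⌋₊ + 1), lpEnergy p (iteratedFDeriv ℝ j f) ^ (1 / p) ≤
      sobolevEnergy ⌊s⌋₊ (s - ⌊s⌋₊) p f ^ (1 / p) := fun j hj =>
    ENNReal.rpow_le_rpow ((Finset.single_le_sum (f := fun j => lpEnergy p (iteratedFDeriv ℝ j f))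
      (fun _ _ => zero_le) hj).trans le_self_add) hp0
  have h2 : fracEnergy (s - ⌊s⌋₊) p (iteratedFDeriv ℝ ⌊s⌋₊ f) ^ (1 / p) ≤
      sobolevEnergy ⌊s⌋₊ (s - ⌊s⌋₊) p f ^ (1 / p) := ENNReal.rpow_le_rpow le_add_self hp0
  refine (add_le_add (Finset.sum_le_card_nsmul _ _ _ h1) h2).trans_eq ?_
  simp only [Finset.card_range, nsmul_eq_mul]
  push_cast
  ring

theorem sobolevEnergy_le_sobolevNorm (s : ℝ) {p : ℝ} (hp : 1 ≤ p) (f : Euc n → F) :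
    sobolevEnergy ⌊s⌋₊ (s - ⌊s⌋₊) p f ≤ (⌊s⌋₊ + 2) * sobolevNorm s p f ^ p := by
  have hp0 : 0 < p := by linarith
  have key : ∀ X : ℝ≥0∞, X ^ (1 / p) ≤ sobolevNorm s p f → X ≤ sobolevNorm s p f ^ p := by
    intro X hX
    have := ENNReal.rpow_le_rpow hX hp0.le
    rwa [← ENNReal.rpow_mul, one_div_mul_cancel hp0.ne', ENNReal.rpow_one] at this
  have h1 : ∀ j ∈ Finset.range (⌊s⌋₊ + 1), lpEnergy p (iteratedFDeriv ℝ j f) ≤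
      sobolevNorm s p f ^ p := fun j hj => key _ <| by
    rw [sobolevNorm_eq s hp]
    exact (Finset.single_le_sum (f := fun j => lpEnergy p (iteratedFDeriv ℝ j f) ^ (1 / p))
      (fun _ _ => zero_le) hj).trans le_self_add
  have h2 : fracEnergy (s - ⌊s⌋₊) p (iteratedFDeriv ℝ ⌊s⌋₊ f) ≤ sobolevNorm s p f ^ p :=
    key _ <| by rw [sobolevNorm_eq s hp]; exact le_add_self
  refine (add_le_add (Finset.sum_le_card_nsmul _ _ _ h1) h2).trans_eq ?_
  simp only [Finset.card_range, nsmul_eq_mul]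
  push_cast
  ring

end Norm

/-- Multiplication by a compactly supported smooth multiplier after a smooth change of coordinates
is bounded on `W^{s,p}`. -/
theorem IsMultiplier.exists_sobolevNorm_le (hT : IsCoordChange T O) {s p : ℝ} (hs : 0 ≤ s)
    (hp : 1 ≤ p) {F G : Type} [NormedAddCommGroup F] [NormedSpace ℝ F] [NormedAddCommGroup G]
    [NormedSpace ℝ G] {a : Euc n → F →L[ℝ] G} (ha : IsMultiplier a O) :
    ∃ C : ℝ≥0∞, C ≠ ⊤ ∧ ∀ u : Euc n → F, ContDiff ℝ ∞ u →
      sobolevNorm s p (fun x => a x (u (T x))) ≤ C * sobolevNorm s p u := by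
  have hp0 : 0 < p := by linarith
  obtain ⟨C, hC, h⟩ := exists_sobolevEnergy_le hT (σ := s - ⌊s⌋₊)
    (by linarith [Nat.floor_le hs]) (by linarith [Nat.lt_floor_add_one s]) hp ⌊s⌋₊ ha
  have hC' : (C * (⌊s⌋₊ + 2)) ^ (1 / p) ≠ ⊤ :=
    ENNReal.rpow_ne_top_of_nonneg (by positivity) (by finiteness)
  refine ⟨(⌊s⌋₊ + 2) * (C * (⌊s⌋₊ + 2)) ^ (1 / p), by finiteness, fun u hu => ?_⟩
  refine (sobolevNorm_le_sobolevEnergy s hp _).trans ?_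
  rw [mul_assoc]
  refine mul_le_mul' le_rfl ?_
  calc _ ≤ ((C * (⌊s⌋₊ + 2)) * sobolevNorm s p u ^ p) ^ (1 / p) := by
        refine ENNReal.rpow_le_rpow ((h u hu).trans ?_) (by positivity)
        rw [mul_assoc]
        exact mul_le_mul' le_rfl (sobolevEnergy_le_sobolevNorm s hp u)
    _ = _ := by
        rw [ENNReal.mul_rpow_of_nonneg _ _ (by positivity), ← ENNReal.rpow_mul,
          mul_one_div_cancel hp0.ne', ENNReal.rpow_one]

end SobolevMultiplier

/-! ### Paths of diffeomorphisms: reparametrization, concatenation, inversion -/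

section Paths

variable {n : ℕ} {N : Type*} [TopologicalSpace N] [ChartedSpace (Euc n) N]

/-- The joint smoothness of a family of diffeomorphisms in time and space. -/
def IsSmoothFamily (Φ : ℝ → (N ≃ₘ^∞⟮𝓡 n, 𝓡 n⟯ N)) : Prop :=
  ContMDiff (𝓘(ℝ, ℝ).prod (𝓡 n)) (𝓡 n) ∞ (fun q : ℝ × N => Φ q.1 q.2)

/-- Absolute homogeneity of a functional on vector fields. -/
def IsHomogeneousNorm (norm : (∀ y : N, TangentSpace (𝓡 n) y) → ℝ≥0∞) : Prop :=
  ∀ (c : ℝ) (u : ∀ y : N, TangentSpace (𝓡 n) y), norm (fun y => c • u y) ≤ ‖c‖ₑ * norm u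

/-- `φ` is joined to the identity by a path in `Diff_c(U)` of length at most `C`. -/
def IsReachable (U : Set N) (norm : (∀ y : N, TangentSpace (𝓡 n) y) → ℝ≥0∞)
    (φ : N ≃ₘ^∞⟮𝓡 n, 𝓡 n⟯ N) (C : ℝ≥0∞) : Prop :=
  ∃ Φ : ℝ → (N ≃ₘ^∞⟮𝓡 n, 𝓡 n⟯ N), IsDiffPath U Φ ∧ Φ 0 = Diffeomorph.refl (𝓡 n) N ∞ ∧ Φ 1 = φ ∧
    pathLength norm Φ ≤ C

variable {Φ Ψ : ℝ → (N ≃ₘ^∞⟮𝓡 n, 𝓡 n⟯ N)} {U : Set N}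
  {norm : (∀ y : N, TangentSpace (𝓡 n) y) → ℝ≥0∞}

theorem IsReachable.mono {φ : N ≃ₘ^∞⟮𝓡 n, 𝓡 n⟯ N} {C D : ℝ≥0∞} (h : IsReachable U norm φ C)
    (hCD : C ≤ D) : IsReachable U norm φ D := by
  obtain ⟨Φ, h1, h2, h3, h4⟩ := h
  exact ⟨Φ, h1, h2, h3, h4.trans hCD⟩

theorem IsDiffPath.mono {V : Set N} (h : IsDiffPath U Φ) (hUV : U ⊆ V) : IsDiffPath V Φ := by
  obtain ⟨h1, K, hK, hKU, h2⟩ := h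
  exact ⟨h1, K, hK, hKU.trans hUV, h2⟩

theorem IsSmoothFamily.comp (hΦ : IsSmoothFamily Φ) {b : ℝ → ℝ} (hb : ContDiff ℝ ∞ b) :
    IsSmoothFamily fun t => Φ (b t) := by
  have hg : ContMDiff (𝓘(ℝ, ℝ).prod (𝓡 n)) (𝓘(ℝ, ℝ).prod (𝓡 n)) ∞
      (fun q : ℝ × N => (b q.1, q.2)) :=
    (hb.contMDiff.comp contMDiff_fst).prodMk contMDiff_snd
  exact ContMDiff.comp (g := fun q : ℝ × N => Φ q.1 q.2) hΦ hg

theorem IsSmoothFamily.trans (hΨ : IsSmoothFamily Ψ) (hΦ : IsSmoothFamily Φ) :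
    IsSmoothFamily fun t => (Ψ t).trans (Φ t) := by
  have hg : ContMDiff (𝓘(ℝ, ℝ).prod (𝓡 n)) (𝓘(ℝ, ℝ).prod (𝓡 n)) ∞
      (fun q : ℝ × N => (q.1, Ψ q.1 q.2)) := contMDiff_fst.prodMk hΨ
  exact ContMDiff.comp (g := fun q : ℝ × N => Φ q.1 q.2) hΦ hg

theorem isSmoothFamily_const (φ : N ≃ₘ^∞⟮𝓡 n, 𝓡 n⟯ N) : IsSmoothFamily fun _ : ℝ => φ :=
  φ.contMDiff.comp contMDiff_snd

theorem IsSmoothFamily.contMDiff_path (hΦ : IsSmoothFamily Φ) (x : N) :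
    ContMDiff 𝓘(ℝ, ℝ) (𝓡 n) ∞ fun t => Φ t x := by
  have hg : ContMDiff 𝓘(ℝ, ℝ) (𝓘(ℝ, ℝ).prod (𝓡 n)) ∞ (fun t : ℝ => (t, x)) :=
    contMDiff_id.prodMk contMDiff_const
  exact ContMDiff.comp (g := fun q : ℝ × N => Φ q.1 q.2) hΦ hg

theorem pathVelocity_comp (hΦ : IsSmoothFamily Φ) {b : ℝ → ℝ} {t : ℝ}
    (hb : DifferentiableAt ℝ b t) :
    pathVelocity (fun t => Φ (b t)) t = fun y => deriv b t • pathVelocity Φ (b t) y := by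
  funext y
  have h1 : MDifferentiableAt 𝓘(ℝ, ℝ) (𝓡 n) (fun τ => Φ τ ((Φ (b t)).symm y)) (b t) :=
    (hΦ.contMDiff_path _).mdifferentiableAt (by simp)
  have h2 := mfderiv_comp (I := 𝓘(ℝ, ℝ)) (I' := 𝓘(ℝ, ℝ)) (I'' := 𝓡 n) t h1
    hb.mdifferentiableAt
  have h3 : mfderiv 𝓘(ℝ, ℝ) 𝓘(ℝ, ℝ) b t (1 : ℝ) = deriv b t • (1 : ℝ) := by
    rw [mfderiv_eq_fderiv, smul_eq_mul, mul_one]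
    exact fderiv_apply_one_eq_deriv
  unfold pathVelocity
  have h4 : (fun τ => Φ (b τ) ((Φ (b t)).symm y)) =
      (fun τ => Φ τ ((Φ (b t)).symm y)) ∘ b := rfl
  rw [h4, h2]
  exact (congrArg (mfderiv 𝓘(ℝ, ℝ) (𝓡 n) (fun τ => Φ τ ((Φ (b t)).symm y)) (b t)) h3).trans
    (ContinuousLinearMap.map_smul _ _ _)

theorem pathVelocity_congr {t : ℝ} (h : Φ =ᶠ[nhds t] Ψ) : pathVelocity Φ t = pathVelocity Ψ t := by
  funext y
  unfold pathVelocity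
  rw [h.eq_of_nhds]
  have : (fun τ => Φ τ ((Ψ t).symm y)) =ᶠ[nhds t] fun τ => Ψ τ ((Ψ t).symm y) :=
    h.mono fun τ hτ => by simp only [hτ]
  rw [this.mfderiv_eq]

/-- Right invariance: `ψ.trans (Φ t)` is `Φ t ∘ ψ`, and `ψ` cancels in the velocity. -/
theorem pathVelocity_trans_left (ψ : N ≃ₘ^∞⟮𝓡 n, 𝓡 n⟯ N) (t : ℝ) :
    pathVelocity (fun t => ψ.trans (Φ t)) t = pathVelocity Φ t := by
  funext y
  unfold pathVelocity
  have : (fun τ => (ψ.trans (Φ τ)) ((ψ.trans (Φ t)).symm y)) =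
      fun τ => Φ τ ((Φ t).symm y) := by
    funext τ
    rw [Diffeomorph.symm_trans']
    simp
  rw [this]
  rfl

/-- Monotone substitution, valid for arbitrary `f`. Nothing is known about measurability of the
speed of a path, so its integrals are only treated by such rules. -/
theorem setLIntegral_comp_deriv_le {b : ℝ → ℝ} (hb : ContDiff ℝ ∞ b) (hm : Monotone b)
    (h0 : ∀ t, b t ∈ Icc (0 : ℝ) 1) {s : Set ℝ} (hs : MeasurableSet s) (f : ℝ → ℝ≥0∞) :
    ∫⁻ t in s, ‖deriv b t‖ₑ * f (b t) ≤ ∫⁻ t in Icc (0 : ℝ) 1, f t := by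
  have h1 := lintegral_image_eq_lintegral_deriv_mul_of_monotoneOn hs
    (fun x _ => (hb.differentiable (by simp) x).hasDerivAt.hasDerivWithinAt) (hm.monotoneOn s) f
  have h2 : ∀ t, ‖deriv b t‖ₑ = ENNReal.ofReal (deriv b t) := fun t =>
    Real.enorm_eq_ofReal (hm.deriv_nonneg)
  simp only [h2]
  rw [← h1]
  refine lintegral_mono_set ?_
  rintro _ ⟨t, _, rfl⟩
  exact h0 t

theorem setLIntegral_reparam_le (hnorm : IsHomogeneousNorm norm) (hΦ : IsSmoothFamily Φ)
    {b : ℝ → ℝ} (hb : ContDiff ℝ ∞ b) (hm : Monotone b) (h0 : ∀ t, b t ∈ Icc (0 : ℝ) 1)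
    {s : Set ℝ} (hs : MeasurableSet s) :
    ∫⁻ t in s, norm (pathVelocity (fun t => Φ (b t)) t) ≤ pathLength norm Φ := by
  refine le_trans ?_ (setLIntegral_comp_deriv_le hb hm h0 hs fun t => norm (pathVelocity Φ t))
  refine lintegral_mono fun t => ?_
  rw [pathVelocity_comp hΦ (hb.differentiable (by simp) t)]
  exact hnorm _ _

/-- Reparametrization: the path can be made stationary outside `[0,1]`. -/
theorem IsDiffPath.exists_reparam (hnorm : IsHomogeneousNorm norm) (hΦ : IsDiffPath U Φ) :
    ∃ Ψ : ℝ → (N ≃ₘ^∞⟮𝓡 n, 𝓡 n⟯ N), IsSmoothFamily Ψ ∧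
      (∃ K : Set N, IsCompact K ∧ K ⊆ U ∧ ∀ t, ∀ x ∉ K, Ψ t x = x) ∧ Ψ 0 = Φ 0 ∧ Ψ 1 = Φ 1 ∧
      pathLength norm Ψ ≤ pathLength norm Φ := by
  obtain ⟨h1, K, hK, hKU, h2⟩ := hΦ
  -- Every real time is sent into `[0,1]`, so the common support is valid for all times. Transport
  -- to another manifold needs this.
  have hr : ∀ t, Real.smoothTransition t ∈ Icc (0 : ℝ) 1 := fun t =>
    ⟨Real.smoothTransition.nonneg t, Real.smoothTransition.le_one t⟩
  refine ⟨fun t => Φ (Real.smoothTransition t), IsSmoothFamily.comp h1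
    Real.smoothTransition.contDiff, ⟨K, hK, hKU, fun t => h2 _ (hr t)⟩, ?_, ?_, ?_⟩
  · simp
  · simp
  · exact setLIntegral_reparam_le hnorm h1 Real.smoothTransition.contDiff
      Real.smoothTransition.monotone hr measurableSet_Icc

/-- Run `Ψ` during the first half of the time and `Φ` during the second, each slowed down to be
stationary on the other half, which keeps the product smooth. By right invariance the second half
has the speed of `Φ`. -/
theorem IsReachable.trans (hnorm : IsHomogeneousNorm norm) {φ ψ : N ≃ₘ^∞⟮𝓡 n, 𝓡 n⟯ N}
    {C D : ℝ≥0∞} (hψ : IsReachable U norm ψ C) (hφ : IsReachable U norm φ D) :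
    IsReachable U norm (ψ.trans φ) (C + D) := by
  obtain ⟨Ψ, ⟨hΨ, K, hK, hKU, hΨK⟩, hΨ0, hΨ1, hΨC⟩ := hψ
  obtain ⟨Φ, ⟨hΦ, K', hK', hKU', hΦK⟩, hΦ0, hΦ1, hΦD⟩ := hφ
  set b : ℝ → ℝ := fun t => Real.smoothTransition (2 * t) with hb
  set a : ℝ → ℝ := fun t => Real.smoothTransition (2 * t - 1) with ha
  have hbs : ContDiff ℝ ∞ b := Real.smoothTransition.contDiff.comp (by fun_prop)
  have has : ContDiff ℝ ∞ a := Real.smoothTransition.contDiff.comp (by fun_prop)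
  have hbm : Monotone b := fun x y hxy => Real.smoothTransition.monotone (by linarith)
  have ham : Monotone a := fun x y hxy => Real.smoothTransition.monotone (by linarith)
  have hbr : ∀ t, b t ∈ Icc (0 : ℝ) 1 := fun t =>
    ⟨Real.smoothTransition.nonneg _, Real.smoothTransition.le_one _⟩
  have har : ∀ t, a t ∈ Icc (0 : ℝ) 1 := fun t =>
    ⟨Real.smoothTransition.nonneg _, Real.smoothTransition.le_one _⟩
  set χ : ℝ → (N ≃ₘ^∞⟮𝓡 n, 𝓡 n⟯ N) := fun t => (Ψ (b t)).trans (Φ (a t)) with hχ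
  have hχs : IsSmoothFamily χ := (IsSmoothFamily.comp hΨ hbs).trans (IsSmoothFamily.comp hΦ has)
  have e1 : ∀ t ∈ Ioo (0 : ℝ) (1 / 2), pathVelocity χ t = pathVelocity (fun t => Ψ (b t)) t := by
    intro t ht
    refine pathVelocity_congr ?_
    filter_upwards [Iio_mem_nhds ht.2] with τ hτ
    have : a τ = 0 := Real.smoothTransition.zero_of_nonpos (by
      have : τ < 1 / 2 := hτ
      linarith)
    simp [hχ, this, hΦ0]
  have e2 : ∀ t ∈ Ioo (1 / 2 : ℝ) 1, pathVelocity χ t = pathVelocity (fun t => Φ (a t)) t := by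
    intro t ht
    rw [← pathVelocity_trans_left (Φ := fun t => Φ (a t)) ψ t]
    refine pathVelocity_congr ?_
    filter_upwards [Ioi_mem_nhds ht.1] with τ hτ
    have : b τ = 1 := Real.smoothTransition.one_of_one_le (by
      have : 1 / 2 < τ := hτ
      linarith)
    simp [hχ, this, hΨ1]
  refine ⟨χ, ⟨hχs, K ∪ K', hK.union hK', union_subset hKU hKU', fun t _ x hx => ?_⟩, ?_, ?_, ?_⟩
  · rw [mem_union, not_or] at hx
    simp [hχ, hΨK _ (hbr t) x hx.1, hΦK _ (har t) x hx.2]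
  · have h1 : b 0 = 0 := by simp [hb]
    have h2 : a 0 = 0 := Real.smoothTransition.zero_of_nonpos (by norm_num)
    simp [hχ, h1, h2, hΨ0, hΦ0]
  · have h1 : b 1 = 1 := Real.smoothTransition.one_of_one_le (by norm_num)
    have h2 : a 1 = 1 := Real.smoothTransition.one_of_one_le (by norm_num)
    simp [hχ, h1, h2, hΨ1, hΦ1]
  -- The velocities are identified on the two open halves only; the three remaining points are null.
  · have hsub : Icc (0 : ℝ) 1 ⊆ Ioo 0 (1 / 2) ∪ (Ioo (1 / 2) 1 ∪ {0, 1 / 2, 1}) := by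
      intro t ht
      rcases eq_or_lt_of_le ht.1 with h | h
      · simp [← h]
      rcases eq_or_lt_of_le ht.2 with h' | h'
      · simp [h']
      rcases lt_trichotomy t (1 / 2) with h'' | h'' | h''
      · exact Or.inl ⟨h, h''⟩
      · simp [h'']
      · exact Or.inr (Or.inl ⟨h'', h'⟩)
    have hnull : (volume : Measure ℝ) {0, 1 / 2, 1} = 0 := (Set.toFinite _).measure_zero _
    calc pathLength norm χ
        ≤ ∫⁻ t in Ioo 0 (1 / 2) ∪ (Ioo (1 / 2) 1 ∪ {0, 1 / 2, 1}), norm (pathVelocity χ t) :=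
          lintegral_mono_set hsub
      _ ≤ (∫⁻ t in Ioo 0 (1 / 2), norm (pathVelocity χ t)) +
          ((∫⁻ t in Ioo (1 / 2) 1, norm (pathVelocity χ t)) +
            ∫⁻ t in {0, 1 / 2, 1}, norm (pathVelocity χ t)) :=
          (lintegral_union_le _ _ _).trans (add_le_add le_rfl (lintegral_union_le _ _ _))
      _ = (∫⁻ t in Ioo 0 (1 / 2), norm (pathVelocity (fun t => Ψ (b t)) t)) +
          ∫⁻ t in Ioo (1 / 2) 1, norm (pathVelocity (fun t => Φ (a t)) t) := by
          rw [setLIntegral_measure_zero _ _ hnull, add_zero]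
          exact congrArg₂ (· + ·)
            (setLIntegral_congr_fun measurableSet_Ioo fun t ht => congrArg norm (e1 t ht))
            (setLIntegral_congr_fun measurableSet_Ioo fun t ht => congrArg norm (e2 t ht))
      _ ≤ C + D := add_le_add
          ((setLIntegral_reparam_le hnorm hΨ hbs hbm hbr measurableSet_Ioo).trans hΨC)
          ((setLIntegral_reparam_le hnorm hΦ has ham har measurableSet_Ioo).trans hΦD)

/-- Run the path backwards and compose on the right with `φ⁻¹`; neither changes the length. -/
theorem IsReachable.symm (hnorm : IsHomogeneousNorm norm) {φ : N ≃ₘ^∞⟮𝓡 n, 𝓡 n⟯ N} {C : ℝ≥0∞}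
    (hφ : IsReachable U norm φ C) : IsReachable U norm φ.symm C := by
  obtain ⟨Φ, ⟨hΦ, K, hK, hKU, hΦK⟩, hΦ0, hΦ1, hΦC⟩ := hφ
  have hr : ContDiff ℝ ∞ fun t : ℝ => 1 - t := by fun_prop
  refine ⟨fun t => φ.symm.trans (Φ (1 - t)),
    ⟨(isSmoothFamily_const _).trans (IsSmoothFamily.comp hΦ hr), K, hK, hKU, ?_⟩, ?_, ?_, ?_⟩
  · intro t ht x hx
    have h1 : φ x = x := by rw [← hΦ1]; exact hΦK 1 (by simp) x hx
    have h2 : φ.symm x = x := by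
      conv_lhs => rw [← h1]
      simp
    have h3 := hΦK (1 - t) ⟨by linarith [ht.2], by linarith [ht.1]⟩ x hx
    simp [h2, h3]
  · simp [hΦ1]
  · simp [hΦ0]
  · refine le_trans ?_ hΦC
    have h1 := lintegral_image_eq_lintegral_deriv_mul_of_antitoneOn (s := Icc (0 : ℝ) 1)
      (f := fun t => 1 - t) (f' := fun _ => -1) measurableSet_Icc
      (fun x _ => ((hasDerivAt_id x).const_sub 1).hasDerivWithinAt)
      (fun x _ y _ hxy => by simp only; linarith) fun t => norm (pathVelocity Φ t)
    have h2 : (fun t : ℝ => 1 - t) '' Icc 0 1 = Icc 0 1 := by simp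
    rw [h2] at h1
    rw [pathLength, pathLength, h1]
    refine lintegral_mono fun t => ?_
    rw [pathVelocity_trans_left, pathVelocity_comp hΦ (hr.differentiable (by simp) t)]
    refine (hnorm _ _).trans ?_
    have : deriv (fun t : ℝ => 1 - t) t = -1 := ((hasDerivAt_id t).const_sub 1).deriv
    rw [this]
    simp

theorem diffDist_le_of_isReachable [CompactSpace N] {φ₀ φ₁ : N ≃ₘ^∞⟮𝓡 n, 𝓡 n⟯ N} {C : ℝ≥0∞}
    (h : IsReachable univ norm (φ₀.symm.trans φ₁) C) : diffDist univ norm φ₀ φ₁ ≤ C := by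
  obtain ⟨Φ, ⟨hΦ, -⟩, hΦ0, hΦ1, hΦC⟩ := h
  have hs : IsSmoothFamily fun t => φ₀.trans (Φ t) := (isSmoothFamily_const _).trans hΦ
  refine (iInf₂_le (fun t => φ₀.trans (Φ t))
    ⟨⟨hs, univ, isCompact_univ, subset_rfl, fun _ _ x hx => absurd (mem_univ x) hx⟩, ?_, ?_⟩).trans ?_
  · unfold pathLength
    simp only [pathVelocity_trans_left]
    exact hΦC
  · simp [hΦ0]
  · simp only [hΦ1]
    exact Diffeomorph.ext fun x => by simp

end Paths

/-! ### Conjugation of compactly supported diffeomorphisms by a partial diffeomorphism -/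

section Transport

variable {n : ℕ} {N N' : Type*} [TopologicalSpace N] [ChartedSpace (Euc n) N]
  [TopologicalSpace N'] [ChartedSpace (Euc n) N']

/-- `e` is a smooth diffeomorphism from its source onto its target. -/
structure IsSmoothPartial (n : ℕ) {N N' : Type*} [TopologicalSpace N] [ChartedSpace (Euc n) N]
    [TopologicalSpace N'] [ChartedSpace (Euc n) N'] (e : OpenPartialHomeomorph N N') : Prop where
  contMDiffOn : ContMDiffOn (𝓡 n) (𝓡 n) ∞ e e.source
  contMDiffOn_symm : ContMDiffOn (𝓡 n) (𝓡 n) ∞ e.symm e.target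

theorem IsSmoothPartial.symm {e : OpenPartialHomeomorph N N'} (he : IsSmoothPartial n e) :
    IsSmoothPartial n e.symm :=
  ⟨he.contMDiffOn_symm, by simpa using he.contMDiffOn⟩

open Classical in
/-- The conjugate of `f` by `e`, extended by the identity. -/
def transportFun {N N' : Type*} [TopologicalSpace N] [TopologicalSpace N']
    (e : OpenPartialHomeomorph N N') (f : N → N) (y : N') : N' :=
  if y ∈ e.target then e (f (e.symm y)) else y

theorem transportFun_of_mem (e : OpenPartialHomeomorph N N') (f : N → N) {y : N'}
    (hy : y ∈ e.target) : transportFun e f y = e (f (e.symm y)) := if_pos hy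

theorem transportFun_of_notMem (e : OpenPartialHomeomorph N N') (f : N → N) {y : N'}
    (hy : y ∉ e.target) : transportFun e f y = y := if_neg hy

theorem transportFun_eq_self {e : OpenPartialHomeomorph N N'} {f : N → N} {K : Set N}
    (hf : ∀ x ∉ K, f x = x) {y : N'} (hy : y ∉ e '' K) :
    transportFun e f y = y := by
  by_cases hyt : y ∈ e.target
  · rw [transportFun_of_mem e f hyt, hf, e.right_inv hyt]
    exact fun h => hy ⟨_, h, e.right_inv hyt⟩
  · exact transportFun_of_notMem e f hyt

theorem mem_of_eq_self_off {X : Type*} {f : X → X} (hinj : Function.Injective f) {K : Set X}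
    (hf : ∀ x ∉ K, f x = x) {x : X} (hx : x ∈ K) : f x ∈ K := by
  by_contra h
  exact h (by rwa [hinj (hf _ h)])

theorem mapsTo_of_eq_self_off {X : Type*} {f : X → X} (hinj : Function.Injective f) {K S : Set X}
    (hK : K ⊆ S) (hf : ∀ x ∉ K, f x = x) {x : X} (hx : x ∈ S) : f x ∈ S := by
  by_cases h : x ∈ K
  · exact hK (mem_of_eq_self_off hinj hf h)
  · rwa [hf x h]

/-- The target of `e` and the complement of `e '' K` cover `N'`. On the first the map is a
composition of smooth maps, on the second it is the identity. -/
theorem contMDiff_transportFun [T2Space N'] {e : OpenPartialHomeomorph N N'}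
    (he : IsSmoothPartial n e) {f : ℝ → N → N}
    (hf : ContMDiff (𝓘(ℝ, ℝ).prod (𝓡 n)) (𝓡 n) ∞ fun q : ℝ × N => f q.1 q.2)
    (hinj : ∀ t, Function.Injective (f t))
    {K : Set N} (hK : IsCompact K) (hKe : K ⊆ e.source) (hfK : ∀ t, ∀ x ∉ K, f t x = x) :
    ContMDiff (𝓘(ℝ, ℝ).prod (𝓡 n)) (𝓡 n) ∞ fun q : ℝ × N' => transportFun e (f q.1) q.2 := by
  rintro ⟨t, y⟩
  by_cases hy : y ∈ e.target
  · have h1 : ContMDiffAt (𝓘(ℝ, ℝ).prod (𝓡 n)) (𝓘(ℝ, ℝ).prod (𝓡 n)) ∞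
        (fun q : ℝ × N' => (q.1, e.symm q.2)) (t, y) := by
      refine contMDiffAt_fst.prodMk ?_
      exact (he.contMDiffOn_symm.contMDiffAt (e.open_target.mem_nhds hy)).comp (t, y)
        contMDiffAt_snd
    have h2 : ContMDiffAt (𝓘(ℝ, ℝ).prod (𝓡 n)) (𝓡 n) ∞
        (fun q : ℝ × N' => f q.1 (e.symm q.2)) (t, y) :=
      ContMDiffAt.comp (g := fun q : ℝ × N => f q.1 q.2) (t, y) (hf _) h1
    have h3 : f t (e.symm y) ∈ e.source :=
      mapsTo_of_eq_self_off (hinj t) hKe (hfK t) (e.map_target hy)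
    have h4 : ContMDiffAt (𝓘(ℝ, ℝ).prod (𝓡 n)) (𝓡 n) ∞
        (fun q : ℝ × N' => e (f q.1 (e.symm q.2))) (t, y) :=
      ContMDiffAt.comp (g := e) (t, y)
        (he.contMDiffOn.contMDiffAt (e.open_source.mem_nhds h3)) h2
    refine h4.congr_of_eventuallyEq ?_
    filter_upwards [continuous_snd.continuousAt.preimage_mem_nhds (e.open_target.mem_nhds hy)]
      with q hq
    exact transportFun_of_mem e _ hq
  -- Compactness of `K` and the Hausdorff property of `N'` make the complement open.
  · have hc : IsClosed (e '' K) := (hK.image_of_continuousOn (e.continuousOn.mono hKe)).isClosed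
    have hyK : y ∈ (e '' K)ᶜ := by
      rintro ⟨x, hx, rfl⟩
      exact hy (e.map_source (hKe hx))
    refine (contMDiffAt_snd (n := ∞)).congr_of_eventuallyEq ?_
    filter_upwards [continuous_snd.continuousAt.preimage_mem_nhds (hc.isOpen_compl.mem_nhds hyK)]
      with q hq
    exact transportFun_eq_self (hfK q.1) hq

theorem contMDiff_transportFun_diffeomorph [T2Space N'] {e : OpenPartialHomeomorph N N'}
    (he : IsSmoothPartial n e) (φ : N ≃ₘ^∞⟮𝓡 n, 𝓡 n⟯ N) {K : Set N} (hK : IsCompact K)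
    (hKe : K ⊆ e.source) (hφ : ∀ x ∉ K, φ x = x) :
    ContMDiff (𝓡 n) (𝓡 n) ∞ (transportFun e φ) := by
  have h1 := contMDiff_transportFun (f := fun _ => φ) he (isSmoothFamily_const φ) (fun _ => φ.injective) hK hKe
    fun _ => hφ
  have h2 : ContMDiff (𝓡 n) (𝓘(ℝ, ℝ).prod (𝓡 n)) ∞ (fun y : N' => ((0 : ℝ), y)) :=
    contMDiff_const.prodMk contMDiff_id
  exact ContMDiff.comp (g := fun q : ℝ × N' => transportFun e φ q.2) h1 h2

theorem symm_eq_self_off (φ : N ≃ₘ^∞⟮𝓡 n, 𝓡 n⟯ N) {K : Set N} (hφ : ∀ x ∉ K, φ x = x) {x : N}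
    (hx : x ∉ K) : φ.symm x = x := by
  conv_lhs => rw [← hφ x hx]
  simp

theorem transportFun_leftInverse {e : OpenPartialHomeomorph N N'} {f g : N → N}
    (hgf : Function.LeftInverse g f) (hf : ∀ x ∈ e.source, f x ∈ e.source) (y : N') :
    transportFun e g (transportFun e f y) = y := by
  by_cases hy : y ∈ e.target
  · have h1 : f (e.symm y) ∈ e.source := hf _ (e.map_target hy)
    rw [transportFun_of_mem e f hy, transportFun_of_mem e g (e.map_source h1), e.left_inv h1,
      hgf, e.right_inv hy]
  · rw [transportFun_of_notMem e f hy, transportFun_of_notMem e g hy]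

/-- The conjugate by `e` of a diffeomorphism with compact support in the source of `e`. -/
def transportDiffeo [T2Space N'] (e : OpenPartialHomeomorph N N') (he : IsSmoothPartial n e)
    (φ : N ≃ₘ^∞⟮𝓡 n, 𝓡 n⟯ N) (K : Set N) (hK : IsCompact K) (hKe : K ⊆ e.source)
    (hφ : ∀ x ∉ K, φ x = x) : N' ≃ₘ^∞⟮𝓡 n, 𝓡 n⟯ N' where
  toFun := transportFun e φ
  invFun := transportFun e φ.symm
  left_inv := transportFun_leftInverse φ.symm_apply_apply fun _ hx =>
    mapsTo_of_eq_self_off φ.injective hKe hφ hx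
  right_inv := transportFun_leftInverse φ.apply_symm_apply fun _ hx =>
    mapsTo_of_eq_self_off φ.symm.injective hKe (fun _ => symm_eq_self_off φ hφ) hx
  contMDiff_toFun := contMDiff_transportFun_diffeomorph he φ hK hKe hφ
  contMDiff_invFun := contMDiff_transportFun_diffeomorph he φ.symm hK hKe
    fun _ => symm_eq_self_off φ hφ

section

variable [T2Space N'] {e : OpenPartialHomeomorph N N'} (he : IsSmoothPartial n e) {K : Set N}
  (hK : IsCompact K) (hKe : K ⊆ e.source)

theorem transportDiffeo_apply {φ : N ≃ₘ^∞⟮𝓡 n, 𝓡 n⟯ N} (hφ : ∀ x ∉ K, φ x = x) (y : N') :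
    transportDiffeo e he φ K hK hKe hφ y = transportFun e φ y := rfl

theorem transportDiffeo_refl {φ : N ≃ₘ^∞⟮𝓡 n, 𝓡 n⟯ N} (hφ : ∀ x ∉ K, φ x = x)
    (h : φ = Diffeomorph.refl (𝓡 n) N ∞) :
    transportDiffeo e he φ K hK hKe hφ = Diffeomorph.refl (𝓡 n) N' ∞ := by
  subst h
  refine Diffeomorph.ext fun y => ?_
  rw [transportDiffeo_apply]
  exact transportFun_eq_self (K := ∅) (fun _ _ => rfl) (by simp)

variable {Φ : ℝ → (N ≃ₘ^∞⟮𝓡 n, 𝓡 n⟯ N)}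

theorem IsSmoothFamily.transport (hΦ : IsSmoothFamily Φ) (hΦK : ∀ t, ∀ x ∉ K, Φ t x = x) :
    IsSmoothFamily fun t => transportDiffeo e he (Φ t) K hK hKe (hΦK t) :=
  contMDiff_transportFun (f := fun t => Φ t) he hΦ (fun t => (Φ t).injective) hK hKe hΦK

theorem IsSmoothFamily.isDiffPath_transport (hΦ : IsSmoothFamily Φ)
    (hΦK : ∀ t, ∀ x ∉ K, Φ t x = x) :
    IsDiffPath (e '' K) fun t => transportDiffeo e he (Φ t) K hK hKe (hΦK t) :=
  ⟨hΦ.transport he hK hKe hΦK, e '' K, hK.image_of_continuousOn (e.continuousOn.mono hKe),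
    subset_rfl, fun t _ _ hy => transportFun_eq_self (hΦK t) hy⟩

/-- The push-forward of a vector field on `N` by `e`, extended by zero. -/
def pushField (e : OpenPartialHomeomorph N N') (u : ∀ x : N, TangentSpace (𝓡 n) x) (y : N') :
    TangentSpace (𝓡 n) y :=
  open Classical in
  if y ∈ e.target then
    (mfderiv (𝓡 n) (𝓡 n) e (e.symm y) (u (e.symm y)) : Euc n) else (0 : Euc n)

theorem pushField_of_mem (u : ∀ x : N, TangentSpace (𝓡 n) x) {y : N'} (hy : y ∈ e.target) :
    (pushField e u y : Euc n) = mfderiv (𝓡 n) (𝓡 n) e (e.symm y) (u (e.symm y)) := by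
  exact if_pos hy

theorem pushField_of_notMem (u : ∀ x : N, TangentSpace (𝓡 n) x) {y : N'} (hy : y ∉ e.target) :
    (pushField e u y : Euc n) = 0 := by
  exact if_neg hy

/-- The velocity of a curve, as a vector of the model space. -/
def curveVelocity (n : ℕ) {N : Type*} [TopologicalSpace N] [ChartedSpace (Euc n) N]
    (c : ℝ → N) (t : ℝ) : Euc n :=
  mfderiv 𝓘(ℝ, ℝ) (𝓡 n) c t (1 : ℝ)

theorem curveVelocity_const (y : N) (t : ℝ) : curveVelocity n (fun _ => y) t = 0 := by
  rw [curveVelocity, mfderiv_const]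
  rfl

theorem curveVelocity_comp {f : N → N'} {c : ℝ → N} {t : ℝ} {x : N} (hx : c t = x)
    (hf : MDifferentiableAt (𝓡 n) (𝓡 n) f x) (hc : MDifferentiableAt 𝓘(ℝ, ℝ) (𝓡 n) c t) :
    curveVelocity n (f ∘ c) t = mfderiv (𝓡 n) (𝓡 n) f x (curveVelocity n c t) := by
  subst hx
  rw [curveVelocity, mfderiv_comp (I' := 𝓡 n) t hf hc]
  rfl

/-- On the target of `e` the moving point is `e` applied to a curve in `N`, so the chain rule
applies; off the target nothing moves. -/
theorem pathVelocity_transport (hΦ : IsSmoothFamily Φ) (hΦK : ∀ t, ∀ x ∉ K, Φ t x = x) (t : ℝ) :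
    pathVelocity (fun t => transportDiffeo e he (Φ t) K hK hKe (hΦK t)) t =
      pushField e (pathVelocity Φ t) := by
  funext y
  change curveVelocity n (fun τ => transportFun e (Φ τ) (transportFun e (Φ t).symm y)) t = _
  by_cases hy : y ∈ e.target
  · refine Eq.trans ?_ (pushField_of_mem (pathVelocity Φ t) hy).symm
    have hz : (Φ t).symm (e.symm y) ∈ e.source := mapsTo_of_eq_self_off (Φ t).symm.injective hKe
      (fun _ => symm_eq_self_off (Φ t) (hΦK t)) (e.map_target hy)
    have h1 : (fun τ => transportFun e (Φ τ) (transportFun e (Φ t).symm y)) =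
        e ∘ fun τ => Φ τ ((Φ t).symm (e.symm y)) := by
      funext τ
      rw [transportFun_of_mem e _ hy, transportFun_of_mem e _ (e.map_source hz), e.left_inv hz]
      rfl
    have h3 : MDifferentiableAt (𝓡 n) (𝓡 n) e (e.symm y) :=
      (he.contMDiffOn.contMDiffAt
        (e.open_source.mem_nhds (e.map_target hy))).mdifferentiableAt (by simp)
    rw [h1]
    exact curveVelocity_comp (by simp) h3 ((hΦ.contMDiff_path _).mdifferentiableAt (by simp))
  · refine Eq.trans ?_ (pushField_of_notMem (pathVelocity Φ t) hy).symm
    have h1 : (fun τ => transportFun e (Φ τ) (transportFun e (Φ t).symm y)) = fun _ => y := by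
      funext τ
      rw [transportFun_of_notMem e _ hy, transportFun_of_notMem e _ hy]
    rw [h1]
    exact curveVelocity_const y t

end

end Transport

/-! ### Smoothness and support of velocity fields -/

section EuclideanVelocity

variable {n : ℕ} {Φ : ℝ → (Euc n ≃ₘ^∞⟮𝓡 n, 𝓡 n⟯ Euc n)}

theorem IsSmoothFamily.contDiff (hΦ : IsSmoothFamily Φ) :
    ContDiff ℝ ∞ fun q : ℝ × Euc n => Φ q.1 q.2 := by
  rw [← contMDiff_iff_contDiff, modelWithCornersSelf_prod, ← chartedSpaceSelf_prod]
  exact hΦ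

/-- The field is the time derivative of the joint map evaluated at `(t, Φ_t⁻¹ y)`; with `t` fixed,
only smoothness of the single inverse `Φ_t⁻¹` is needed. -/
theorem IsSmoothFamily.contDiff_pathVelocity (hΦ : IsSmoothFamily Φ) (t : ℝ) :
    ContDiff ℝ ∞ (pathVelocity Φ t : Euc n → Euc n) := by
  have h0 := hΦ.contDiff
  have h1 : (pathVelocity Φ t : Euc n → Euc n) = fun y =>
      fderiv ℝ (fun q : ℝ × Euc n => Φ q.1 q.2) (t, (Φ t).symm y) ((1 : ℝ), (0 : Euc n)) := by
    funext y
    unfold pathVelocity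
    rw [mfderiv_eq_fderiv]
    have h2 : HasFDerivAt (fun q : ℝ × Euc n => Φ q.1 q.2)
        (fderiv ℝ (fun q : ℝ × Euc n => Φ q.1 q.2) (t, (Φ t).symm y)) (t, (Φ t).symm y) :=
      (h0.differentiable (by simp) _).hasFDerivAt
    have h3 : HasDerivAt (fun τ : ℝ => (τ, (Φ t).symm y)) ((1 : ℝ), (0 : Euc n)) t :=
      (hasDerivAt_id t).prodMk (hasDerivAt_const t _)
    have h4 := h2.comp_hasDerivAt t h3
    exact h4.deriv
  rw [h1]
  have h5 : ContDiff ℝ ∞ (Φ t).symm := (Φ t).symm.contMDiff.contDiff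
  exact ((h0.fderiv_right (m := ∞) (by simp)).comp (contDiff_const.prodMk h5)).clm_apply
    contDiff_const

theorem pathVelocity_eq_zero_of_notMem {N : Type*} [TopologicalSpace N] [ChartedSpace (Euc n) N]
    {Φ : ℝ → (N ≃ₘ^∞⟮𝓡 n, 𝓡 n⟯ N)} {K : Set N} (hΦK : ∀ t, ∀ x ∉ K, Φ t x = x) (t : ℝ) {y : N}
    (hy : y ∉ K) : pathVelocity Φ t y = (0 : Euc n) := by
  unfold pathVelocity
  have h1 : (fun τ => Φ τ ((Φ t).symm y)) = fun _ => y := by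
    funext τ
    rw [symm_eq_self_off (Φ t) (hΦK t) hy, hΦK τ y hy]
  rw [h1, mfderiv_const]
  rfl

end EuclideanVelocity

/-! ### Homogeneity of the Sobolev norms -/

section Homogeneity

variable {n : ℕ} {F : Type*} [NormedAddCommGroup F] [NormedSpace ℝ F]

theorem iteratedFDeriv_const_smul_field (c : ℝ) (j : ℕ) (f : Euc n → F) :
    iteratedFDeriv ℝ j (c • f) = c • iteratedFDeriv ℝ j f := by
  induction j with
  | zero => ext x m; simp
  | succ j ih =>
    rw [iteratedFDeriv_succ_eq_comp_left, iteratedFDeriv_succ_eq_comp_left, ih,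
      fderiv_const_smul_field]
    ext x m
    simp

theorem lpEnergy_const_smul {p : ℝ} (hp : 0 < p) (c : ℝ) (f : Euc n → F) :
    lpEnergy p (c • f) = ‖c‖ₑ ^ p * lpEnergy p f := by
  unfold lpEnergy
  rw [← lintegral_const_mul' _ _ (ENNReal.rpow_ne_top_of_nonneg hp.le (by simp))]
  refine lintegral_congr fun x => ?_
  rw [Pi.smul_apply, enorm_smul, ENNReal.mul_rpow_of_nonneg _ _ hp.le]

theorem fracEnergy_const_smul {σ p : ℝ} (hp : 0 < p) (c : ℝ) (f : Euc n → F) :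
    fracEnergy σ p (c • f) = ‖c‖ₑ ^ p * fracEnergy σ p f := by
  have hc : ‖c‖ₑ ^ p ≠ ⊤ := ENNReal.rpow_ne_top_of_nonneg hp.le (by simp)
  unfold fracEnergy
  split_ifs
  · simp
  unfold gagliardoEnergy
  rw [← lintegral_const_mul' _ _ hc]
  refine lintegral_congr fun x => ?_
  rw [← lintegral_const_mul' _ _ hc]
  refine lintegral_congr fun y => ?_
  rw [Pi.smul_apply, Pi.smul_apply, ← smul_sub, enorm_smul, ENNReal.mul_rpow_of_nonneg _ _ hp.le,
    mul_div_assoc]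

theorem sobolevNorm_const_smul (s : ℝ) {p : ℝ} (hp : 1 ≤ p) (c : ℝ) (f : Euc n → F) :
    sobolevNorm s p (c • f) = ‖c‖ₑ * sobolevNorm s p f := by
  have hp0 : 0 < p := by linarith
  have h : ∀ X : ℝ≥0∞, (‖c‖ₑ ^ p * X) ^ (1 / p) = ‖c‖ₑ * X ^ (1 / p) := fun X => by
    rw [ENNReal.mul_rpow_of_nonneg _ _ (by positivity), ← ENNReal.rpow_mul,
      mul_one_div_cancel hp0.ne', ENNReal.rpow_one]
  simp only [sobolevNorm_eq s hp, iteratedFDeriv_const_smul_field, lpEnergy_const_smul hp0,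
    fracEnergy_const_smul hp0, h, mul_add, Finset.mul_sum]

theorem isHomogeneousNorm_sobolevNorm (n : ℕ) (s : ℝ) {p : ℝ} (hp : 1 ≤ p) :
    IsHomogeneousNorm (n := n) (N := Euc n) fun u => sobolevNorm (F := Euc n) s p u :=
  fun c u => (sobolevNorm_const_smul s hp c (u : Euc n → Euc n)).le

variable {M : Type*} [TopologicalSpace M] [ChartedSpace (Euc n) M] [IsManifold (𝓡 n) ∞ M]
  {g : ContMDiffRiemannianMetric (𝓡 n) ∞ (Euc n) (fun x : M => TangentSpace (𝓡 n) x)}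

theorem NormalBall.localize_of_mem (B : NormalBall g) (ρ : M → ℝ)
    (u : ∀ y : M, TangentSpace (𝓡 n) y) {v : Euc n} (hv : v ∈ ball (0 : Euc n) B.radius) :
    B.localize ρ u v =
      ρ (B.coord v) • ((mfderiv (𝓡 n) (𝓡 n) B.coord v).inverse (u (B.coord v)) : Euc n) :=
  indicator_of_mem hv _

theorem NormalBall.localize_of_notMem (B : NormalBall g) (ρ : M → ℝ)
    (u : ∀ y : M, TangentSpace (𝓡 n) y) {v : Euc n} (hv : v ∉ ball (0 : Euc n) B.radius) :
    B.localize ρ u v = 0 :=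
  indicator_of_notMem hv _

theorem NormalBall.localize_const_smul (B : NormalBall g) (ρ : M → ℝ) (c : ℝ)
    (u : ∀ y : M, TangentSpace (𝓡 n) y) :
    B.localize ρ (fun y => c • u y) = c • B.localize ρ u := by
  funext v
  rw [Pi.smul_apply]
  by_cases hv : v ∈ ball (0 : Euc n) B.radius
  · rw [B.localize_of_mem ρ _ hv, B.localize_of_mem ρ _ hv]
    have key : ∀ (A : Euc n →L[ℝ] Euc n) (r : ℝ) (w : Euc n), r • A (c • w) = c • r • A w :=
      fun A r w => by rw [A.map_smul, smul_comm]
    exact key _ _ _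
  · rw [B.localize_of_notMem ρ _ hv, B.localize_of_notMem ρ _ hv, smul_zero]

theorem isHomogeneousNorm_manifoldSobolevNorm {ι : Type*} [Fintype ι] (B : ι → NormalBall g)
    (ρ : SmoothPartitionOfUnity ι (𝓡 n) M univ) (s : ℝ) {p : ℝ} (hp : 1 ≤ p) :
    IsHomogeneousNorm (manifoldSobolevNorm B ρ s p) := by
  intro c u
  refine le_of_eq ?_
  unfold manifoldSobolevNorm
  simp only [NormalBall.localize_const_smul, sobolevNorm_const_smul s hp]
  simp only [ENNReal.mul_rpow_of_nonneg _ _ (zero_le_two (α := ℝ))]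
  rw [← Finset.mul_sum, ENNReal.mul_rpow_of_nonneg _ _ (by norm_num), ← ENNReal.rpow_mul]
  norm_num

end Homogeneity

/-! ### Pushed-forward fields in normal coordinates -/

section LocalizedPush

variable {n : ℕ} {M : Type*} [TopologicalSpace M] [ChartedSpace (Euc n) M]

theorem IsSmoothPartial.trans {N₁ N₂ N₃ : Type*} [TopologicalSpace N₁] [ChartedSpace (Euc n) N₁]
    [TopologicalSpace N₂] [ChartedSpace (Euc n) N₂] [TopologicalSpace N₃] [ChartedSpace (Euc n) N₃]
    {e : OpenPartialHomeomorph N₁ N₂} {f : OpenPartialHomeomorph N₂ N₃}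
    (he : IsSmoothPartial n e) (hf : IsSmoothPartial n f) : IsSmoothPartial n (e.trans f) := by
  constructor
  · refine hf.contMDiffOn.comp (he.contMDiffOn.mono ?_) ?_
    · rw [e.trans_source]; exact inter_subset_left
    · rw [e.trans_source]; exact inter_subset_right
  · rw [OpenPartialHomeomorph.trans_symm_eq_symm_trans_symm, e.trans_target]
    refine he.contMDiffOn_symm.comp (hf.contMDiffOn_symm.mono inter_subset_left) ?_
    exact inter_subset_right

theorem IsSmoothPartial.mdifferentiable {N₁ N₂ : Type*} [TopologicalSpace N₁]
    [ChartedSpace (Euc n) N₁] [TopologicalSpace N₂] [ChartedSpace (Euc n) N₂]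
    {e : OpenPartialHomeomorph N₁ N₂} (he : IsSmoothPartial n e) :
    e.MDifferentiable (𝓡 n) (𝓡 n) :=
  ⟨he.contMDiffOn.mdifferentiableOn (by simp), he.contMDiffOn_symm.mdifferentiableOn (by simp)⟩

theorem IsSmoothPartial.isInvertible_mfderiv {N₁ N₂ : Type*} [TopologicalSpace N₁]
    [ChartedSpace (Euc n) N₁] [IsManifold (𝓡 n) ∞ N₁] [TopologicalSpace N₂]
    [ChartedSpace (Euc n) N₂] [IsManifold (𝓡 n) ∞ N₂]
    {e : OpenPartialHomeomorph N₁ N₂} (he : IsSmoothPartial n e) {x : N₁} (hx : x ∈ e.source) :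
    (mfderiv (𝓡 n) (𝓡 n) e x).IsInvertible :=
  haveI : IsManifold (𝓡 n) 1 N₁ := IsManifold.of_le (n := ∞) (by simp)
  haveI : IsManifold (𝓡 n) 1 N₂ := IsManifold.of_le (n := ∞) (by simp)
  ⟨he.mdifferentiable.mfderiv hx, rfl⟩

theorem IsSmoothPartial.isCoordChange {e : OpenPartialHomeomorph (Euc n) (Euc n)}
    (he : IsSmoothPartial n e) : IsCoordChange e e.source where
  isOpen := e.open_source
  contDiffOn := he.contMDiffOn.contDiffOn
  injOn := e.injOn
  det_ne_zero x hx := by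
    obtain ⟨A, hA⟩ := he.isInvertible_mfderiv hx
    rw [mfderiv_eq_fderiv] at hA
    let A' : Euc n ≃L[ℝ] Euc n := A
    have h1 : fderiv ℝ e x = (A' : Euc n →L[ℝ] Euc n) := hA.symm
    rw [h1]
    exact A'.toLinearEquiv.isUnit_det'.ne_zero

theorem exists_smooth_cutoff {C O : Set (Euc n)} (hC : IsCompact C) (hO : IsOpen O) (hCO : C ⊆ O) :
    ∃ ζ : Euc n → ℝ, ContDiff ℝ ∞ ζ ∧ HasCompactSupport ζ ∧ tsupport ζ ⊆ O ∧
      (∀ x ∈ C, ζ x = 1) ∧ ∀ x, ζ x ∈ Icc (0 : ℝ) 1 := by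
  obtain ⟨L, hL, hCL, hLO⟩ := exists_compact_between hC hO hCO
  obtain ⟨f, hf0, hf1, hfr⟩ := exists_contMDiffMap_zero_one_of_isClosed (n := (⊤ : ℕ∞)) 𝓘(ℝ, Euc n)
    (isOpen_interior (s := L)).isClosed_compl hC.isClosed
    (disjoint_compl_left_iff_subset.2 hCL)
  have hs : tsupport f ⊆ L := by
    refine closure_minimal (fun x hx => ?_) hL.isClosed
    by_contra h
    exact hx (hf0 fun h' => h (interior_subset h'))
  exact ⟨f, f.contMDiff.contDiff, hL.of_isClosed_subset (isClosed_tsupport _) hs, hs.trans hLO,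
    fun x hx => hf1 hx, hfr⟩

variable [T2Space M] [CompactSpace M] [IsManifold (𝓡 n) ∞ M]
  {g : ContMDiffRiemannianMetric (𝓡 n) ∞ (Euc n) (fun x : M => TangentSpace (𝓡 n) x)}

theorem NormalBall.isSmoothPartial (B : NormalBall g) : IsSmoothPartial n B.coord :=
  ⟨B.contMDiffOn_coord, B.contMDiffOn_symm⟩

/-- Reading a push-forward in normal coordinates is a multiplier followed by a coordinate change. -/
theorem NormalBall.exists_localize_pushField (B : NormalBall g) {ρ : M → ℝ}
    (hρ : ContMDiff (𝓡 n) 𝓘(ℝ, ℝ) ∞ ρ) (hρB : tsupport ρ ⊆ B.carrier)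
    {e : OpenPartialHomeomorph (Euc n) M} (he : IsSmoothPartial n e) {Q : Set (Euc n)}
    (hQ : IsCompact Q) (hQe : Q ⊆ e.source) :
    ∃ (T : Euc n → Euc n) (O : Set (Euc n)) (a : Euc n → Euc n →L[ℝ] Euc n),
      IsCoordChange T O ∧ IsMultiplier a O ∧ ∀ u : Euc n → Euc n, (∀ x ∉ Q, u x = 0) →
        B.localize ρ (pushField e u) = fun x => a x (u (T x)) := by
  set c := B.coord with hc
  have hcs : IsSmoothPartial n c := B.isSmoothPartial
  set τ : OpenPartialHomeomorph (Euc n) (Euc n) := c.trans e.symm with hτ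
  have hτs : IsSmoothPartial n τ := hcs.trans he.symm
  have hsrc : ∀ v, v ∈ τ.source ↔ v ∈ c.source ∧ c v ∈ e.target := fun v => by
    simp [hτ]
  have hρc : IsCompact (tsupport ρ ∩ e '' Q) := (isClosed_tsupport ρ).isCompact.inter
    (hQ.image_of_continuousOn (e.continuousOn.mono hQe))
  -- The part of the chart where both the partition function and a pushed field can be nonzero. It
  -- is compact in the overlap domain of `τ = e⁻¹ ∘ c`.
  set C : Set (Euc n) := c.symm '' (tsupport ρ ∩ e '' Q) with hC
  have hCc : IsCompact C := hρc.image_of_continuousOn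
    (c.symm.continuousOn.mono (inter_subset_left.trans hρB))
  have hCO : C ⊆ τ.source := by
    rintro _ ⟨y, ⟨hy1, x, hx, rfl⟩, rfl⟩
    rw [hsrc, c.right_inv (hρB hy1)]
    exact ⟨c.map_target (hρB hy1), e.map_source (hQe hx)⟩
  obtain ⟨ζ, hζs, hζc, hζO, hζ1, -⟩ := exists_smooth_cutoff hCc τ.open_source hCO
  -- The true coefficient need not have compact support in the overlap. The cutoff `ζ` repairs this
  -- and changes nothing for fields vanishing off `Q`, since `ζ = 1` on `C`.
  set a₀ : Euc n → Euc n →L[ℝ] Euc n := fun v => ρ (c v) • fderiv ℝ τ.symm (τ v) with ha₀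
  have ha₀s : ContDiffOn ℝ ∞ a₀ τ.source := by
    have h1 : ContDiffOn ℝ ∞ (fun v => ρ (c v)) τ.source := by
      refine ContMDiffOn.contDiffOn ?_
      exact hρ.comp_contMDiffOn (hcs.contMDiffOn.mono fun v hv => ((hsrc v).1 hv).1)
    have h2 : ContDiffOn ℝ ∞ (fun v => fderiv ℝ τ.symm (τ v)) τ.source :=
      (hτs.contMDiffOn_symm.contDiffOn.fderiv_of_isOpen τ.open_target (by simp)).comp
        hτs.contMDiffOn.contDiffOn τ.mapsTo
    exact h1.smul h2
  have haO : ContDiffOn ℝ ∞ (fun v => ζ v • a₀ v) τ.source := hζs.contDiffOn.smul ha₀s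
  have hts : tsupport (fun v => ζ v • a₀ v) ⊆ tsupport ζ := closure_mono fun v hv => by
    contrapose! hv
    rw [Function.notMem_support] at hv ⊢
    rw [hv]
    exact zero_smul ℝ (a₀ v)
  refine ⟨τ, τ.source, fun v => ζ v • a₀ v, hτs.isCoordChange,
    ⟨contDiff_of_contDiffOn_of_tsupport_subset τ.open_source haO (hts.trans hζO),
      hζc.of_isClosed_subset (isClosed_tsupport _) hts, hts.trans hζO⟩, fun u hu => ?_⟩
  funext v
  have hζ0 : v ∉ τ.source → (ζ v • a₀ v) (u (τ v)) = 0 := fun h => by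
    rw [image_eq_zero_of_notMem_tsupport fun h' => h (hζO h')]
    exact zero_smul ℝ (a₀ v (u (τ v)))
  change _ = (ζ v • a₀ v) (u (τ v))
  by_cases hv : v ∈ ball (0 : Euc n) B.radius
  swap
  · have : v ∉ τ.source := fun h => hv (B.source_eq ▸ ((hsrc v).1 h).1)
    rw [B.localize_of_notMem ρ _ hv, hζ0 this]
  have hvc : v ∈ c.source := by rw [hc, B.source_eq]; exact hv
  have hloc : B.localize ρ (pushField e u) v =
      ρ (c v) • ((mfderiv (𝓡 n) (𝓡 n) c v).inverse (pushField e u (c v)) : Euc n) :=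
    B.localize_of_mem ρ _ hv
  rw [hloc]
  by_cases hvO : v ∈ τ.source
  · have hve : c v ∈ e.target := ((hsrc v).1 hvO).2
    have hτv : τ v = e.symm (c v) := rfl
    have hpush : (pushField e u (c v) : Euc n) =
        mfderiv (𝓡 n) (𝓡 n) e (τ v) (u (τ v)) := if_pos hve
    -- Near `τ v` one has `e = c ∘ τ⁻¹`, so applying `(Dc)⁻¹` to `De` leaves the derivative of
    -- `τ⁻¹`.
    have hinv : ((mfderiv (𝓡 n) (𝓡 n) c v).inverse (pushField e u (c v)) : Euc n) =
        fderiv ℝ τ.symm (τ v) (u (τ v)) := by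
      refine (hcs.isInvertible_mfderiv hvc).inverse_apply_eq.2 (hpush.trans ?_)
      have h1 : e =ᶠ[nhds (τ v)] c ∘ τ.symm := by
        filter_upwards [τ.open_target.mem_nhds (τ.map_source hvO)] with x hx
        have hx' := hx
        simp only [hτ, OpenPartialHomeomorph.trans_target, OpenPartialHomeomorph.symm_target,
          mem_inter_iff, mem_preimage, OpenPartialHomeomorph.symm_symm] at hx'
        simp [hτ, c.right_inv hx'.2]
      have h2 : τ.symm (τ v) = v := τ.left_inv hvO
      have h3 : MDifferentiableAt (𝓡 n) (𝓡 n) c (τ.symm (τ v)) := by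
        rw [h2]
        exact hcs.mdifferentiable.mdifferentiableAt hvc
      have h4 : MDifferentiableAt (𝓡 n) (𝓡 n) τ.symm (τ v) :=
        hτs.mdifferentiable.mdifferentiableAt_symm (τ.map_source hvO)
      have h5 : ∀ (z : Euc n), z = v → ∀ w : Euc n,
          (mfderiv (𝓡 n) (𝓡 n) c z w : Euc n) = mfderiv (𝓡 n) (𝓡 n) c v w := by
        rintro _ rfl w
        rfl
      have h6 : (mfderiv (𝓡 n) (𝓡 n) e (τ v) (u (τ v)) : Euc n) =
          mfderiv (𝓡 n) (𝓡 n) c (τ.symm (τ v)) (mfderiv (𝓡 n) (𝓡 n) τ.symm (τ v) (u (τ v))) := by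
        rw [h1.mfderiv_eq, mfderiv_comp (τ v) h3 h4]
        rfl
      rw [h6, mfderiv_eq_fderiv]
      exact h5 _ h2 _
    rw [hinv]
    -- Outside `C` either the field vanishes at `τ v` or the partition function vanishes at `c v`.
    by_cases hvC : v ∈ C
    · rw [hζ1 v hvC, one_smul ℝ (a₀ v)]
      rfl
    · by_cases hvρ : c v ∈ tsupport ρ
      · have : τ v ∉ Q := fun h => hvC ⟨c v, ⟨hvρ, τ v, h, by rw [hτv, e.right_inv hve]⟩,
          c.left_inv hvc⟩
        rw [hu _ this]
        exact ((congrArg (ρ (c v) • ·) (map_zero (fderiv ℝ τ.symm (τ v)))).trans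
          (smul_zero (ρ (c v)))).trans (map_zero (ζ v • a₀ v)).symm
      · have h0 : a₀ v = 0 := by
          rw [ha₀]
          change ρ (c v) • fderiv ℝ τ.symm (τ v) = 0
          rw [image_eq_zero_of_notMem_tsupport hvρ]
          exact zero_smul ℝ (fderiv ℝ τ.symm (τ v))
        rw [h0, image_eq_zero_of_notMem_tsupport hvρ]
        exact (zero_smul ℝ (fderiv ℝ τ.symm (τ v) (u (τ v)))).trans
          (congrArg (fun A : Euc n →L[ℝ] Euc n => A (u (τ v))) (smul_zero (ζ v))).symm
  · have hve : c v ∉ e.target := fun h => hvO ((hsrc v).2 ⟨hvc, h⟩)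
    have hpush : pushField e u (c v) = (0 : Euc n) := if_neg hve
    have hz : ((mfderiv (𝓡 n) (𝓡 n) c v).inverse (pushField e u (c v)) : Euc n) = 0 := by
      rw [hpush]
      exact ContinuousLinearMap.map_zero _
    rw [hz]
    rw [hζ0 hvO]
    exact smul_zero (A := Euc n) (ρ (c v))

theorem exists_manifoldSobolevNorm_pushField_le {s p : ℝ} (hs : 0 ≤ s) (hp : 1 ≤ p) {ι : Type*}
    [Fintype ι] (B : ι → NormalBall g) (ρ : SmoothPartitionOfUnity ι (𝓡 n) M univ)
    (hρ : ρ.IsSubordinate fun α => (B α).carrier)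
    {e : OpenPartialHomeomorph (Euc n) M} (he : IsSmoothPartial n e) {Q : Set (Euc n)}
    (hQ : IsCompact Q) (hQe : Q ⊆ e.source) :
    ∃ C : ℝ≥0∞, C ≠ ⊤ ∧ ∀ u : Euc n → Euc n, ContDiff ℝ ∞ u → (∀ x ∉ Q, u x = 0) →
      manifoldSobolevNorm B ρ s p (pushField e u) ≤ C * sobolevNorm s p u := by
  have h1 : ∀ α, ∃ C : ℝ≥0∞, C ≠ ⊤ ∧ ∀ u : Euc n → Euc n, ContDiff ℝ ∞ u → (∀ x ∉ Q, u x = 0) →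
      sobolevNorm s p ((B α).localize (ρ α) (pushField e u)) ≤ C * sobolevNorm s p u := by
    intro α
    obtain ⟨T, O, a, hT, ha, h⟩ := (B α).exists_localize_pushField (ρ α).contMDiff (hρ α) he hQ hQe
    obtain ⟨C, hC, hb⟩ := IsMultiplier.exists_sobolevNorm_le hT hs hp ha
    refine ⟨C, hC, fun u hu hu0 => ?_⟩
    rw [h u hu0]
    exact hb u hu
  choose C hC hb using h1
  refine ⟨(∑ α, C α ^ (2 : ℝ)) ^ (1 / 2 : ℝ), ?_, fun u hu hu0 => ?_⟩
  · refine ENNReal.rpow_ne_top_of_nonneg (by norm_num) ?_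
    exact (ENNReal.sum_lt_top.2 fun α _ =>
      (ENNReal.rpow_ne_top_of_nonneg (by norm_num) (hC α)).lt_top).ne
  · calc manifoldSobolevNorm B ρ s p (pushField e u)
        ≤ (∑ α, (C α * sobolevNorm s p u) ^ (2 : ℝ)) ^ (1 / 2 : ℝ) := by
          refine ENNReal.rpow_le_rpow (Finset.sum_le_sum fun α _ => ?_) (by norm_num)
          exact ENNReal.rpow_le_rpow (hb α u hu hu0) (by norm_num)
      _ = _ := by
          simp only [ENNReal.mul_rpow_of_nonneg _ _ (zero_le_two (α := ℝ))]
          rw [← Finset.sum_mul, ENNReal.mul_rpow_of_nonneg _ _ (by norm_num), ← ENNReal.rpow_mul]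
          norm_num

end LocalizedPush

/-! ### Transfer of the diameter bound from the unit ball -/

section UnitBallGroup

variable {n : ℕ} {N : Type*} [TopologicalSpace N] [ChartedSpace (Euc n) N]

theorem exists_isSmoothFamily_of_mem_diffC {U : Set N} {φ : N ≃ₘ^∞⟮𝓡 n, 𝓡 n⟯ N}
    (hφ : φ ∈ DiffC U) :
    ∃ Φ : ℝ → (N ≃ₘ^∞⟮𝓡 n, 𝓡 n⟯ N), IsSmoothFamily Φ ∧
      (∃ K : Set N, IsCompact K ∧ K ⊆ U ∧ ∀ t, ∀ x ∉ K, Φ t x = x) ∧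
      Φ 0 = Diffeomorph.refl (𝓡 n) N ∞ ∧ Φ 1 = φ := by
  obtain ⟨Φ, hΦ, h0, h1⟩ := hφ
  -- The zero functional serves here, as lengths play no role.
  obtain ⟨Ψ, hΨ, hK, hΨ0, hΨ1, -⟩ := hΦ.exists_reparam (norm := fun _ => 0) fun _ _ => zero_le
  exact ⟨Ψ, hΨ, hK, hΨ0.trans h0, hΨ1.trans h1⟩

theorem refl_mem_diffC (U : Set N) : Diffeomorph.refl (𝓡 n) N ∞ ∈ DiffC U :=
  ⟨fun _ => Diffeomorph.refl (𝓡 n) N ∞, ⟨isSmoothFamily_const _, ∅, isCompact_empty,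
    empty_subset _, fun _ _ _ _ => rfl⟩, rfl, rfl⟩

theorem DiffC.mono {U V : Set N} (hUV : U ⊆ V) {φ : N ≃ₘ^∞⟮𝓡 n, 𝓡 n⟯ N} (hφ : φ ∈ DiffC U) :
    φ ∈ DiffC V := by
  obtain ⟨Φ, hΦ, h⟩ := hφ
  exact ⟨Φ, hΦ.mono hUV, h⟩

variable {M : Type*} [TopologicalSpace M] [T2Space M] [CompactSpace M] [ChartedSpace (Euc n) M]
  [IsManifold (𝓡 n) ∞ M]
  {g : ContMDiffRiemannianMetric (𝓡 n) ∞ (Euc n) (fun x : M => TangentSpace (𝓡 n) x)}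

/-- A smoothly embedded closed unit ball carries a subgroup whose elements are reachable at
uniformly bounded cost. -/
theorem exists_isReachable_of_diffDiam_lt_top {s p : ℝ} (hs : 0 ≤ s) (hp : 1 ≤ p) {ι : Type*}
    [Fintype ι] (B : ι → NormalBall g) (ρ : SmoothPartitionOfUnity ι (𝓡 n) M univ)
    (hρ : ρ.IsSubordinate fun α => (B α).carrier)
    (hball : diffDiam (ball (0 : Euc n) 1) (fun u => sobolevNorm (F := Euc n) s p u) < ⊤)
    {e : OpenPartialHomeomorph (Euc n) M} (he : IsSmoothPartial n e)
    (hQe : closedBall (0 : Euc n) 1 ⊆ e.source) :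
    ∃ C : ℝ≥0∞, C ≠ ⊤ ∧ ∀ ψ ∈ DiffC (e '' ball (0 : Euc n) 1),
      IsReachable univ (manifoldSobolevNorm B ρ s p) ψ C := by
  obtain ⟨C, hC, hb⟩ := exists_manifoldSobolevNorm_pushField_le hs hp B ρ hρ he
    (isCompact_closedBall (0 : Euc n) 1) hQe
  set D := diffDiam (ball (0 : Euc n) 1) (fun u => sobolevNorm (F := Euc n) s p u) with hD
  refine ⟨C * (D + 1), ENNReal.mul_ne_top hC (by simp [hball.ne]), fun ψ hψ => ?_⟩
  obtain ⟨Ψ, hΨ, ⟨K, hK, hKU, hΨK⟩, hΨ0, hΨ1⟩ := exists_isSmoothFamily_of_mem_diffC hψ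
  have hbe : ball (0 : Euc n) 1 ⊆ e.source := ball_subset_closedBall.trans hQe
  have hKe : K ⊆ e.symm.source := hKU.trans (image_subset_iff.2 fun x hx => e.map_source (hbe hx))
  set ψ' : Euc n ≃ₘ^∞⟮𝓡 n, 𝓡 n⟯ Euc n :=
    transportDiffeo e.symm he.symm (Ψ 1) K hK hKe (hΨK 1) with hψ'
  have hψ'mem : ψ' ∈ DiffC (ball (0 : Euc n) 1) := by
    refine ⟨_, (hΨ.isDiffPath_transport he.symm hK hKe hΨK).mono ?_,
      transportDiffeo_refl he.symm hK hKe (hΨK 0) hΨ0, rfl⟩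
    rintro _ ⟨y, hy, rfl⟩
    obtain ⟨x, hx, rfl⟩ := hKU hy
    rwa [e.left_inv (hbe hx)]
  -- The infimum need not be attained; the slack `1` yields an actual path from the finite diameter
  -- `D`.
  have hdist : diffDist (ball (0 : Euc n) 1) (fun u => sobolevNorm (F := Euc n) s p u)
      (Diffeomorph.refl (𝓡 n) (Euc n) ∞) ψ' < D + 1 := by
    refine lt_of_le_of_lt ?_ (ENNReal.lt_add_right hball.ne one_ne_zero)
    exact le_iSup₂_of_le (f := fun φ₀ (_ : φ₀ ∈ DiffC (ball (0 : Euc n) 1)) =>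
      ⨆ φ₁ ∈ DiffC (n := n) (ball (0 : Euc n) 1), diffDist (ball (0 : Euc n) 1)
        (fun u => sobolevNorm (F := Euc n) s p u) φ₀ φ₁) _ (refl_mem_diffC _)
      (le_iSup₂_of_le (f := fun φ₁ (_ : φ₁ ∈ DiffC (ball (0 : Euc n) 1)) =>
        diffDist (ball (0 : Euc n) 1) (fun u => sobolevNorm (F := Euc n) s p u) _ φ₁)
        ψ' hψ'mem le_rfl)
  simp only [diffDist, iInf_lt_iff] at hdist
  obtain ⟨Θ₀, ⟨hΘ₀, hΘ₀0, hΘ₀1⟩, hlen⟩ := hdist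
  obtain ⟨Θ, hΘ, ⟨K', hK', hKU', hΘK⟩, hΘ0, hΘ1, hΘlen⟩ :=
    hΘ₀.exists_reparam (isHomogeneousNorm_sobolevNorm n s hp)
  have hKe' : K' ⊆ e.source := hKU'.trans hbe
  refine ⟨_, (hΘ.isDiffPath_transport he hK' hKe' hΘK).mono (subset_univ _),
    transportDiffeo_refl he hK' hKe' (hΘK 0) (hΘ0.trans hΘ₀0), ?_, ?_⟩
  · refine Diffeomorph.ext fun y => ?_
    rw [transportDiffeo_apply, ← hΨ1]
    have h1 : ∀ x, Θ 1 x = transportFun e.symm (Ψ 1) x := fun x => by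
      rw [hΘ1, hΘ₀1, hψ', transportDiffeo_apply]
    by_cases hy : y ∈ e.target
    · rw [transportFun_of_mem e _ hy, h1, transportFun_of_mem e.symm _ (e.map_target hy),
        OpenPartialHomeomorph.symm_symm, e.right_inv hy, e.right_inv]
      exact mapsTo_of_eq_self_off (Ψ 1).injective hKe (hΨK 1) hy
    · rw [transportFun_of_notMem e _ hy, hΨK]
      exact fun h => hy (hKe h)
  · unfold pathLength
    calc ∫⁻ t in Icc (0 : ℝ) 1, manifoldSobolevNorm B ρ s p
          (pathVelocity (fun t => transportDiffeo e he (Θ t) K' hK' hKe' (hΘK t)) t)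
        ≤ ∫⁻ t in Icc (0 : ℝ) 1, C * sobolevNorm (F := Euc n) s p (pathVelocity Θ t) := by
          refine lintegral_mono fun t => ?_
          rw [pathVelocity_transport he hK' hKe' hΘ hΘK]
          refine hb _ (hΘ.contDiff_pathVelocity t) fun x hx => ?_
          exact pathVelocity_eq_zero_of_notMem hΘK t
            fun h => hx (ball_subset_closedBall (hKU' h))
      _ = C * pathLength (fun u => sobolevNorm (F := Euc n) s p u) Θ :=
          lintegral_const_mul' _ _ hC
      _ ≤ C * (D + 1) := mul_le_mul_right (hΘlen.trans hlen.le) C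

end UnitBallGroup

/-! ### Constant speed of geodesics -/

section ConstantSpeed

variable {n : ℕ} {M : Type*} [TopologicalSpace M] [T2Space M] [ChartedSpace (Euc n) M]
  [IsManifold (𝓡 n) ∞ M]
  (g : ContMDiffRiemannianMetric (𝓡 n) ∞ (Euc n) (fun x : M => TangentSpace (𝓡 n) x))

theorem contMDiff_tangentBundle_mk {n : ℕ} :
    ContMDiff 𝓘(ℝ, Euc n × Euc n) (𝓡 n).tangent ∞
      fun q : Euc n × Euc n => (⟨q.1, q.2⟩ : TangentBundle (𝓡 n) (Euc n)) := by
  intro q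
  rw [contMDiffAt_totalSpace]
  refine ⟨contDiff_fst.contMDiff q, ?_⟩
  simpa using (contDiff_snd (𝕜 := ℝ) (E := Euc n) (F := Euc n) (n := ∞)).contMDiff q

theorem contMDiffOn_tangent_extChartAt_symm (x₀ : M) :
    ContMDiffOn 𝓘(ℝ, Euc n × Euc n) (𝓡 n).tangent ∞
      (fun q : Euc n × Euc n => (⟨(extChartAt (𝓡 n) x₀).symm q.1,
        mfderiv (𝓡 n) (𝓡 n) (extChartAt (𝓡 n) x₀).symm q.1 q.2⟩ : TangentBundle (𝓡 n) M))
      ((extChartAt (𝓡 n) x₀).target ×ˢ univ) := by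
  have hop : IsOpen (extChartAt (𝓡 n) x₀).target := isOpen_extChartAt_target x₀
  have h := ((contMDiffOn_extChartAt_symm (I := 𝓡 n) (n := ∞) x₀).contMDiffOn_tangentMapWithin
    (m := ∞) (by simp) hop.uniqueMDiffOn).comp (contMDiff_tangentBundle_mk (n := n)).contMDiffOn
    (s := (extChartAt (𝓡 n) x₀).target ×ˢ univ) fun q hq => hq.1
  refine h.congr fun q hq => ?_
  simp only [Function.comp, tangentMapWithin]
  rw [mfderivWithin_of_isOpen hop hq.1]

theorem contDiffOn_chartMetric (x₀ : M) :
    ContDiffOn ℝ ∞ (fun q : Euc n × Euc n × Euc n => chartMetric g x₀ q.1 q.2.1 q.2.2)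
      ((extChartAt (𝓡 n) x₀).target ×ˢ univ) := by
  refine ContMDiffOn.contDiffOn fun q hq => ?_
  have hv := ((contMDiffOn_tangent_extChartAt_symm (n := n) x₀).comp
    (contDiff_fst.prodMk (contDiff_fst.comp contDiff_snd) :
      ContDiff ℝ ∞ fun q : Euc n × Euc n × Euc n => (q.1, q.2.1)).contMDiff.contMDiffOn
    (s := (extChartAt (𝓡 n) x₀).target ×ˢ univ) fun q hq => ⟨hq.1, mem_univ _⟩) q hq
  have hw := ((contMDiffOn_tangent_extChartAt_symm (n := n) x₀).comp
    (contDiff_fst.prodMk (contDiff_snd.comp contDiff_snd) :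
      ContDiff ℝ ∞ fun q : Euc n × Euc n × Euc n => (q.1, q.2.2)).contMDiff.contMDiffOn
    (s := (extChartAt (𝓡 n) x₀).target ×ˢ univ) fun q hq => ⟨hq.1, mem_univ _⟩) q hq
  have hb := ((contMDiffOn_extChartAt_symm (I := 𝓡 n) (n := ∞) x₀).comp
    (contDiff_fst : ContDiff ℝ ∞ fun q : Euc n × Euc n × Euc n => q.1).contMDiff.contMDiffOn
    (s := (extChartAt (𝓡 n) x₀).target ×ˢ univ) fun q hq => hq.1) q hq
  have h := ContMDiffWithinAt.clm_bundle_apply₂ (F₁ := Euc n) (F₂ := Euc n)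
    (E₁ := fun x : M => TangentSpace (𝓡 n) x) (E₂ := fun x : M => TangentSpace (𝓡 n) x)
    (E₃ := Bundle.Trivial M ℝ) (F₃ := ℝ)
    (b := fun q : Euc n × Euc n × Euc n => (extChartAt (𝓡 n) x₀).symm q.1)
    (v := fun q => mfderiv (𝓡 n) (𝓡 n) (extChartAt (𝓡 n) x₀).symm q.1 q.2.1)
    (w := fun q => mfderiv (𝓡 n) (𝓡 n) (extChartAt (𝓡 n) x₀).symm q.1 q.2.2)
    (ψ := fun q => g.inner ((extChartAt (𝓡 n) x₀).symm q.1))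
    (ContMDiffAt.comp_contMDiffWithinAt q g.contMDiff.contMDiffAt hb) hv hw
  simp only [contMDiffWithinAt_totalSpace] at h
  exact h.2

theorem chartMetric_comm (x₀ : M) (y v w : Euc n) :
    chartMetric g x₀ y v w = chartMetric g x₀ y w v :=
  g.symm _ _ _

/-- The vector is kept in the model space, so that the base point can be replaced without dependent
rewriting. -/
theorem inner_congr_point {y z : M} (h : y = z) (v : Euc n) :
    g.inner y v v = g.inner z v v := by
  subst h
  rfl

theorem chartMetric_deriv_extChartAt {x₀ : M} {γ : ℝ → M} {t : ℝ}
    (hγ : MDifferentiableAt 𝓘(ℝ, ℝ) (𝓡 n) γ t) (hx : γ t ∈ (chartAt (Euc n) x₀).source) :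
    chartMetric g x₀ (extChartAt (𝓡 n) x₀ (γ t)) (deriv (fun τ => extChartAt (𝓡 n) x₀ (γ τ)) t)
        (deriv (fun τ => extChartAt (𝓡 n) x₀ (γ τ)) t) =
      g.inner (γ t) (curveVelocity n γ t) (curveVelocity n γ t) := by
  haveI : IsManifold (𝓡 n) 1 M := IsManifold.of_le (n := ∞) (by simp)
  have hx' : γ t ∈ (extChartAt (𝓡 n) x₀).source := by rwa [extChartAt_source]
  have hc : MDifferentiableAt 𝓘(ℝ, ℝ) (𝓡 n) (fun τ => extChartAt (𝓡 n) x₀ (γ τ)) t :=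
    (mdifferentiableAt_extChartAt hx).comp t hγ
  have hs : MDifferentiableAt (𝓡 n) (𝓡 n) (extChartAt (𝓡 n) x₀).symm
      (extChartAt (𝓡 n) x₀ (γ t)) :=
    ((contMDiffOn_extChartAt_symm (I := 𝓡 n) (n := ∞) x₀).contMDiffAt
      ((isOpen_extChartAt_target x₀).mem_nhds
        ((extChartAt (𝓡 n) x₀).map_source hx'))).mdifferentiableAt (by simp)
  have h1 : curveVelocity n γ t = mfderiv (𝓡 n) (𝓡 n) (extChartAt (𝓡 n) x₀).symm
      (extChartAt (𝓡 n) x₀ (γ t)) (curveVelocity n (fun τ => extChartAt (𝓡 n) x₀ (γ τ)) t) := by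
    rw [← curveVelocity_comp rfl hs hc]
    have : γ =ᶠ[nhds t] (extChartAt (𝓡 n) x₀).symm ∘ fun τ => extChartAt (𝓡 n) x₀ (γ τ) := by
      filter_upwards [hγ.continuousAt.preimage_mem_nhds
        ((isOpen_extChartAt_source (I := 𝓡 n) x₀).mem_nhds hx')] with τ hτ
      exact ((extChartAt (𝓡 n) x₀).left_inv hτ).symm
    unfold curveVelocity
    rw [this.mfderiv_eq]
    rfl
  have h2 : curveVelocity n (fun τ => extChartAt (𝓡 n) x₀ (γ τ)) t =
      deriv (fun τ => extChartAt (𝓡 n) x₀ (γ τ)) t := by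
    unfold curveVelocity
    rw [mfderiv_eq_fderiv]
    rfl
  rw [h2] at h1
  rw [h1]
  exact inner_congr_point g ((extChartAt (𝓡 n) x₀).left_inv hx') _

/-- Geodesics have constant speed. -/
theorem IsGeodesicOn.hasDerivAt_energy {γ : ℝ → M} {J : Set ℝ} (hγ : IsGeodesicOn g γ J)
    (hJ : IsOpen J) {t : ℝ} (ht : t ∈ J) :
    HasDerivAt (fun τ => g.inner (γ τ) (curveVelocity n γ τ) (curveVelocity n γ τ)) 0 t := by
  obtain ⟨hγs, hγe⟩ := hγ
  set c : ℝ → Euc n := fun τ => extChartAt (𝓡 n) (γ t) (γ τ) with hc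
  have hγt : ∀ τ ∈ J, MDifferentiableAt 𝓘(ℝ, ℝ) (𝓡 n) γ τ := fun τ hτ =>
    (hγs.contMDiffAt (hJ.mem_nhds hτ)).mdifferentiableAt (by simp)
  have hγc : ContinuousAt γ t := (hγt t ht).continuousAt
  have hev : ∀ᶠ τ in nhds t, γ τ ∈ (chartAt (Euc n) (γ t)).source :=
    hγc.preimage_mem_nhds (chart_source_mem_nhds _ _)
  have hcs : ContDiffAt ℝ ∞ c t := by
    refine ContMDiffAt.contDiffAt ?_
    exact ContMDiffAt.comp t (contMDiffAt_extChartAt (I := 𝓡 n) (n := ∞))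
      (hγs.contMDiffAt (hJ.mem_nhds ht))
  have hc1 : HasDerivAt c (deriv c t) t := (hcs.differentiableAt (by simp)).hasDerivAt
  have hc2 : HasDerivAt (deriv c) (deriv (deriv c) t) t := by
    have h : ContDiffAt ℝ ∞ (deriv c) t := by
      have := (hcs.fderiv_right (m := ∞) (by simp)).clm_apply
        (contDiffAt_const (c := (1 : ℝ)))
      exact this
    exact (h.differentiableAt (by simp)).hasDerivAt
  have hmem : c t ∈ (extChartAt (𝓡 n) (γ t)).target := mem_extChartAt_target (γ t)
  set P : Euc n × Euc n × Euc n → ℝ := fun q => chartMetric g (γ t) q.1 q.2.1 q.2.2 with hP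
  have hPd : HasFDerivAt P (fderiv ℝ P (c t, deriv c t, deriv c t)) (c t, deriv c t, deriv c t) := by
    have := (contDiffOn_chartMetric g (γ t)).contDiffAt
      (((isOpen_extChartAt_target (γ t)).prod isOpen_univ).mem_nhds
        (mk_mem_prod hmem (mem_univ (deriv c t, deriv c t))))
    exact (this.differentiableAt (by simp)).hasFDerivAt
  set D := fderiv ℝ P (c t, deriv c t, deriv c t) with hD
  have e1 : HasDerivAt (fun τ => P (c τ, deriv c τ, deriv c τ))
      (D (deriv c t, deriv (deriv c) t, deriv (deriv c) t)) t :=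
    HasFDerivAt.comp_hasDerivAt (l := P) t hPd (hc1.prodMk (hc2.prodMk hc2))
  have e2 : HasDerivAt (fun τ => P (c τ, deriv c τ, deriv c t))
      (D (deriv c t, deriv (deriv c) t, 0)) t :=
    HasFDerivAt.comp_hasDerivAt (l := P) t hPd (hc1.prodMk (hc2.prodMk (hasDerivAt_const t _)))
  have hline : ∀ a b : Euc n, HasDerivAt (fun r : ℝ => a + r • b) b 0 := fun a b => by
    simpa using ((hasDerivAt_id (0 : ℝ)).smul_const b).const_add a
  have e3 : HasDerivAt (fun r : ℝ => P (c t + r • deriv c t, deriv c t, deriv c t))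
      (D (deriv c t, 0, 0)) 0 :=
    HasFDerivAt.comp_hasDerivAt_of_eq (l := P) 0 hPd
      ((hline _ _).prodMk (hasDerivAt_const _ _)) (by simp)
  have e4 : HasDerivAt (fun r : ℝ => P (c t, deriv c t + r • deriv (deriv c) t, deriv c t))
      (D (0, deriv (deriv c) t, 0)) 0 :=
    HasFDerivAt.comp_hasDerivAt_of_eq (l := P) 0 hPd
      ((hasDerivAt_const _ _).prodMk ((hline _ _).prodMk (hasDerivAt_const _ _))) (by simp)
  have e5 : HasDerivAt (fun r : ℝ => P (c t, deriv c t, deriv c t + r • deriv (deriv c) t))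
      (D (0, 0, deriv (deriv c) t)) 0 :=
    HasFDerivAt.comp_hasDerivAt_of_eq (l := P) 0 hPd
      ((hasDerivAt_const _ _).prodMk ((hasDerivAt_const _ _).prodMk (hline _ _))) (by simp)
  -- Both base vectors equal the velocity, so symmetry of the metric exchanges the two slots.
  have h45 : D (0, 0, deriv (deriv c) t) = D (0, deriv (deriv c) t, 0) := by
    refine e5.unique (e4.congr_of_eventuallyEq (Filter.Eventually.of_forall fun r => ?_))
    exact chartMetric_comm g _ _ _ _
  -- The geodesic equation contracted with the velocity itself. Together with the splittings below,
  -- the derivative of the energy becomes `½ - ½` times `D (deriv c t, 0, 0)`.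
  have hgeo : D (deriv c t, deriv (deriv c) t, 0) = (1 / 2 : ℝ) * D (deriv c t, 0, 0) := by
    rw [← e2.deriv, ← e3.deriv]
    exact hγe t ht (deriv c t)
  have hs1 : D (deriv c t, deriv (deriv c) t, 0) =
      D (deriv c t, 0, 0) + D (0, deriv (deriv c) t, 0) := by
    rw [← map_add]; simp
  have hs2 : D (deriv c t, deriv (deriv c) t, deriv (deriv c) t) =
      D (deriv c t, deriv (deriv c) t, 0) + D (0, 0, deriv (deriv c) t) := by
    rw [← map_add]; simp
  have h0 : D (deriv c t, deriv (deriv c) t, deriv (deriv c) t) = 0 := by linarith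
  rw [h0] at e1
  refine e1.congr_of_eventuallyEq ?_
  filter_upwards [hev, hJ.mem_nhds ht] with τ hτ hτJ
  exact (chartMetric_deriv_extChartAt g (hγt τ hτJ) hτ).symm

/-- The radial vector field of normal coordinates has the same length as in Euclidean space. -/
theorem NormalBall.inner_mfderiv_coord_self (B : NormalBall g) {v : Euc n}
    (hv : v ∈ ball (0 : Euc n) B.radius) :
    g.inner (B.coord v) (mfderiv (𝓡 n) (𝓡 n) B.coord v v)
      (mfderiv (𝓡 n) (𝓡 n) B.coord v v) = ‖v‖ ^ 2 := by
  set J : Set ℝ := {t : ℝ | t • v ∈ ball (0 : Euc n) B.radius} with hJ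
  have hJo : IsOpen J := isOpen_ball.preimage (continuous_id.smul continuous_const)
  set γ : ℝ → M := fun t => B.coord (t • v) with hγ
  have hconv : Convex ℝ J :=
    (convex_ball (0 : Euc n) B.radius).linear_preimage (LinearMap.toSpanSingleton ℝ (Euc n) v)
  have h1 : (1 : ℝ) ∈ J := by simpa [hJ] using hv
  have h0 : (0 : ℝ) ∈ J := by simpa [hJ] using B.radius_pos
  have hvel : ∀ t ∈ J, ∀ z : Euc n, t • v = z →
      curveVelocity n γ t = mfderiv (𝓡 n) (𝓡 n) B.coord z v := by
    rintro t ht _ rfl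
    have hd : HasDerivAt (fun t : ℝ => t • v) v t := by
      simpa using (hasDerivAt_id t).smul_const v
    have := curveVelocity_comp (n := n) (f := B.coord) (c := fun t : ℝ => t • v) (t := t) rfl
      ((B.contMDiffOn_coord.contMDiffAt (B.coord.open_source.mem_nhds
        (by rw [B.source_eq]; exact ht))).mdifferentiableAt (by simp))
      hd.differentiableAt.mdifferentiableAt
    rw [show γ = B.coord ∘ fun t : ℝ => t • v from rfl, this]
    have h2 : curveVelocity n (fun t : ℝ => t • v) t = v := by
      unfold curveVelocity
      rw [mfderiv_eq_fderiv]
      exact hd.deriv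
    rw [h2]
  have hE : ∀ t ∈ J, HasDerivWithinAt
      (fun τ => g.inner (γ τ) (curveVelocity n γ τ) (curveVelocity n γ τ)) 0 J t := fun t ht =>
    ((B.isGeodesicOn_ray v hv).hasDerivAt_energy g hJo ht).hasDerivWithinAt
  -- The speed of the ray at time `1` is compared with that at time `0`, where the coordinates are
  -- isometric.
  have key := hconv.is_const_of_fderivWithin_eq_zero (𝕜 := ℝ)
    (f := fun τ => g.inner (γ τ) (curveVelocity n γ τ) (curveVelocity n γ τ))
    (fun t ht => (hE t ht).differentiableWithinAt) (fun t ht => by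
      rw [(hE t ht).hasFDerivWithinAt.fderivWithin (hJo.uniqueDiffWithinAt ht)]
      ext; simp) h1 h0
  have e1 := hvel 1 h1 v (one_smul ℝ v)
  have e0 := hvel 0 h0 0 (zero_smul ℝ v)
  simp only [e1, e0] at key
  have hiso := B.isometry_zero v v
  rw [real_inner_self_eq_norm_sq] at hiso
  rw [← hiso]
  have p1 : B.coord v = γ 1 := by simp [hγ]
  have p0 : γ 0 = B.coord 0 := by simp [hγ]
  exact (inner_congr_point g p1 _).trans (key.trans (inner_congr_point g p0 _))

end ConstantSpeed

/-! ### Radial derivatives bounded up to the boundary of a normal ball -/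

section GradientBound

variable {n : ℕ} {M : Type*} [TopologicalSpace M] [T2Space M] [ChartedSpace (Euc n) M]
  [IsManifold (𝓡 n) ∞ M]
  (g : ContMDiffRiemannianMetric (𝓡 n) ∞ (Euc n) (fun x : M => TangentSpace (𝓡 n) x))

theorem eventually_norm_mfderiv_extChartAt_apply_le (x : M) :
    ∃ C : ℝ, 0 < C ∧ ∀ᶠ y in nhds x, ∀ w : Euc n,
      norm (E := Euc n) (mfderiv (𝓡 n) (𝓡 n) (extChartAt (𝓡 n) x) y w) ≤ C * √(g.inner y w w) := by
  haveI : IsManifold (𝓡 n) 1 M := IsManifold.of_le (n := ∞) (by simp)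
  letI : RiemannianBundle (fun x : M => TangentSpace (𝓡 n) x) := 
    ⟨g.toContinuousRiemannianMetric.toRiemannianMetric⟩
  obtain ⟨C, hC, h⟩ := eventually_norm_mfderiv_extChartAt_lt (𝓡 n) x
  refine ⟨C, hC, h.mono fun y hy w => ?_⟩
  letI := normedAddCommGroupTangentSpaceVectorSpace (E := Euc n) (extChartAt (𝓡 n) x y)
  letI := normedSpaceTangentSpaceVectorSpace (E := Euc n) (extChartAt (𝓡 n) x y)
  have h1 := (mfderiv (𝓡 n) (𝓡 n) (extChartAt (𝓡 n) x) y).le_of_opNorm_le hy.le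
    (w : TangentSpace (𝓡 n) y)
  have h2 : ∀ v : TangentSpace (𝓡 n) y, ‖v‖ = √(g.inner y v v) :=
    fun v => norm_eq_sqrt_real_inner v
  exact h1.trans (mul_le_mul_of_nonneg_left (h2 w).le hC.le)

/-- The differential of a real function, as a number. -/
def differentialApply (χ : M → ℝ) (y : M) (w : Euc n) : ℝ :=
  mfderiv (𝓡 n) 𝓘(ℝ, ℝ) χ y w

/-- Locally, charts compare the Riemannian and the Euclidean norm; compactness leaves finitely many
local constants, and their sum serves everywhere. -/
theorem exists_norm_mfderiv_le [CompactSpace M] {χ : M → ℝ}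
    (hχ : ContMDiff (𝓡 n) 𝓘(ℝ, ℝ) ∞ χ) :
    ∃ L : ℝ, 0 ≤ L ∧ ∀ (y : M) (w : Euc n),
      |differentialApply χ y w| ≤ L * √(g.inner y w w) := by
  haveI : IsManifold (𝓡 n) 1 M := IsManifold.of_le (n := ∞) (by simp)
  have hloc : ∀ x : M, ∃ L : ℝ, 0 ≤ L ∧ ∀ᶠ y in nhds x, ∀ w : Euc n,
      |differentialApply χ y w| ≤ L * √(g.inner y w w) := by
    intro x
    obtain ⟨C, hC, h⟩ := eventually_norm_mfderiv_extChartAt_apply_le g x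
    set f : Euc n → ℝ := χ ∘ (extChartAt (𝓡 n) x).symm with hf
    have hop := isOpen_extChartAt_target (I := 𝓡 n) x
    have hfs : ContDiffOn ℝ ∞ f (extChartAt (𝓡 n) x).target :=
      (hχ.comp_contMDiffOn (contMDiffOn_extChartAt_symm x)).contDiffOn
    have hfc : ContinuousAt (fun z => ‖fderiv ℝ f z‖) (extChartAt (𝓡 n) x x) :=
      ((hfs.continuousOn_fderiv_of_isOpen hop (by simp)).continuousAt
        (hop.mem_nhds (mem_extChartAt_target x))).norm
    set K := ‖fderiv ℝ f (extChartAt (𝓡 n) x x)‖ + 1 with hK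
    have hev : ∀ᶠ y in nhds x, ‖fderiv ℝ f (extChartAt (𝓡 n) x y)‖ < K :=
      (hfc.comp (continuousAt_extChartAt x)).eventually_lt_const (by simp [hK])
    refine ⟨K * C, by positivity, ?_⟩
    filter_upwards [h, hev, (isOpen_extChartAt_source (I := 𝓡 n) x).mem_nhds
      (mem_extChartAt_source x)] with y hy1 hy2 hy3 w
    have hfd : MDifferentiableAt (𝓡 n) 𝓘(ℝ, ℝ) f (extChartAt (𝓡 n) x y) :=
      ((hfs.contDiffAt (hop.mem_nhds ((extChartAt (𝓡 n) x).map_source hy3))).differentiableAt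
        (by simp)).mdifferentiableAt
    have hed : MDifferentiableAt (𝓡 n) (𝓡 n) (extChartAt (𝓡 n) x) y :=
      mdifferentiableAt_extChartAt (by rwa [extChartAt_source] at hy3)
    have heq : χ =ᶠ[nhds y] f ∘ extChartAt (𝓡 n) x := by
      filter_upwards [(isOpen_extChartAt_source (I := 𝓡 n) x).mem_nhds hy3] with z hz
      simp only [hf, Function.comp, (extChartAt (𝓡 n) x).left_inv hz]
    have h1 : differentialApply χ y w = fderiv ℝ f (extChartAt (𝓡 n) x y)
        (mfderiv (𝓡 n) (𝓡 n) (extChartAt (𝓡 n) x) y w) := by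
      unfold differentialApply
      rw [heq.mfderiv_eq, mfderiv_comp y hfd hed, mfderiv_eq_fderiv]
      rfl
    rw [h1, mul_assoc]
    refine ((fderiv ℝ f _).le_opNorm _).trans ?_
    exact mul_le_mul hy2.le (hy1 w) (norm_nonneg _) (by positivity)
  choose L hL hLe using hloc
  obtain ⟨t, -, ht⟩ := isCompact_univ.elim_nhds_subcover
    (fun x => {y | ∀ w : Euc n, |differentialApply χ y w| ≤ L x * √(g.inner y w w)})
    fun x _ => hLe x
  refine ⟨∑ x ∈ t, L x, Finset.sum_nonneg fun x _ => hL x, fun y w => ?_⟩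
  obtain ⟨x, hx, hy⟩ := mem_iUnion₂.1 (ht (mem_univ y))
  exact (hy w).trans (mul_le_mul_of_nonneg_right
    (Finset.single_le_sum (f := L) (fun x _ => hL x) hx) (Real.sqrt_nonneg _))

/-- The radial derivative of a smooth function in normal coordinates is bounded, uniformly up to
the boundary of the ball. -/
theorem NormalBall.exists_abs_fderiv_radial_le [CompactSpace M] {χ : M → ℝ}
    (hχ : ContMDiff (𝓡 n) 𝓘(ℝ, ℝ) ∞ χ) :
    ∃ L : ℝ, 0 ≤ L ∧ ∀ (B : NormalBall g), ∀ v ∈ ball (0 : Euc n) B.radius,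
      |fderiv ℝ (χ ∘ B.coord) v v| ≤ L * ‖v‖ := by
  obtain ⟨L, hL, h⟩ := exists_norm_mfderiv_le g hχ
  refine ⟨L, hL, fun B v hv => ?_⟩
  have h1 : MDifferentiableAt (𝓡 n) (𝓡 n) B.coord v :=
    (B.contMDiffOn_coord.contMDiffAt (B.coord.open_source.mem_nhds
      (by rwa [B.source_eq]))).mdifferentiableAt (by simp)
  have h2 : MDifferentiableAt (𝓡 n) 𝓘(ℝ, ℝ) χ (B.coord v) := hχ.mdifferentiableAt (by simp)
  have h3 : fderiv ℝ (χ ∘ B.coord) v v =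
      differentialApply χ (B.coord v) (mfderiv (𝓡 n) (𝓡 n) B.coord v v) := by
    rw [← mfderiv_eq_fderiv, mfderiv_comp v h2 h1]
    rfl
  have h4 := h (B.coord v) (mfderiv (𝓡 n) (𝓡 n) B.coord v v)
  rw [h3]
  refine h4.trans_eq ?_
  have h5 := B.inner_mfderiv_coord_self g hv
  refine congrArg (L * ·) ((congrArg Real.sqrt h5).trans (Real.sqrt_sq (norm_nonneg v)))

end GradientBound

/-! ### Radial diffeomorphisms -/

section RadialMaps

variable {n : ℕ}

/-- The radial map `v ↦ (1 - f v) v` is a diffeomorphism for these functions `f`. -/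
structure IsRadialProfile (f : Euc n → ℝ) : Prop where
  contDiff : ContDiff ℝ ∞ f
  hasCompactSupport : HasCompactSupport f
  lt_one : ∀ v, f v < 1
  radial_lt_one : ∀ v, f v + fderiv ℝ f v v < 1

def radialMap (f : Euc n → ℝ) (v : Euc n) : Euc n := (1 - f v) • v

namespace IsRadialProfile

variable {f : Euc n → ℝ}

theorem const_mul (hf : IsRadialProfile f) {t : ℝ} (ht : t ∈ Icc (0 : ℝ) 1) :
    IsRadialProfile fun v => t * f v := by
  have key : ∀ x : ℝ, x < 1 → t * x < 1 := fun x hx => by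
    rcases ht.1.eq_or_lt with h | h
    · simp [← h]
    · nlinarith [ht.2]
  refine ⟨contDiff_const.mul hf.contDiff, hf.hasCompactSupport.mul_left (f := fun _ => t),
    fun v => key _ (hf.lt_one v), fun v => ?_⟩
  have h1 : fderiv ℝ (fun v => t * f v) v = t • fderiv ℝ f v :=
    fderiv_const_mul (hf.contDiff.differentiable (by simp) v) t
  rw [h1]
  have := key _ (hf.radial_lt_one v)
  simpa [mul_add] using this

theorem hasDerivAt_ray (hf : IsRadialProfile f) (v : Euc n) (l : ℝ) :
    HasDerivAt (fun l : ℝ => l * (1 - f (l • v))) (1 - (f (l • v) + fderiv ℝ f (l • v) (l • v)))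
      l := by
  have h1 : HasDerivAt (fun l : ℝ => l • v) v l := by simpa using (hasDerivAt_id l).smul_const v
  have h2 : HasDerivAt (fun l : ℝ => f (l • v)) (fderiv ℝ f (l • v) v) l :=
    HasFDerivAt.comp_hasDerivAt l (hf.contDiff.differentiable (by simp) (l • v)).hasFDerivAt h1
  have h3 := (hasDerivAt_id l).mul (h2.const_sub 1)
  refine h3.congr_deriv ?_
  rw [map_smul, smul_eq_mul]
  simp only [id]
  ring

theorem strictMono_ray (hf : IsRadialProfile f) (v : Euc n) :
    StrictMono fun l : ℝ => l * (1 - f (l • v)) :=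
  strictMono_of_deriv_pos fun l => by
    rw [(hf.hasDerivAt_ray v l).deriv]
    linarith [hf.radial_lt_one (l • v)]

theorem injective (hf : IsRadialProfile f) : Function.Injective (radialMap f) := by
  intro v w hvw
  simp only [radialMap] at hvw
  have hv : 0 < 1 - f v := by linarith [hf.lt_one v]
  have hw : 0 < 1 - f w := by linarith [hf.lt_one w]
  have h1 : w = ((1 - f w)⁻¹ * (1 - f v)) • v := by
    rw [mul_smul, hvw, smul_smul, inv_mul_cancel₀ hw.ne', one_smul]
  set l := (1 - f w)⁻¹ * (1 - f v) with hl
  by_cases hv0 : v = 0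
  · rw [h1, hv0, smul_zero]
  have h2 : l * (1 - f (l • v)) = 1 * (1 - f ((1 : ℝ) • v)) := by
    rw [← h1, one_smul, hl]
    field_simp
  have h3 := (hf.strictMono_ray v).injective h2
  rw [h1, h3, one_smul]

/-- On the ray through `y` the function `l (1 - f (l y))` vanishes at `0` and equals `a ≥ 1` at a
point beyond the support of `f`, so it takes the value `1`. -/
theorem surjective (hf : IsRadialProfile f) : Function.Surjective (radialMap f) := by
  intro y
  by_cases hy : y = 0
  · exact ⟨0, by simp [radialMap, hy]⟩
  obtain ⟨R, hR⟩ := hf.hasCompactSupport.isCompact.isBounded.subset_closedBall (0 : Euc n)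
  have hy' : 0 < ‖y‖ := norm_pos_iff.2 hy
  set a : ℝ := max 1 ((R + 1) / ‖y‖) with ha
  have ha1 : 1 ≤ a := le_max_left _ _
  have hfa : f (a • y) = 0 := by
    refine image_eq_zero_of_notMem_tsupport fun h => ?_
    have h2 := mem_closedBall_zero_iff.1 (hR h)
    rw [norm_smul, Real.norm_of_nonneg (by linarith)] at h2
    have h3 : R + 1 ≤ a * ‖y‖ := by
      rw [← div_le_iff₀ hy']
      exact le_max_right _ _
    linarith
  have hc : Continuous fun l : ℝ => l * (1 - f (l • y)) :=
    continuous_iff_continuousAt.2 fun l => (hf.hasDerivAt_ray y l).continuousAt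
  obtain ⟨l, -, hl⟩ := intermediate_value_Icc (zero_le_one.trans ha1) hc.continuousOn
    (show (1 : ℝ) ∈ Icc _ _ by simp [hfa, ha1])
  exact ⟨l • y, by
    simp only at hl
    rw [radialMap, smul_smul, mul_comm, hl, one_smul]⟩

theorem contDiff_radialMap (hf : IsRadialProfile f) : ContDiff ℝ ∞ (radialMap f) :=
  (contDiff_const.sub hf.contDiff).smul contDiff_id

/-- The derivative is `(1 - f v) id - df ⊗ v`. Applying `df` to a kernel vector `w` gives `(1 - f v
- df v) df w = 0`, hence `df w = 0` and then `w = 0`. -/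
theorem exists_hasFDerivAt (hf : IsRadialProfile f) (v : Euc n) :
    ∃ A : Euc n ≃L[ℝ] Euc n, HasFDerivAt (radialMap f) (A : Euc n →L[ℝ] Euc n) v := by
  have h1 : HasFDerivAt (radialMap f) ((1 - f v) • ContinuousLinearMap.id ℝ (Euc n) +
      (-fderiv ℝ f v).smulRight v) v :=
    ((hf.contDiff.differentiable (by simp) v).hasFDerivAt.const_sub 1).smul (hasFDerivAt_id v)
  set D := (1 - f v) • ContinuousLinearMap.id ℝ (Euc n) + (-fderiv ℝ f v).smulRight v with hD
  have hv : 0 < 1 - f v := by linarith [hf.lt_one v]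
  have hinj : Function.Injective (D : Euc n →ₗ[ℝ] Euc n) := by
    rw [injective_iff_map_eq_zero]
    intro w hw
    have hw' : (1 - f v) • w = fderiv ℝ f v w • v := by
      have : (1 - f v) • w + (-fderiv ℝ f v w) • v = 0 := hw
      rw [neg_smul] at this
      exact add_neg_eq_zero.1 this
    have h2 : (1 - f v) * fderiv ℝ f v w = fderiv ℝ f v w * fderiv ℝ f v v := by
      have := congrArg (fderiv ℝ f v) hw'
      simpa using this
    have h3 : fderiv ℝ f v w = 0 := by
      have : (1 - (f v + fderiv ℝ f v v)) * fderiv ℝ f v w = 0 := by linarith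
      rcases mul_eq_zero.1 this with h | h
      · linarith [hf.radial_lt_one v]
      · exact h
    rw [h3, zero_smul] at hw'
    exact (smul_eq_zero.1 hw').resolve_left hv.ne'
  refine ⟨(LinearEquiv.ofInjectiveEndo _ hinj).toContinuousLinearEquiv, ?_⟩
  have hAD : ((LinearEquiv.ofInjectiveEndo _ hinj).toContinuousLinearEquiv :
      Euc n →L[ℝ] Euc n) = D := by
    ext w : 1
    rfl
  rwa [hAD]

theorem contDiff_symm (hf : IsRadialProfile f) :
    ContDiff ℝ ∞ (Equiv.ofBijective _ ⟨hf.injective, hf.surjective⟩).symm := by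
  rw [contDiff_iff_contDiffAt]
  intro y
  obtain ⟨v, rfl⟩ := hf.surjective y
  obtain ⟨A, hA⟩ := hf.exists_hasFDerivAt v
  have hs : ContDiffAt ℝ ∞ (radialMap f) v := hf.contDiff_radialMap.contDiffAt
  refine (hs.to_localInverse hA (by simp)).congr_of_eventuallyEq ?_
  have hst : HasStrictFDerivAt (radialMap f) (A : Euc n →L[ℝ] Euc n) v :=
    hs.hasStrictFDerivAt' hA (by simp)
  filter_upwards [hst.eventually_right_inverse] with z hz
  rw [Equiv.symm_apply_eq]
  exact hz.symm

/-- The radial diffeomorphism `v ↦ (1 - f v) v`. -/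
def diffeo (hf : IsRadialProfile f) : Euc n ≃ₘ^∞⟮𝓡 n, 𝓡 n⟯ Euc n where
  toEquiv := Equiv.ofBijective _ ⟨hf.injective, hf.surjective⟩
  contMDiff_toFun := hf.contDiff_radialMap.contMDiff
  contMDiff_invFun := hf.contDiff_symm.contMDiff

theorem diffeo_apply (hf : IsRadialProfile f) (v : Euc n) : hf.diffeo v = (1 - f v) • v := rfl

variable {N : Type*} [TopologicalSpace N] [T2Space N] [ChartedSpace (Euc n) N]

/-- A radial map in the coordinates of a ball is joined to the identity by radial maps. -/
theorem exists_mem_diffC (hf : IsRadialProfile f) {e : OpenPartialHomeomorph (Euc n) N}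
    (he : IsSmoothPartial n e) (hfe : tsupport f ⊆ e.source) {U : Set N}
    (hU : e '' tsupport f ⊆ U) :
    ∃ φ ∈ DiffC (n := n) U, ∀ v ∈ e.source, φ (e v) = e ((1 - f v) • v) := by
  have hb : ∀ t, Real.smoothTransition t ∈ Icc (0 : ℝ) 1 := fun t =>
    ⟨Real.smoothTransition.nonneg t, Real.smoothTransition.le_one t⟩
  have hΦ : IsSmoothFamily fun t => (hf.const_mul (hb t)).diffeo := by
    have h : ContDiff ℝ ∞ fun q : ℝ × Euc n =>
        (1 - Real.smoothTransition q.1 * f q.2) • q.2 :=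
      (contDiff_const.sub ((Real.smoothTransition.contDiff.comp contDiff_fst).mul
        (hf.contDiff.comp contDiff_snd))).smul contDiff_snd
    rw [← contMDiff_iff_contDiff, modelWithCornersSelf_prod, ← chartedSpaceSelf_prod] at h
    exact h
  have hK : IsCompact (tsupport f) := hf.hasCompactSupport
  have hΦK : ∀ t, ∀ v ∉ tsupport f, (hf.const_mul (hb t)).diffeo v = v := fun t v hv => by
    rw [diffeo_apply, image_eq_zero_of_notMem_tsupport hv, mul_zero, sub_zero, one_smul]
  refine ⟨_, ⟨_, (hΦ.isDiffPath_transport he hK hfe hΦK).mono hU,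
    transportDiffeo_refl he hK hfe (hΦK 0) (Diffeomorph.ext fun v => ?_), rfl⟩, fun v hv => ?_⟩
  · rw [diffeo_apply, Real.smoothTransition.zero, zero_mul, sub_zero, one_smul]
    rfl
  · rw [transportDiffeo_apply, transportFun_of_mem e _ (e.map_source hv), e.left_inv hv,
      diffeo_apply, Real.smoothTransition.one, one_mul]

end IsRadialProfile

/-- A smooth radially decreasing cutoff function. -/
theorem exists_radial_cutoff {r r' : ℝ} (hr' : 0 < r') (hr : r' < r) :
    ∃ η : Euc n → ℝ, ContDiff ℝ ∞ η ∧ tsupport η ⊆ ball 0 r ∧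
      (∀ v ∈ closedBall (0 : Euc n) r', η v = 1) ∧ (∀ v, η v ∈ Icc (0 : ℝ) 1) ∧
      ∀ v, fderiv ℝ η v v ≤ 0 := by
  obtain ⟨R, hR1, hR2⟩ := exists_between hr
  have hd : 0 < R ^ 2 - r' ^ 2 := by nlinarith
  -- Squared norms keep `a` smooth at the origin. It is at least `1` on the ball of radius `r'` and
  -- nonpositive outside that of radius `R`.
  set a : Euc n → ℝ := fun v => (R ^ 2 - ‖v‖ ^ 2) / (R ^ 2 - r' ^ 2) with ha
  have has : ContDiff ℝ ∞ a := (contDiff_const.sub (contDiff_norm_sq ℝ)).div_const _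
  have had : ∀ v, fderiv ℝ a v v = -(2 * ‖v‖ ^ 2) / (R ^ 2 - r' ^ 2) := fun v => by
    have h1 : HasFDerivAt (fun v : Euc n => ‖v‖ ^ 2) ((2 : ℝ) • innerSL ℝ v) v := by
      rw [ofNat_smul_eq_nsmul ℝ 2 (innerSL ℝ v)]
      exact (hasStrictFDerivAt_norm_sq v).hasFDerivAt
    have h2 : HasFDerivAt a ((R ^ 2 - r' ^ 2)⁻¹ • -((2 : ℝ) • innerSL ℝ v)) v := by
      simpa [ha, div_eq_inv_mul] using (h1.const_sub (R ^ 2)).const_mul (R ^ 2 - r' ^ 2)⁻¹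
    rw [h2.fderiv]
    simp
    ring
  refine ⟨fun v => Real.smoothTransition (a v), Real.smoothTransition.contDiff.comp has, ?_, ?_,
    fun v => ⟨Real.smoothTransition.nonneg _, Real.smoothTransition.le_one _⟩, fun v => ?_⟩
  · refine (closure_minimal (t := closedBall 0 R) (fun v hv => ?_) isClosed_closedBall).trans
      (closedBall_subset_ball hR2)
    by_contra h
    rw [mem_closedBall_zero_iff, not_le] at h
    refine hv (Real.smoothTransition.zero_of_nonpos (div_nonpos_of_nonpos_of_nonneg ?_ hd.le))
    nlinarith
  · intro v hv
    rw [mem_closedBall_zero_iff] at hv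
    refine Real.smoothTransition.one_of_one_le ((one_le_div hd).2 ?_)
    nlinarith [norm_nonneg v]
  · have h1 : HasDerivAt Real.smoothTransition (deriv Real.smoothTransition (a v)) (a v) :=
      ((Real.smoothTransition.contDiff (n := (⊤ : ℕ∞))).differentiable (by simp) _).hasDerivAt
    have h2 := h1.comp_hasFDerivAt v (has.differentiable (by simp) v).hasFDerivAt
    have h3 : fderiv ℝ (fun v => Real.smoothTransition (a v)) v =
        deriv Real.smoothTransition (a v) • fderiv ℝ a v := h2.fderiv
    rw [h3, smul_apply, had, smul_eq_mul]
    exact mul_nonpos_of_nonneg_of_nonpos Real.smoothTransition.monotone.deriv_nonneg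
      (div_nonpos_of_nonpos_of_nonneg (by nlinarith [sq_nonneg ‖v‖]) hd.le)

end RadialMaps

/-! ### Products and conjugates of reachable diffeomorphisms -/

section Reachability

variable {n : ℕ} {N : Type*} [TopologicalSpace N] [ChartedSpace (Euc n) N] {U : Set N}
  {norm : (∀ y : N, TangentSpace (𝓡 n) y) → ℝ≥0∞}

theorem isReachable_refl (hnorm : IsHomogeneousNorm norm) :
    IsReachable U norm (Diffeomorph.refl (𝓡 n) N ∞) 0 := by
  refine ⟨fun _ => Diffeomorph.refl (𝓡 n) N ∞, ⟨isSmoothFamily_const _, ∅, isCompact_empty,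
    empty_subset _, fun _ _ _ _ => rfl⟩, rfl, rfl, ?_⟩
  have h : ∀ t, norm (pathVelocity (fun _ => Diffeomorph.refl (𝓡 n) N ∞) t) ≤ 0 := fun t => by
    have h1 : pathVelocity (fun _ => Diffeomorph.refl (𝓡 n) N ∞) t =
        fun y => (0 : ℝ) • (pathVelocity (fun _ => Diffeomorph.refl (𝓡 n) N ∞) t y) := by
      funext y
      refine Eq.trans ?_ (zero_smul ℝ _).symm
      exact pathVelocity_eq_zero_of_notMem (K := ∅) (fun _ _ _ => rfl) t (notMem_empty y)
    rw [h1]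
    refine (hnorm 0 _).trans ?_
    simp
  unfold pathLength
  exact (lintegral_mono fun t => h t).trans (by simp)

theorem exists_isReachable_foldr (hnorm : IsHomogeneousNorm norm) {C : ℝ≥0∞}
    (l : List (N ≃ₘ^∞⟮𝓡 n, 𝓡 n⟯ N)) (hl : ∀ ψ ∈ l, IsReachable U norm ψ C) :
    ∃ φ : N ≃ₘ^∞⟮𝓡 n, 𝓡 n⟯ N, IsReachable U norm φ (l.length * C) ∧
      (φ : N → N) = (List.map (fun ψ : N ≃ₘ^∞⟮𝓡 n, 𝓡 n⟯ N => (ψ : N → N)) l).foldr (fun f h => f ∘ h) id := by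
  induction l with
  | nil => exact ⟨Diffeomorph.refl (𝓡 n) N ∞, by simpa using isReachable_refl hnorm, rfl⟩
  | cons ψ l ih =>
    obtain ⟨φ, hφ, he⟩ := ih fun χ hχ => hl χ (List.mem_cons_of_mem _ hχ)
    refine ⟨φ.trans ψ, ?_, ?_⟩
    · refine (hφ.trans hnorm (hl ψ List.mem_cons_self)).mono (le_of_eq ?_)
      rw [List.length_cons, Nat.cast_succ, add_mul, one_mul]
    · rw [List.map_cons, List.foldr_cons, ← he]
      rfl

/-- The conjugating map `h` need not be supported in `U`; it only has to carry the support of the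
path there. -/
theorem conj_mem_diffC {ψ : N ≃ₘ^∞⟮𝓡 n, 𝓡 n⟯ N} {Ψ : ℝ → (N ≃ₘ^∞⟮𝓡 n, 𝓡 n⟯ N)}
    (hΨ : IsSmoothFamily Ψ) {K : Set N} (hK : IsCompact K) (hΨK : ∀ t, ∀ x ∉ K, Ψ t x = x)
    (hΨ0 : Ψ 0 = Diffeomorph.refl (𝓡 n) N ∞) (hΨ1 : Ψ 1 = ψ) (h : N ≃ₘ^∞⟮𝓡 n, 𝓡 n⟯ N)
    (hKU : h '' K ⊆ U) : h.symm.trans (ψ.trans h) ∈ DiffC U := by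
  refine ⟨fun t => h.symm.trans ((Ψ t).trans h), ⟨(isSmoothFamily_const h.symm).trans
    (hΨ.trans (isSmoothFamily_const h)), h '' K, hK.image h.continuous, hKU, fun t _ x hx => ?_⟩,
    ?_, by simp only [hΨ1]⟩
  · have : h.symm x ∉ K := fun hx' => hx ⟨_, hx', h.apply_symm_apply x⟩
    change h (Ψ t (h.symm x)) = x
    rw [hΨK t _ this, h.apply_symm_apply]
  · simp only [hΨ0]
    exact Diffeomorph.ext fun x => h.apply_symm_apply x

end Reachability

/-! ### Contraction towards the centre by radial pulls -/

section Contraction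

variable {n : ℕ} {M : Type*} [TopologicalSpace M] [T2Space M] [ChartedSpace (Euc n) M]

/-- Dividing the bound at `u • v` by `u` gives `|DF (u • v) v| ≤ L ‖v‖ ≤ L r` along the ray; the
mean value inequality does the rest. -/
theorem abs_sub_le_of_radial_bound {F : Euc n → ℝ} {r L : ℝ} (hL : 0 ≤ L)
    (hF : ∀ v ∈ ball (0 : Euc n) r, DifferentiableAt ℝ F v)
    (hFL : ∀ v ∈ ball (0 : Euc n) r, |fderiv ℝ F v v| ≤ L * ‖v‖) {v : Euc n}
    (hv : v ∈ ball (0 : Euc n) r) {s : ℝ} (hs : s ∈ Ioc (0 : ℝ) 1) :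
    |F (s • v) - F v| ≤ L * r * (1 - s) := by
  have hmem : ∀ u ∈ Icc s 1, u • v ∈ ball (0 : Euc n) r := fun u hu => by
    rw [mem_ball_zero_iff] at hv ⊢
    rw [norm_smul, Real.norm_of_nonneg (hs.1.le.trans hu.1)]
    exact (mul_le_of_le_one_left (norm_nonneg v) hu.2).trans_lt hv
  have hd : ∀ u ∈ Icc s 1, HasDerivWithinAt (fun u : ℝ => F (u • v)) (fderiv ℝ F (u • v) v)
      (Icc s 1) u := fun u hu => by
    have h1 : HasDerivAt (fun u : ℝ => u • v) v u := by simpa using (hasDerivAt_id u).smul_const v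
    exact (HasFDerivAt.comp_hasDerivAt u (hF _ (hmem u hu)).hasFDerivAt h1).hasDerivWithinAt
  have hb : ∀ u ∈ Icc s 1, ‖fderiv ℝ F (u • v) v‖ ≤ L * r := fun u hu => by
    have hu0 : 0 < u := hs.1.trans_le hu.1
    have h1 := hFL _ (hmem u hu)
    rw [map_smul, smul_eq_mul, abs_mul, abs_of_pos hu0, norm_smul, Real.norm_of_nonneg hu0.le] at h1
    have h2 : |fderiv ℝ F (u • v) v| ≤ L * ‖v‖ :=
      le_of_mul_le_mul_left (h1.trans_eq (by ring)) hu0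
    exact h2.trans (mul_le_mul_of_nonneg_left (mem_ball_zero_iff.1 hv).le hL)
  have h := (convex_Icc s 1).norm_image_sub_le_of_norm_hasDerivWithin_le hd hb
    (right_mem_Icc.2 hs.2) (left_mem_Icc.2 hs.2)
  simp only [one_smul] at h
  rwa [Real.norm_eq_abs, Real.norm_eq_abs, abs_of_nonpos (by linarith [hs.2] : s - 1 ≤ 0),
    neg_sub] at h

variable {norm : (∀ y : M, TangentSpace (𝓡 n) y) → ℝ≥0∞}

/-- A point with `χ j ≥ δ` initially might be moved by other pulls before the turn of `j`. Either
these already contracted it by the factor `1 - κ`, or it moved so little that `χ j ≥ δ / 2` still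
holds, and pull `j` contracts it enough. -/
theorem exists_isReachable_pull_list (hnorm : IsHomogeneousNorm norm) {J : Type*}
    {c : Euc n → M} {χ : J → M → ℝ} {r r' L τ δ κ : ℝ} {C : ℝ≥0∞} (hr : r' < r) (hL : 0 ≤ L)
    (hχ : ∀ j y, χ j y ∈ Icc (0 : ℝ) 1) (hτ : 0 < τ) (hτ1 : τ < 1)
    (hd : ∀ j, ∀ v ∈ ball (0 : Euc n) r, DifferentiableAt ℝ (χ j ∘ c) v)
    (hdL : ∀ j, ∀ v ∈ ball (0 : Euc n) r, |fderiv ℝ (χ j ∘ c) v v| ≤ L * ‖v‖)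
    (hstep : ∀ j, ∃ φ : M ≃ₘ^∞⟮𝓡 n, 𝓡 n⟯ M, IsReachable univ norm φ C ∧
      ∀ v ∈ closedBall (0 : Euc n) r', φ (c v) = c ((1 - τ * χ j (c v)) • v))
    (hκ : κ ≤ τ * (δ / 2)) (hκL : L * r * κ ≤ δ / 2) (l : List J) :
    ∃ φ : M ≃ₘ^∞⟮𝓡 n, 𝓡 n⟯ M, IsReachable univ norm φ (l.length * C) ∧
      ∀ v ∈ closedBall (0 : Euc n) r', ∃ s ∈ Ioc (0 : ℝ) 1, φ (c v) = c (s • v) ∧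
        ∀ j ∈ l, δ ≤ χ j (c v) → s ≤ 1 - κ := by
  induction l with
  | nil =>
    refine ⟨Diffeomorph.refl (𝓡 n) M ∞, by simpa using isReachable_refl hnorm, fun v _ =>
      ⟨1, by simp, ?_, by simp⟩⟩
    rw [one_smul]
    rfl
  | cons j l ih =>
    obtain ⟨φ, hφ, hφv⟩ := ih
    obtain ⟨ψ, hψ, hψv⟩ := hstep j
    refine ⟨φ.trans ψ, ?_, fun v hv => ?_⟩
    · refine (hφ.trans hnorm hψ).mono (le_of_eq ?_)
      rw [List.length_cons, Nat.cast_succ, add_mul, one_mul]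
    · obtain ⟨s, hs, hsv, hsl⟩ := hφv v hv
      have hsv' : s • v ∈ closedBall (0 : Euc n) r' := by
        rw [mem_closedBall_zero_iff] at hv ⊢
        rw [norm_smul, Real.norm_of_nonneg hs.1.le]
        exact (mul_le_of_le_one_left (norm_nonneg v) hs.2).trans hv
      have hχj := hχ j (c (s • v))
      have h1 : 0 < 1 - τ * χ j (c (s • v)) := by nlinarith [hχj.1, hχj.2]
      have h2 : 1 - τ * χ j (c (s • v)) ≤ 1 := by nlinarith [hχj.1, hχj.2]
      refine ⟨(1 - τ * χ j (c (s • v))) * s, ⟨mul_pos h1 hs.1, mul_le_one₀ h2 hs.1.le hs.2⟩, ?_,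
        fun i hi hiv => ?_⟩
      · change ψ (φ (c v)) = _
        rw [hsv, hψv _ hsv', smul_smul]
      · by_cases hsκ : s ≤ 1 - κ
        · exact (mul_le_of_le_one_left hs.1.le h2).trans hsκ
        rcases List.mem_cons.1 hi with rfl | hi
        -- Here `1 - s < κ`, so `χ i` has dropped by at most `L r κ ≤ δ / 2`.
        · rw [not_le] at hsκ
          have hvb : v ∈ ball (0 : Euc n) r := closedBall_subset_ball hr hv
          have hr0 : 0 ≤ r := ((norm_nonneg v).trans_lt (mem_ball_zero_iff.1 hvb)).le
          have h3 := (abs_le.1 (abs_sub_le_of_radial_bound hL (hd i) (hdL i) hvb hs)).1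
          simp only [Function.comp] at h3
          have h4 : L * r * (1 - s) ≤ L * r * κ :=
            mul_le_mul_of_nonneg_left (by linarith) (mul_nonneg hL hr0)
          have h5 : δ / 2 ≤ χ i (c (s • v)) := by linarith
          have h6 : τ * (δ / 2) ≤ τ * χ i (c (s • v)) := mul_le_mul_of_nonneg_left h5 hτ.le
          refine (mul_le_of_le_one_right h1.le hs.2).trans ?_
          linarith
        · exact absurd (hsl i hi hiv) hsκ

theorem exists_isReachable_pow (hnorm : IsHomogeneousNorm norm) {c : Euc n → M} {r' ε : ℝ}
    {D : ℝ≥0∞} (hε : 0 ≤ ε) {φ : M ≃ₘ^∞⟮𝓡 n, 𝓡 n⟯ M} (hφ : IsReachable univ norm φ D)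
    (hφv : ∀ v ∈ closedBall (0 : Euc n) r', ∃ s ∈ Ioc (0 : ℝ) 1, φ (c v) = c (s • v) ∧ s ≤ ε)
    (k : ℕ) :
    ∃ ψ : M ≃ₘ^∞⟮𝓡 n, 𝓡 n⟯ M, IsReachable univ norm ψ (k * D) ∧
      ∀ v ∈ closedBall (0 : Euc n) r', ∃ s ∈ Ioc (0 : ℝ) 1, ψ (c v) = c (s • v) ∧ s ≤ ε ^ k := by
  induction k with
  | zero =>
    refine ⟨Diffeomorph.refl (𝓡 n) M ∞, by simpa using isReachable_refl hnorm, fun v _ =>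
      ⟨1, by simp, ?_, by simp⟩⟩
    rw [one_smul]
    rfl
  | succ k ih =>
    obtain ⟨ψ, hψ, hψv⟩ := ih
    refine ⟨ψ.trans φ, ?_, fun v hv => ?_⟩
    · refine (hψ.trans hnorm hφ).mono (le_of_eq ?_)
      rw [Nat.cast_succ, add_mul, one_mul]
    · obtain ⟨s, hs, hsv, hsε⟩ := hψv v hv
      have hsv' : s • v ∈ closedBall (0 : Euc n) r' := by
        rw [mem_closedBall_zero_iff] at hv ⊢
        rw [norm_smul, Real.norm_of_nonneg hs.1.le]
        exact (mul_le_of_le_one_left (norm_nonneg v) hs.2).trans hv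
      obtain ⟨s', hs', hsv2, hsε'⟩ := hφv _ hsv'
      refine ⟨s' * s, ⟨mul_pos hs'.1 hs.1, mul_le_one₀ hs'.2 hs.1.le hs.2⟩, ?_, ?_⟩
      · change φ (ψ (c v)) = _
        rw [hsv, hsv2, smul_smul]
      · rw [pow_succ, mul_comm]
        exact mul_le_mul hsε hsε' hs'.1.le (pow_nonneg hε k)

variable [IsManifold (𝓡 n) ∞ M]
  {g : ContMDiffRiemannianMetric (𝓡 n) ∞ (Euc n) (fun x : M => TangentSpace (𝓡 n) x)}

theorem NormalBall.contDiffOn_comp_coord (A : NormalBall g) {χ : M → ℝ}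
    (hχ : ContMDiff (𝓡 n) 𝓘(ℝ, ℝ) ∞ χ) :
    ContDiffOn ℝ ∞ (χ ∘ A.coord) (ball (0 : Euc n) A.radius) := by
  rw [← A.source_eq]
  exact (hχ.comp_contMDiffOn A.contMDiffOn_coord).contDiffOn

/-- The flow-like map pulling the points of the support of `χ` towards the centre of the ball. -/
theorem NormalBall.exists_pull (A : NormalBall g) {χ : M → ℝ}
    (hχ : ContMDiff (𝓡 n) 𝓘(ℝ, ℝ) ∞ χ) (hχ01 : ∀ y, χ y ∈ Icc (0 : ℝ) 1) {L τ r' : ℝ} (hL : 0 ≤ L)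
    (hdL : ∀ v ∈ ball (0 : Euc n) A.radius, |fderiv ℝ (χ ∘ A.coord) v v| ≤ L * ‖v‖)
    (hτ : 0 < τ) (hτL : τ * (1 + L * A.radius) < 1) (hr' : 0 < r') (hr : r' < A.radius)
    {U : Set M} (hU : tsupport χ ⊆ U) :
    ∃ φ ∈ DiffC (n := n) U, ∀ v ∈ closedBall (0 : Euc n) r',
      φ (A.coord v) = A.coord ((1 - τ * χ (A.coord v)) • v) := by
  obtain ⟨η, hηs, hηb, hη1, hη01, hηd⟩ := exists_radial_cutoff (n := n) hr' hr
  have hop : IsOpen (ball (0 : Euc n) A.radius) := isOpen_ball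
  have hcs := A.contDiffOn_comp_coord hχ
  set f : Euc n → ℝ := fun v => τ * (η v * χ (A.coord v)) with hf
  have hfη : tsupport f ⊆ tsupport η := closure_mono fun v hv => by
    contrapose! hv
    simp [hf, Function.notMem_support.1 hv]
  have hfb := hfη.trans hηb
  have hLr : 0 ≤ L * A.radius := mul_nonneg hL A.radius_pos.le
  have hτ1 : τ < 1 := by nlinarith
  have hprof : IsRadialProfile f := by
    refine ⟨contDiff_of_contDiffOn_of_tsupport_subset hop
      (contDiffOn_const.mul (hηs.contDiffOn.mul hcs)) hfb,
      (isCompact_closedBall (0 : Euc n) A.radius).of_isClosed_subset (isClosed_tsupport f)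
        (hfb.trans ball_subset_closedBall), fun v => ?_, fun v => ?_⟩
    · have h1 : η v * χ (A.coord v) ≤ 1 := mul_le_one₀ (hη01 v).2 (hχ01 _).1 (hχ01 _).2
      exact (mul_le_of_le_one_right hτ.le h1).trans_lt hτ1
    · by_cases hv : v ∈ ball (0 : Euc n) A.radius
      · have h1 : HasFDerivAt f (τ • (η v • fderiv ℝ (χ ∘ A.coord) v +
            χ (A.coord v) • fderiv ℝ η v)) v :=
          (((hηs.differentiable (by simp) v).hasFDerivAt.mul
            ((hcs.contDiffAt (hop.mem_nhds hv)).differentiableAt (by simp)).hasFDerivAt).const_mul τ)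
        rw [h1.fderiv]
        change τ * (η v * χ (A.coord v)) + τ * (η v * fderiv ℝ (χ ∘ A.coord) v v +
          χ (A.coord v) * fderiv ℝ η v v) < 1
        have h2 : η v * χ (A.coord v) ≤ 1 := mul_le_one₀ (hη01 v).2 (hχ01 _).1 (hχ01 _).2
        have h3 : χ (A.coord v) * fderiv ℝ η v v ≤ 0 :=
          mul_nonpos_of_nonneg_of_nonpos (hχ01 _).1 (hηd v)
        have h4 : fderiv ℝ (χ ∘ A.coord) v v ≤ L * A.radius :=
          (le_abs_self _).trans ((hdL v hv).trans
            (mul_le_mul_of_nonneg_left (mem_ball_zero_iff.1 hv).le hL))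
        have h5 : η v * fderiv ℝ (χ ∘ A.coord) v v ≤ L * A.radius :=
          (mul_le_mul_of_nonneg_left h4 (hη01 v).1).trans
            (mul_le_of_le_one_left hLr (hη01 v).2)
        have h6 : τ * (η v * χ (A.coord v) + (η v * fderiv ℝ (χ ∘ A.coord) v v +
          χ (A.coord v) * fderiv ℝ η v v)) ≤ τ * (1 + L * A.radius) :=
          mul_le_mul_of_nonneg_left (by linarith) hτ.le
        linarith
      · have hvf : v ∉ tsupport f := fun h => hv (hfb h)
        rw [image_eq_zero_of_notMem_tsupport hvf, fderiv_of_notMem_tsupport ℝ hvf]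
        simp
  -- By continuity of the coordinates the support of the pull lies in `tsupport χ`; the ball `A`
  -- itself plays no role in `U`.
  have hfU : A.coord '' tsupport f ⊆ U := by
    rintro _ ⟨v, hv, rfl⟩
    refine hU ?_
    have hvb : v ∈ A.coord.source := by
      rw [A.source_eq]
      exact hfb hv
    refine mem_closure_image (s := Function.support f) (f := A.coord)
      (A.coord.continuousAt hvb) hv |> closure_mono ?_
    rintro _ ⟨w, hw, rfl⟩
    intro h0
    exact hw (by simp [hf, h0])
  obtain ⟨φ, hφ, hφv⟩ := hprof.exists_mem_diffC
    ⟨A.contMDiffOn_coord, A.contMDiffOn_symm⟩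
    (by rw [A.source_eq]; exact hfb) hfU
  refine ⟨φ, hφ, fun v hv => ?_⟩
  rw [hφv v (by rw [A.source_eq]; exact closedBall_subset_ball hr hv)]
  simp [hf, hη1 v hv]

end Contraction

/-! ### Uniform bounds for the balls of a cover -/

section Cover

variable {n : ℕ} {M : Type*} [TopologicalSpace M] [T2Space M] [CompactSpace M]
  [ChartedSpace (Euc n) M] [IsManifold (𝓡 n) ∞ M]
  {g : ContMDiffRiemannianMetric (𝓡 n) ∞ (Euc n) (fun x : M => TangentSpace (𝓡 n) x)}

/-- A compact subset of a normal ball is contained in a concentric smaller ball. -/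
theorem NormalBall.exists_radius (A : NormalBall g) {K : Set M} (hK : IsCompact K)
    (hKA : K ⊆ A.carrier) :
    ∃ R, A.radius / 2 < R ∧ R < A.radius ∧ K ⊆ A.coord '' ball 0 R := by
  have hc : IsCompact (A.coord.symm '' K) :=
    hK.image_of_continuousOn (A.coord.symm.continuousOn.mono hKA)
  have hs : A.coord.symm '' K ⊆ ball 0 A.radius := by
    rintro _ ⟨y, hy, rfl⟩
    rw [← A.source_eq]
    exact A.coord.map_target (hKA hy)
  obtain ⟨R, hR, hRs⟩ := exists_lt_subset_ball hc.isClosed hs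
  -- Keeping the radius above one half lets a contraction by `1 / 2` bring the whole ball inside.
  obtain ⟨R', hR'1, hR'2⟩ := exists_between (max_lt hR (half_lt_self A.radius_pos))
  refine ⟨R', (le_max_right _ _).trans_lt hR'1, hR'2, fun y hy => ?_⟩
  exact ⟨A.coord.symm y, ball_subset_ball ((le_max_left _ _).trans hR'1.le) (hRs ⟨y, hy, rfl⟩),
    A.coord.right_inv (hKA hy)⟩

variable {s p : ℝ} {ι : Type*} [Fintype ι] {B : ι → NormalBall g}
  {ρ : SmoothPartitionOfUnity ι (𝓡 n) M univ}

/-- Diffeomorphisms supported in a smaller concentric ball are reachable at bounded cost. -/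
theorem NormalBall.exists_isReachable (hs : 0 ≤ s) (hp : 1 ≤ p)
    (hρ : ρ.IsSubordinate fun α => (B α).carrier)
    (hball : diffDiam (ball (0 : Euc n) 1) (fun u => sobolevNorm (F := Euc n) s p u) < ⊤)
    (A : NormalBall g) {R : ℝ} (hR0 : 0 < R) (hR : R < A.radius) :
    ∃ C : ℝ≥0∞, C ≠ ⊤ ∧ ∀ ψ ∈ DiffC (A.coord '' ball (0 : Euc n) R),
      IsReachable univ (manifoldSobolevNorm B ρ s p) ψ C := by
  -- Scaling by `R` carries the closed unit ball to the closed ball of radius `R`, which is compact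
  -- inside the coordinate domain.
  set σ : OpenPartialHomeomorph (Euc n) (Euc n) :=
    (Homeomorph.smulOfNeZero R hR0.ne').toOpenPartialHomeomorph with hσ
  have hσs : IsSmoothPartial n σ := by
    constructor
    · have : ContDiff ℝ ∞ fun v : Euc n => R • v := contDiff_const_smul R
      exact this.contMDiff.contMDiffOn
    · have : ContDiff ℝ ∞ fun v : Euc n => R⁻¹ • v := contDiff_const_smul R⁻¹
      exact this.contMDiff.contMDiffOn
  have he : IsSmoothPartial n (σ.trans A.coord) := hσs.trans A.isSmoothPartial
  have hσv : ∀ v, σ v = R • v := fun v => rfl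
  have hQ : closedBall (0 : Euc n) 1 ⊆ (σ.trans A.coord).source := fun v hv => by
    rw [OpenPartialHomeomorph.trans_source, A.source_eq]
    refine ⟨mem_univ v, ?_⟩
    rw [mem_closedBall_zero_iff] at hv
    rw [mem_preimage, hσv, mem_ball_zero_iff, norm_smul, Real.norm_of_nonneg hR0.le]
    nlinarith
  obtain ⟨C, hC, h⟩ := exists_isReachable_of_diffDiam_lt_top hs hp B ρ hρ hball he hQ
  refine ⟨C, hC, fun ψ hψ => h ψ (DiffC.mono ?_ hψ)⟩
  rintro _ ⟨v, hv, rfl⟩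
  refine ⟨R⁻¹ • v, ?_, ?_⟩
  · rw [mem_ball_zero_iff] at hv ⊢
    rwa [norm_smul, Real.norm_of_nonneg (inv_nonneg.2 hR0.le), inv_mul_lt_one₀ hR0]
  · rw [OpenPartialHomeomorph.coe_trans, Function.comp, hσv, smul_inv_smul₀ hR0.ne']

/-- Diffeomorphisms supported in one of the balls of a cover are reachable at bounded cost: they
are conjugate to diffeomorphisms supported in a smaller ball, by products of a bounded number of
radial maps, each of which is supported in a smaller ball of the cover. -/
theorem exists_isReachable_of_mem_diffC_carrier (hs : 0 ≤ s) (hp : 1 ≤ p)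
    (hρ : ρ.IsSubordinate fun α => (B α).carrier)
    (hball : diffDiam (ball (0 : Euc n) 1) (fun u => sobolevNorm (F := Euc n) s p u) < ⊤)
    {m : ℕ} (A : Fin m → NormalBall g) (hA : (⋃ α, (A α).carrier) = univ) :
    ∃ C : ℝ≥0∞, C ≠ ⊤ ∧ ∀ α, ∀ ψ ∈ DiffC (A α).carrier,
      IsReachable univ (manifoldSobolevNorm B ρ s p) ψ C := by
  have hnorm : IsHomogeneousNorm (manifoldSobolevNorm B ρ s p) :=
    isHomogeneousNorm_manifoldSobolevNorm B ρ s hp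
  obtain ⟨χ, hχ⟩ := SmoothPartitionOfUnity.exists_isSubordinate (𝓡 n) (isClosed_univ (X := M))
    (fun α => (A α).carrier) (fun α => (A α).coord.open_target) hA.ge
  choose R hR1 hR2 hRχ using fun α => (A α).exists_radius (isClosed_tsupport (χ α)).isCompact (hχ α)
  have hR0 : ∀ α, 0 < R α := fun α => (half_pos (A α).radius_pos).trans (hR1 α)
  choose C hC hCr using fun α => (A α).exists_isReachable hs hp hρ hball (hR0 α) (hR2 α)
  set D : ℝ≥0∞ := ∑ α, C α with hD
  have hDt : D ≠ ⊤ := (ENNReal.sum_lt_top.2 fun α _ => (hC α).lt_top).ne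
  have hCD : ∀ α, C α ≤ D := fun α => Finset.single_le_sum (fun _ _ => zero_le) (Finset.mem_univ α)
  have hχ01 : ∀ α y, χ α y ∈ Icc (0 : ℝ) 1 := fun α y => ⟨χ.nonneg α y, χ.le_one α y⟩
  choose L₀ hL₀ hL₀d using fun α => NormalBall.exists_abs_fderiv_radial_le g (χ α).contMDiff
  set L : ℝ := ∑ α, L₀ α with hLdef
  have hL : 0 ≤ L := Finset.sum_nonneg fun α _ => hL₀ α
  have hdL : ∀ α j, ∀ v ∈ ball (0 : Euc n) (A α).radius,
      |fderiv ℝ (χ j ∘ (A α).coord) v v| ≤ L * ‖v‖ := fun α j v hv =>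
    (hL₀d j (A α) v hv).trans (mul_le_mul_of_nonneg_right
      (Finset.single_le_sum (fun α _ => hL₀ α) (Finset.mem_univ j)) (norm_nonneg v))
  have hloc : ∀ α, ∃ C : ℝ≥0∞, C ≠ ⊤ ∧ ∀ ψ ∈ DiffC (A α).carrier,
      IsReachable univ (manifoldSobolevNorm B ρ s p) ψ C := by
    intro α
    set r := (A α).radius with hr
    have hr0 : 0 < r := (A α).radius_pos
    have hLr : 0 ≤ L * r := mul_nonneg hL hr0.le
    have hm : (0 : ℝ) < m := by exact_mod_cast α.pos
    -- Chosen so that `τ (1 + L r) = 1 / 2`, which also gives `L r κ ≤ δ / 2` below. None of `τ`,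
    -- `δ`, `κ` and `k` depends on the diffeomorphism `ψ`.
    set τ : ℝ := 1 / (2 * (1 + L * r)) with hτdef
    have hτ : 0 < τ := by positivity
    have hτL : τ * (1 + L * r) < 1 := by
      have : τ * (1 + L * r) = 1 / 2 := by rw [hτdef]; field_simp
      rw [this]; norm_num
    have hτ1 : τ < 1 := by nlinarith
    set δ : ℝ := 1 / m with hδdef
    have hδ : 0 < δ := by positivity
    have hδ1 : δ ≤ 1 := by
      rw [hδdef, div_le_one hm]
      exact_mod_cast α.pos
    set κ : ℝ := τ * (δ / 2) with hκdef
    have hκ : 0 < κ := by positivity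
    have hκ1 : κ < 1 := by nlinarith
    have hκL : L * r * κ ≤ δ / 2 := by
      have : L * r * κ = (τ * (L * r)) * (δ / 2) := by rw [hκdef]; ring
      rw [this]
      exact mul_le_of_le_one_left (by positivity) (by nlinarith)
    obtain ⟨k, hk⟩ := exists_pow_lt_of_lt_one (show (0 : ℝ) < 1 / 2 by norm_num)
      (show 1 - κ < 1 by linarith)
    -- The `m` functions sum to `1`, so they cannot all lie below `1 / m`.
    have hsel : ∀ y, ∃ j, δ ≤ χ j y := by
      intro y
      by_contra! hcon
      have h1 : ∑ j, χ j y = 1 := by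
        rw [← finsum_eq_sum_of_fintype]
        exact χ.sum_eq_one (mem_univ y)
      have h2 : ∑ j, χ j y < ∑ _j : Fin m, δ :=
        Finset.sum_lt_sum_of_nonempty ⟨α, Finset.mem_univ α⟩ fun j _ => hcon j
      rw [h1, Finset.sum_const, Finset.card_univ, Fintype.card_fin, nsmul_eq_mul, hδdef,
        mul_one_div_cancel hm.ne'] at h2
      exact lt_irrefl _ h2
    set E : ℝ≥0∞ := k * ((List.finRange m).length * D) with hE
    have hEt : E ≠ ⊤ := ENNReal.mul_ne_top (by simp) (ENNReal.mul_ne_top (by simp) hDt)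
    -- The cost of `h`, of the conjugate of `ψ` in the smaller ball, and of `h⁻¹`.
    refine ⟨E + (C α + E), by simp [hEt, hC α], fun ψ hψ => ?_⟩
    obtain ⟨Ψ, hΨ, ⟨K, hK, hKA, hΨK⟩, hΨ0, hΨ1⟩ := exists_isSmoothFamily_of_mem_diffC hψ
    -- Only `r'`, and with it the pulls themselves, depends on the support of `ψ`; their cost does
    -- not.
    obtain ⟨r', hr'1, hr'2, hKr'⟩ := (A α).exists_radius hK hKA
    have hr'0 : 0 < r' := (half_pos hr0).trans hr'1
    obtain ⟨φ, hφ, hφv⟩ := exists_isReachable_pull_list hnorm (c := (A α).coord)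
      (χ := fun j => χ j) (r := r) (r' := r') (τ := τ) (δ := δ) (κ := κ) (C := D) hr'2 hL hχ01 hτ
      hτ1 (fun j v hv => (((A α).contDiffOn_comp_coord (χ j).contMDiff).contDiffAt
        (isOpen_ball.mem_nhds hv)).differentiableAt (by simp)) (hdL α) (fun j => by
        obtain ⟨φ, hφ, hφv⟩ := (A α).exists_pull (χ j).contMDiff (hχ01 j) hL (hdL α j) hτ hτL
          hr'0 hr'2 (hRχ j)
        exact ⟨φ, (hCr j φ hφ).mono (hCD j), hφv⟩) le_rfl hκL (List.finRange m)
    obtain ⟨h, hh, hhv⟩ := exists_isReachable_pow hnorm (c := (A α).coord) (r' := r')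
      (ε := 1 - κ) (by linarith) hφ (fun v hv => by
        obtain ⟨s, hs, hsv, hsl⟩ := hφv v hv
        obtain ⟨j, hj⟩ := hsel ((A α).coord v)
        exact ⟨s, hs, hsv, hsl j (List.mem_finRange j) hj⟩) k
    have hhK : h '' K ⊆ (A α).coord '' ball 0 (R α) := by
      rintro _ ⟨y, hy, rfl⟩
      obtain ⟨v, hv, rfl⟩ := hKr' hy
      obtain ⟨s, hs, hsv, hsk⟩ := hhv v (ball_subset_closedBall hv)
      refine ⟨s • v, ?_, hsv.symm⟩
      rw [mem_ball_zero_iff] at hv ⊢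
      rw [norm_smul, Real.norm_of_nonneg hs.1.le]
      have h1 : s * ‖v‖ ≤ 1 / 2 * r :=
        mul_le_mul (hsk.trans hk.le) (hv.le.trans hr'2.le) (norm_nonneg v) (by norm_num)
      linarith [hR1 α]
    have hconj := hCr α _ (conj_mem_diffC hΨ hK hΨK hΨ0 hΨ1 h hhK)
    have hfin := hh.trans hnorm (hconj.trans hnorm (hh.symm hnorm))
    have heq : h.trans ((h.symm.trans (ψ.trans h)).trans h.symm) = ψ :=
      Diffeomorph.ext fun x => by
        change h.symm (h (ψ (h.symm (h x)))) = ψ x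
        rw [h.symm_apply_apply, h.symm_apply_apply]
    rwa [heq] at hfin
  choose C' hC' hCr' using hloc
  refine ⟨∑ α, C' α, (ENNReal.sum_lt_top.2 fun α _ => (hC' α).lt_top).ne, fun α ψ hψ => ?_⟩
  exact (hCr' α ψ hψ).mono (Finset.single_le_sum (fun _ _ => zero_le) (Finset.mem_univ α))

end Cover

end

/-! ### Finiteness of the diameter -/

theorem mainTheorem6 {n : ℕ} {M : Type*} [TopologicalSpace M] [T2Space M] [CompactSpace M]
    [ChartedSpace (Euc n) M] [IsManifold (𝓡 n) ∞ M]
    (g : ContMDiffRiemannianMetric (𝓡 n) ∞ (Euc n) (fun x : M => TangentSpace (𝓡 n) x))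
    -- the uniform fragmentation property holds with respect to some finite cover
    (hfrag : ∃ (m : ℕ) (A : Fin m → NormalBall g),
      (⋃ α, (A α).carrier) = univ ∧ UniformFragmentation A)
    -- the order and the exponent of the Sobolev norm
    (s p : ℝ) (hs : 0 ≤ s) (hp : 1 ≤ p)
    -- the finite cover and the partition of unity by which the norm on `M` is defined
    {ι : Type*} [Fintype ι] (B : ι → NormalBall g)
    (ρ : SmoothPartitionOfUnity ι (𝓡 n) M univ)
    (hρ : ρ.IsSubordinate fun α => (B α).carrier)
    -- the diameter of the group of the unit ball is finite
    (hball : diffDiam (ball (0 : Euc n) 1) (fun u => sobolevNorm (F := Euc n) s p u) < ⊤) :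
    diffDiam (univ : Set M) (manifoldSobolevNorm B ρ s p) < ⊤ := by
  obtain ⟨m, A, hA, K, -, hK⟩ := hfrag
  obtain ⟨C, hC, hCr⟩ := exists_isReachable_of_mem_diffC_carrier hs hp hρ hball A hA
  have hnorm : IsHomogeneousNorm (manifoldSobolevNorm B ρ s p) :=
    isHomogeneousNorm_manifoldSobolevNorm B ρ s hp
  have hreach : ∀ φ ∈ DiffC (n := n) (univ : Set M),
      IsReachable univ (manifoldSobolevNorm B ρ s p) φ (K * C) := by
    intro φ hφ
    obtain ⟨ψ, hψ, hφψ⟩ := hK φ hφ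
    obtain ⟨φ', hφ', he⟩ := exists_isReachable_foldr (U := univ) (C := C) hnorm (List.ofFn ψ)
      (fun χ hχ => by
        obtain ⟨i, rfl⟩ := (List.mem_ofFn' ψ χ).1 hχ
        obtain ⟨α, hα⟩ := hψ i
        exact hCr α _ hα)
    rw [List.map_ofFn] at he
    have : φ' = φ := Diffeomorph.ext fun x => congrFun (he.trans hφψ.symm) x
    rwa [this, List.length_ofFn] at hφ'
  have hKC : (K : ℝ≥0∞) * C < ⊤ := ENNReal.mul_lt_top (by simp) hC.lt_top
  -- By right invariance the distance is governed by `φ₁ ∘ φ₀⁻¹`, and each factor costs at most `K *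
  -- C`.
  refine lt_of_le_of_lt (b := (K : ℝ≥0∞) * C + K * C) ?_ (ENNReal.add_lt_top.2 ⟨hKC, hKC⟩)
  exact iSup₂_le fun φ₀ h₀ => iSup₂_le fun φ₁ h₁ => diffDist_le_of_isReachable
    (((hreach φ₀ h₀).symm hnorm).trans hnorm (hreach φ₁ h₁))
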